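/- Let $J\subseteq\mathbb R$ be a nonempty open interval and $X$ a complete Hausdorff locally convex topological vector space over $\mathbb C$. Let $\{m_t : X\hat\otimes X\to X\}_{t\in J}$ be a smooth one-parameter deformation of algebras, i.e. every $m_t$ is an associative product and there is a continuous linear map $\tilde m: X\hat\otimes X\to C^\infty(J,X)$ (completed projective tensor product; topology of uniform convergence of all derivatives on compact sets) with $m_t(z)=\tilde m(z)(t)$. Let $A=A_J=C^\infty(J,X)$ be its algebra of sections, with the product $(ab)(t)=m_t(a(t),b(t))$, a locally convex algebra over $R=C^\infty(J)$. Let $A_+=A\oplus R$ be the unitization over $R$, with unit $e$, and let $C_0(A)=A$ and $C_n(A)=A_+\hat\otimes_R A^{\hat\otimes_R n}$ for $n\ge 1$. On elementary tensors $(a_0,\dots,a_n)$ put $$b(a_0,\dots,a_n)=\sum_{j=0}^{n-1}(-1)^j(a_0,\dots,a_ja_{j+1},\dots,a_n)+(-1)^n(a_na_0,a_1,\dots,a_{n-1}),$$ $$B(a_0,\dots,a_n)=\sum_{j=0}^n(-1)^{jn}(e,a_j,\dots,a_n,a_0,\dots,a_{j-1})\ \ (a_0\in A),\qquad B(e,a_1,\dots,a_n)=0.$$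 $HP_0(A)$ and $HP_1(A)$ are the homology groups of the $\mathbb Z/2$-graded complex $C_{\rm even}(A)=\prod_n C_{2n}(A)\rightleftarrows C_{\rm odd}(A)=\prod_n C_{2n+1}(A)$ with differential $b+B$. Let $\nabla:A\to A$ be any connection: a continuous $\mathbb C$-linear map with $\nabla(f a)=f'a+f\nabla a$ for $f\in R$, $a\in A$. Put $E(a_1,a_2)=\nabla(a_1)a_2+a_1\nabla(a_2)-\nabla(a_1a_2)$ and $\nabla e=0$, and let $$L_\nabla(a_0,\dots,a_n)=\sum_i(a_0,\dots,\nabla a_i,\dots,a_n),\qquad \iota_E(a_0,\dots,a_n)=-(a_0E(a_1,a_2),a_3,\dots,a_n),$$ $$S_E(a_0,\dots,a_n)=\sum_{i=1}^{n-1}\sum_{j=0}^{n-i-1}(-1)^{i+j(n-1)}(e,a_{n-j+1},\dots,a_n,a_0,\dots,a_{i-1},E(a_i,a_{i+1}),a_{i+2},\dots,a_{n-j})$$ for $a_0\in A$, and $S_E(e,a_1,\dots,a_n)=0$. The Gauss--Manin connection is $\nabla_{GM}=L_\nabla-\iota_E-S_E$. Let $T(M_0\otimes\cdots\otimes M_n)=\sum_{i_0,\dots,i_n}(M_0)_{i_0i_1}\otimes(M_1)_{i_1i_2}\otimes\cdots\otimes(M_n)_{i_ni_0}$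 be the generalized trace. For an idempotent $P\in M_N(A)$ let $\operatorname{ch}P\in C_{\rm even}(A)$ be given by $(\operatorname{ch}P)_0=T(P)$ and $$(\operatorname{ch}P)_{2n}=(-1)^n\frac{(2n)!}{n!}\,T\bigl(P^{\otimes(2n+1)}-\tfrac12\,e\otimes P^{\otimes 2n}\bigr)\qquad(n\ge1),$$ where $e$ stands for the unit matrix over $A_+$. If $M_N(A)$ has a unit $1$, then for an invertible $U\in M_N(A)$ let $\operatorname{ch}U\in C_{\rm odd}(A)$ be given by $$(\operatorname{ch}U)_{2n+1}=(-1)^n\,n!\;T\bigl((U^{-1}-1+e)\otimes(U-1)\otimes(U^{-1}-1)\otimes\cdots\otimes(U^{-1}-1)\otimes(U-1)\bigr)$$ with $2n+2$ tensor factors. Then $\nabla_{GM}$ commutes with $b+B$, and so induces an operator on $HP_0(A)$ and on $HP_1(A)$; for every $N$, every idempotent $P\in M_N(A)$ and every invertible $U\in M_N(A)$, the chains $\operatorname{ch}P$ and $\operatorname{ch}U$ are cycles, and $$\nabla_{GM}[\operatorname{ch}P]=0\ \text{ in } HP_0(A_J),\qquad \nabla_{GM}[\operatorname{ch}U]=0\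 \text{ in } HP_1(A_J).$$ -/

import Mathlib

open scoped Topology TensorProduct
open Filter Function TopologicalSpace

noncomputable section

namespace GaussManin

section SmoothFunctions

variable {J : Opens ℝ} {X : Type*} [AddCommGroup X] [Module ℂ X] [TopologicalSpace X]

/-- `g` is the derivative of `f : J → X`: the difference quotients of `f` converge to `g t` in
the topology of `X`, at every `t ∈ J`. -/
def HasDer (f g : J → X) : Prop :=
  ∀ t : J, Tendsto (fun s : J => (((s : ℝ) - (t : ℝ) : ℝ) : ℂ)⁻¹ • (f s - f t))
    (𝓝[≠] t) (𝓝 (g t))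

/-- `f : J → X` is infinitely differentiable. -/
def IsSmooth (f : J → X) : Prop :=
  ∃ F : ℕ → J → X, F 0 = f ∧ ∀ n, HasDer (F n) (F (n + 1))

theorem neBot_punctured (t : J) : (𝓝[≠] t).NeBot := by
  rw [← mem_closure_iff_nhdsWithin_neBot, mem_closure_iff_nhds]
  intro U hU
  rw [nhds_subtype_eq_comap, mem_comap] at hU
  obtain ⟨V, hV, hVU⟩ := hU
  have h1 : V ∩ J ∈ 𝓝 (t : ℝ) := inter_mem hV (J.isOpen.mem_nhds t.2)
  have h2 : (V ∩ (J : Set ℝ)) ∩ {(t : ℝ)}ᶜ ∈ 𝓝[≠] (t : ℝ) :=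
    inter_mem (mem_nhdsWithin_of_mem_nhds h1) self_mem_nhdsWithin
  obtain ⟨s, hs⟩ := (inferInstance : (𝓝[≠] (t : ℝ)).NeBot).nonempty_of_mem h2
  exact ⟨⟨s, hs.1.2⟩, hVU hs.1.1, fun h => hs.2 (congrArg Subtype.val h)⟩

theorem HasDer.unique [T2Space X] {f g g' : J → X} (h : HasDer f g) (h' : HasDer f g') :
    g = g' := by
  funext t
  have := neBot_punctured t
  exact tendsto_nhds_unique (h t) (h' t)

theorem HasDer.add [IsTopologicalAddGroup X] {f g f' g' : J → X} (h : HasDer f g)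
    (h' : HasDer f' g') : HasDer (f + f') (g + g') := by
  intro t
  refine ((h t).add (h' t)).congr fun s => ?_
  simp only [Pi.add_apply, ← smul_add]
  congr 1
  abel

theorem HasDer.const_smul [ContinuousSMul ℂ X] {f g : J → X} (c : ℂ) (h : HasDer f g) :
    HasDer (c • f) (c • g) := by
  intro t
  refine ((h t).const_smul c).congr fun s => ?_
  simp only [Pi.smul_apply, ← smul_sub, smul_comm c]

theorem hasDer_const (x : X) : HasDer (fun _ : J => x) 0 := by
  intro t
  simpa using tendsto_const_nhds

theorem HasDer.continuous [IsTopologicalAddGroup X] [ContinuousSMul ℂ X] {f g : J → X}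
    (h : HasDer f g) : Continuous f := by
  rw [continuous_iff_continuousAt]
  intro t
  rw [continuousAt_iff_punctured_nhds]
  have h0 : Tendsto (fun s : J => (((s : ℝ) - (t : ℝ) : ℝ) : ℂ)) (𝓝[≠] t) (𝓝 0) := by
    have : Continuous (fun s : J => (((s : ℝ) - (t : ℝ) : ℝ) : ℂ)) := by fun_prop
    have h1 := this.tendsto t
    simp only [sub_self, Complex.ofReal_zero] at h1
    exact h1.mono_left nhdsWithin_le_nhds
  have h2 := (h0.smul (h t)).add_const (f t)
  rw [zero_smul, zero_add] at h2
  refine h2.congr' ?_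
  filter_upwards [self_mem_nhdsWithin] with s hs
  have hne : (((s : ℝ) - (t : ℝ) : ℝ) : ℂ) ≠ 0 := by
    rw [Ne, Complex.ofReal_eq_zero, sub_eq_zero]
    exact fun e => hs (Subtype.ext e)
  rw [smul_inv_smul₀ hne, sub_add_cancel]

/-- A class of functions that is stable under differentiation consists of smooth functions. -/
theorem isSmooth_of_stable (S : Set (J → X)) (hS : ∀ f ∈ S, ∃ g ∈ S, HasDer f g) {f : J → X}
    (hf : f ∈ S) : IsSmooth f := by
  choose! d hd hd' using hS
  have key : ∀ n, d^[n] f ∈ S := by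
    intro n
    induction n with
    | zero => exact hf
    | succ n ih => rw [iterate_succ_apply']; exact hd _ ih
  refine ⟨fun n => d^[n] f, rfl, fun n => ?_⟩
  simp only [iterate_succ_apply']
  exact hd' _ (key n)

variable [IsTopologicalAddGroup X] [ContinuousSMul ℂ X]

variable (J X) in
def smoothSubmodule : Submodule ℂ (J → X) where
  carrier := {f | IsSmooth f}
  zero_mem' := ⟨fun _ _ => 0, rfl, fun _ => hasDer_const 0⟩
  add_mem' := by
    rintro f g ⟨F, rfl, hF⟩ ⟨G, rfl, hG⟩
    exact ⟨fun n => F n + G n, rfl, fun n => (hF n).add (hG n)⟩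
  smul_mem' := by
    rintro c f ⟨F, rfl, hF⟩
    exact ⟨fun n => c • F n, rfl, fun n => (hF n).const_smul c⟩

variable (J X) in
/-- The space `C^∞(J, X)`. -/
def CInf : Type _ := smoothSubmodule J X

namespace CInf

instance : AddCommGroup (CInf J X) := inferInstanceAs (AddCommGroup (smoothSubmodule J X))
instance : Module ℂ (CInf J X) := inferInstanceAs (Module ℂ (smoothSubmodule J X))
instance : FunLike (CInf J X) J X where
  coe f := f.1
  coe_injective := Subtype.val_injective

@[ext] theorem ext {f g : CInf J X} (h : ∀ t, f t = g t) : f = g := DFunLike.ext f g h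

@[simp] theorem add_apply (f g : CInf J X) (t : J) : (f + g) t = f t + g t := rfl
@[simp] theorem zero_apply (t : J) : (0 : CInf J X) t = 0 := rfl
@[simp] theorem neg_apply (f : CInf J X) (t : J) : (-f) t = -f t := rfl
@[simp] theorem sub_apply (f g : CInf J X) (t : J) : (f - g) t = f t - g t := rfl
@[simp] theorem smul_apply (c : ℂ) (f : CInf J X) (t : J) : (c • f) t = c • f t := rfl

theorem isSmooth (f : CInf J X) : IsSmooth (f : J → X) := f.2

theorem exists_deriv (f : CInf J X) : ∃ g : CInf J X, HasDer f g := by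
  obtain ⟨F, h0, hF⟩ := f.isSmooth
  exact ⟨⟨F 1, fun n => F (n + 1), rfl, fun n => hF (n + 1)⟩, h0 ▸ hF 0⟩

theorem continuous (f : CInf J X) : Continuous f :=
  f.exists_deriv.choose_spec.continuous

/-- A smooth function as an element of `C(J, X)`, which carries the topology of uniform
convergence on compact sets. -/
def toC (f : CInf J X) : C(J, X) := ⟨f, f.continuous⟩

variable [T2Space X]

/-- The derivative `d/dt` on `C^∞(J, X)`. -/
def deriv : CInf J X →ₗ[ℂ] CInf J X where
  toFun f := f.exists_deriv.choose
  map_add' f g := DFunLike.coe_injective <| HasDer.unique (f + g).exists_deriv.choose_spec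
    (f.exists_deriv.choose_spec.add g.exists_deriv.choose_spec)
  map_smul' c f := DFunLike.coe_injective <| HasDer.unique (c • f).exists_deriv.choose_spec
    (f.exists_deriv.choose_spec.const_smul c)

theorem hasDer_deriv (f : CInf J X) : HasDer f (deriv f) := f.exists_deriv.choose_spec

theorem deriv_eq {f g : CInf J X} (h : HasDer f g) : deriv f = g :=
  DFunLike.coe_injective (f.hasDer_deriv.unique h)

/-- All derivatives of a smooth function. -/
def jet : CInf J X →ₗ[ℂ] (ℕ → C(J, X)) where
  toFun f n := toC ((deriv ^ n) f)
  map_add' f g := by ext; simp [toC]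
  map_smul' c f := by ext; simp [toC]

/-- The topology of uniform convergence of all derivatives on compact subsets of `J`. -/
instance : TopologicalSpace (CInf J X) := TopologicalSpace.induced jet inferInstance

instance : IsTopologicalAddGroup (CInf J X) := topologicalAddGroup_induced jet
instance : ContinuousSMul ℂ (CInf J X) := continuousSMul_induced (jet (J := J) (X := X))

theorem continuous_jet (n : ℕ) : Continuous fun f : CInf J X => toC ((deriv ^ n) f) :=
  (continuous_apply (A := fun _ : ℕ => C(J, X)) n).comp (continuous_induced_dom (f := jet))

theorem continuous_rng {Y : Type*} [TopologicalSpace Y] {φ : Y → CInf J X} :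
    Continuous φ ↔ ∀ n, Continuous fun y => toC ((deriv ^ n) (φ y)) := by
  rw [continuous_induced_rng]
  exact continuous_pi_iff

theorem continuous_deriv : Continuous (deriv : CInf J X → CInf J X) :=
  continuous_rng.2 fun n => by
    simpa only [pow_succ, Module.End.mul_apply] using continuous_jet (J := J) (X := X) (n + 1)

theorem continuous_eval : Continuous fun p : CInf J X × J => p.1 p.2 := by
  have : LocallyCompactSpace J := J.isOpen.locallyCompactSpace
  have h : Continuous fun p : CInf J X × J => (toC p.1, p.2) :=
    ((continuous_jet 0).comp continuous_fst).prodMk continuous_snd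
  exact (ContinuousEval.continuous_eval (F := C(J, X))).comp h

instance : T2Space (CInf J X) := by
  refine T2Space.of_injective_continuous (f := fun f : CInf J X => toC f) ?_ (continuous_jet 0)
  intro f g h
  ext t
  exact congrArg (fun c : C(J, X) => c t) h

variable (J) in
/-- Constant functions. -/
def const : X →ₗ[ℂ] CInf J X where
  toFun x := ⟨fun _ => x, fun n => if n = 0 then fun _ => x else 0, rfl, fun n => by
    rcases n with _ | n
    · exact hasDer_const x
    · exact hasDer_const 0⟩
  map_add' _ _ := rfl
  map_smul' _ _ := rfl

@[simp] theorem const_apply (x : X) (t : J) : const J x t = x := rfl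

theorem deriv_const (x : X) : deriv (const J x) = 0 := deriv_eq (hasDer_const x)

theorem continuous_const : Continuous (const J : X → CInf J X) := by
  refine continuous_rng.2 fun n => ?_
  rcases n with _ | n
  · exact ContinuousMap.continuous_of_continuous_uncurry _ (by exact continuous_fst)
  · simp only [pow_succ, Module.End.mul_apply, deriv_const, map_zero]
    exact _root_.continuous_const

end CInf

/-- Jointly continuous bilinear maps `X × Y → C^∞(J, Z)`, that is, smooth families of jointly
continuous bilinear maps `X × Y → Z`. -/
structure SmoothBilin (J : Opens ℝ) (X Y Z : Type*) [AddCommGroup X] [Module ℂ X]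
    [TopologicalSpace X] [AddCommGroup Y] [Module ℂ Y] [TopologicalSpace Y] [AddCommGroup Z]
    [Module ℂ Z] [TopologicalSpace Z] [IsTopologicalAddGroup Z] [ContinuousSMul ℂ Z]
    [T2Space Z] where
  toFun : X →ₗ[ℂ] Y →ₗ[ℂ] CInf J Z
  cont : Continuous fun p : X × Y => toFun p.1 p.2

namespace SmoothBilin

variable {Y Z : Type*} [AddCommGroup Y] [Module ℂ Y] [TopologicalSpace Y]
  [IsTopologicalAddGroup Y] [ContinuousSMul ℂ Y] [T2Space Y] [AddCommGroup Z] [Module ℂ Z]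
  [TopologicalSpace Z] [IsTopologicalAddGroup Z] [ContinuousSMul ℂ Z] [T2Space Z] [T2Space X]

/-- The family of derivatives. -/
def der (μ : SmoothBilin J X Y Z) : SmoothBilin J X Y Z where
  toFun := μ.toFun.compr₂ CInf.deriv
  cont := CInf.continuous_deriv.comp μ.cont

/-- A jointly continuous bilinear map as a constant family. -/
def ofConst (J : Opens ℝ) (β : X →ₗ[ℂ] Y →ₗ[ℂ] Z) (hβ : Continuous fun p : X × Y => β p.1 p.2) :
    SmoothBilin J X Y Z where
  toFun := β.compr₂ (CInf.const J)
  cont := CInf.continuous_const.comp hβ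

/-- The fibrewise application. -/
def pt (μ : SmoothBilin J X Y Z) (a : J → X) (b : J → Y) : J → Z := fun t => μ.toFun (a t) (b t) t

theorem continuous_pt (μ : SmoothBilin J X Y Z) :
    Continuous fun p : (X × Y) × J => μ.toFun p.1.1 p.1.2 p.2 :=
  CInf.continuous_eval.comp ((μ.cont.comp continuous_fst).prodMk continuous_snd)

theorem hasDer_pt (μ : SmoothBilin J X Y Z) (a : CInf J X) (b : CInf J Y) :
    HasDer (μ.pt a b) (μ.der.pt a b + μ.pt a.deriv b + μ.pt a b.deriv) := by
  intro t
  have hs : Tendsto (fun s : J => s) (𝓝[≠] t) (𝓝 t) := nhdsWithin_le_nhds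
  have hb : Tendsto (fun s : J => b s) (𝓝[≠] t) (𝓝 (b t)) :=
    (b.continuous.tendsto t).mono_left nhdsWithin_le_nhds
  have h1 := (CInf.hasDer_deriv (μ.toFun (a t) (b t))) t
  have h2 := (μ.continuous_pt.tendsto ((a.deriv t, b t), t)).comp
    (((a.hasDer_deriv t).prodMk_nhds hb).prodMk_nhds hs)
  have h3 := (μ.continuous_pt.tendsto ((a t, b.deriv t), t)).comp
    (((tendsto_const_nhds (x := a t)).prodMk_nhds (b.hasDer_deriv t)).prodMk_nhds hs)
  refine ((h1.add h2).add h3).congr fun s => ?_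
  simp only [comp_apply, pt, map_smul, map_sub, LinearMap.smul_apply, LinearMap.sub_apply,
    CInf.smul_apply, CInf.sub_apply, ← smul_add]
  congr 1
  abel

theorem isSmooth_pt (μ : SmoothBilin J X Y Z) (a : CInf J X) (b : CInf J Y) :
    IsSmooth (μ.pt a b) := by
  refine isSmooth_of_stable
    (AddSubmonoid.closure {f | ∃ (μ : SmoothBilin J X Y Z) (a : CInf J X) (b : CInf J Y),
      f = μ.pt a b} : Set (J → Z)) ?_ (AddSubmonoid.subset_closure ⟨μ, a, b, rfl⟩)
  intro f hf
  induction hf using AddSubmonoid.closure_induction with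
  | mem f hf =>
    obtain ⟨μ, a, b, rfl⟩ := hf
    exact ⟨_, add_mem (add_mem (AddSubmonoid.subset_closure ⟨_, _, _, rfl⟩)
      (AddSubmonoid.subset_closure ⟨_, _, _, rfl⟩)) (AddSubmonoid.subset_closure ⟨_, _, _, rfl⟩),
      μ.hasDer_pt a b⟩
  | zero => exact ⟨0, zero_mem _, hasDer_const 0⟩
  | add f g _ _ hf hg =>
    obtain ⟨f', hf', hf⟩ := hf
    obtain ⟨g', hg', hg⟩ := hg
    exact ⟨_, add_mem hf' hg', hf.add hg⟩

/-- The map `C^∞(J, X) × C^∞(J, Y) → C^∞(J, Z)`, `(a, b) ↦ (t ↦ μ_t (a t, b t))`. -/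
def sections (μ : SmoothBilin J X Y Z) (a : CInf J X) (b : CInf J Y) : CInf J Z :=
  ⟨μ.pt a b, μ.isSmooth_pt a b⟩

theorem sections_apply (μ : SmoothBilin J X Y Z) (a : CInf J X) (b : CInf J Y) (t : J) :
    μ.sections a b t = μ.toFun (a t) (b t) t := rfl

theorem deriv_sections (μ : SmoothBilin J X Y Z) (a : CInf J X) (b : CInf J Y) :
    (μ.sections a b).deriv = μ.der.sections a b + μ.sections a.deriv b + μ.sections a b.deriv :=
  CInf.deriv_eq (μ.hasDer_pt a b)

theorem continuous_sections (μ : SmoothBilin J X Y Z) :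
    Continuous fun p : CInf J X × CInf J Y => μ.sections p.1 p.2 := by
  refine CInf.continuous_rng.2 fun n => ?_
  induction n generalizing μ with
  | zero =>
    refine ContinuousMap.continuous_of_continuous_uncurry _ ?_
    have h1 : Continuous fun q : (CInf J X × CInf J Y) × J => q.1.1 q.2 :=
      CInf.continuous_eval.comp ((continuous_fst.comp continuous_fst).prodMk continuous_snd)
    have h2 : Continuous fun q : (CInf J X × CInf J Y) × J => q.1.2 q.2 :=
      CInf.continuous_eval.comp ((continuous_snd.comp continuous_fst).prodMk continuous_snd)
    exact μ.continuous_pt.comp ((h1.prodMk h2).prodMk continuous_snd)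
  | succ n ih =>
    have e : (fun p : CInf J X × CInf J Y =>
        CInf.toC ((CInf.deriv ^ (n + 1)) (μ.sections p.1 p.2))) = fun p =>
        CInf.toC ((CInf.deriv ^ n) (μ.der.sections p.1 p.2))
          + CInf.toC ((CInf.deriv ^ n) (μ.sections p.1.deriv p.2))
          + CInf.toC ((CInf.deriv ^ n) (μ.sections p.1 p.2.deriv)) := by
      funext p
      rw [pow_succ, Module.End.mul_apply, deriv_sections, map_add, map_add]
      rfl
    rw [e]
    refine ((ih μ.der).add ?_).add ?_
    · exact (ih μ).comp
        ((CInf.continuous_deriv.comp continuous_fst).prodMk continuous_snd)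
    · exact (ih μ).comp
        (continuous_fst.prodMk (CInf.continuous_deriv.comp continuous_snd))

end SmoothBilin

end SmoothFunctions


section ProjectiveTopology

variable {E M : Type*} [TopologicalSpace E] [AddCommGroup M] [Module ℂ M]

/-- The strongest locally convex topology on `M` for which `ι` is continuous. -/
abbrev projTop (ι : E → M) : TopologicalSpace M :=
  sInf {t | @IsTopologicalAddGroup M t _ ∧ @ContinuousSMul ℂ M _ _ t ∧
    @LocallyConvexSpace ℝ M _ _ _ _ t ∧ @Continuous E M _ t ι}

/-- `M` with the strongest locally convex topology for which `ι` is continuous. -/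
def WithProj (_ι : E → M) : Type _ := M

namespace WithProj

variable {ι : E → M}

instance : AddCommGroup (WithProj ι) := inferInstanceAs (AddCommGroup M)
instance : Module ℂ (WithProj ι) := inferInstanceAs (Module ℂ M)
instance : TopologicalSpace (WithProj ι) := projTop ι
instance : IsTopologicalAddGroup (WithProj ι) := topologicalAddGroup_sInf fun _ h => h.1
instance : ContinuousSMul ℂ (WithProj ι) := continuousSMul_sInf fun _ h => h.2.1
instance : LocallyConvexSpace ℝ (WithProj ι) :=
  LocallyConvexSpace.sInf (E := M) fun _ h => h.2.2.1
instance : UniformSpace (WithProj ι) := IsTopologicalAddGroup.rightUniformSpace (WithProj ι)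
instance : IsUniformAddGroup (WithProj ι) := isUniformAddGroup_of_addCommGroup
instance : UniformContinuousConstSMul ℂ (WithProj ι) :=
  uniformContinuousConstSMul_of_continuousConstSMul _ _

variable (ι) in
/-- The canonical map. -/
def of (x : E) : WithProj ι := ι x

theorem continuous_of : Continuous (of ι) := continuous_sInf_rng.2 fun _ h => h.2.2.2

/-- The universal property of the projective topology. -/
theorem continuous_lift {Z : Type*} [AddCommGroup Z] [Module ℂ Z] [t : TopologicalSpace Z]
    [IsTopologicalAddGroup Z] [ContinuousSMul ℂ Z] [LocallyConvexSpace ℝ Z]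
    (F : WithProj ι →ₗ[ℂ] Z) (hF : Continuous fun x => F (of ι x)) : Continuous F := by
  rw [continuous_iff_le_induced]
  refine sInf_le ⟨topologicalAddGroup_induced F, continuousSMul_induced F,
    LocallyConvexSpace.induced (F.restrictScalars ℝ), continuous_induced_rng.2 hF⟩

end WithProj

/-- The completion of `M` for the strongest locally convex topology for which `ι` is
continuous. -/
abbrev CompletedProj (ι : E → M) : Type _ := UniformSpace.Completion (WithProj ι)

end ProjectiveTopology

section Deformations

/-- The completed projective tensor product `X ⊗̂ Y`. -/
abbrev ProjTensor (X Y : Type*) [AddCommGroup X] [Module ℂ X] [TopologicalSpace X]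
    [AddCommGroup Y] [Module ℂ Y] [TopologicalSpace Y] : Type _ :=
  CompletedProj fun p : X × Y => p.1 ⊗ₜ[ℂ] p.2

/-- The elementary tensor `x ⊗ y` in `X ⊗̂ Y`. -/
def ptmul {X Y : Type*} [AddCommGroup X] [Module ℂ X] [TopologicalSpace X]
    [AddCommGroup Y] [Module ℂ Y] [TopologicalSpace Y] (x : X) (y : Y) : ProjTensor X Y :=
  ((WithProj.of (fun p : X × Y => p.1 ⊗ₜ[ℂ] p.2) (x, y) : WithProj _) :
    UniformSpace.Completion _)

/-- A smooth one-parameter deformation of algebras over `J` with underlying space `X`: a smooth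
family of continuous linear maps `m_t : X ⊗̂ X → X`, given by a continuous linear map
`X ⊗̂ X → C^∞(J, X)`, such that every `m_t` is associative. -/
structure SmoothDeformation (J : Opens ℝ) (X : Type*) [AddCommGroup X] [Module ℂ X]
    [TopologicalSpace X] [IsTopologicalAddGroup X] [ContinuousSMul ℂ X] [T2Space X] where
  mul : ProjTensor X X →L[ℂ] CInf J X
  assoc : ∀ (t : J) (x y z : X),
    mul (ptmul (mul (ptmul x y) t) z) t = mul (ptmul x (mul (ptmul y z) t)) t

variable {J : Opens ℝ} {X : Type*} [AddCommGroup X] [Module ℂ X] [TopologicalSpace X]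
  [IsTopologicalAddGroup X] [ContinuousSMul ℂ X] [T2Space X]

/-- The product `m_t(x, y)` as a jointly continuous bilinear map with values in
`C^∞(J, X)`. -/
def SmoothDeformation.bilin (D : SmoothDeformation J X) : SmoothBilin J X X X where
  toFun := LinearMap.mk₂ ℂ (fun x y => D.mul (ptmul x y))
    (fun x x' y => by
      rw [← map_add, ptmul, ptmul, ptmul, ← UniformSpace.Completion.coe_add]
      refine congrArg (fun z => D.mul (UniformSpace.Completion.coe' z)) ?_
      exact (TensorProduct.add_tmul x x' y))
    (fun c x y => by
      rw [← map_smul, ptmul, ptmul, ← UniformSpace.Completion.coe_smul]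
      refine congrArg (fun z => D.mul (UniformSpace.Completion.coe' z)) ?_
      exact (TensorProduct.smul_tmul' c x y).symm)
    (fun x y y' => by
      rw [← map_add, ptmul, ptmul, ptmul, ← UniformSpace.Completion.coe_add]
      refine congrArg (fun z => D.mul (UniformSpace.Completion.coe' z)) ?_
      exact (TensorProduct.tmul_add x y y'))
    (fun c x y => by
      rw [← map_smul, ptmul, ptmul, ← UniformSpace.Completion.coe_smul]
      refine congrArg (fun z => D.mul (UniformSpace.Completion.coe' z)) ?_
      exact (TensorProduct.tmul_smul c x y))
  cont := D.mul.continuous.comp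
    ((UniformSpace.Completion.continuous_coe _).comp WithProj.continuous_of)

/-- The ground ring `C^∞(J)`. -/
abbrev CJ (J : Opens ℝ) : Type := CInf J ℂ

namespace CInf

/-- Pointwise scalar multiplication as a constant family. -/
def smulFam (J : Opens ℝ) (X : Type*) [AddCommGroup X] [Module ℂ X] [TopologicalSpace X]
    [IsTopologicalAddGroup X] [ContinuousSMul ℂ X] [T2Space X] : SmoothBilin J ℂ X X :=
  SmoothBilin.ofConst J (LinearMap.lsmul ℂ X) (by exact continuous_smul)

instance : Mul (CJ J) := ⟨(smulFam J ℂ).sections⟩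
instance : One (CJ J) := ⟨const J 1⟩
instance : SMul (CJ J) (CInf J X) := ⟨(smulFam J X).sections⟩

@[simp] theorem mul_apply (f g : CJ J) (t : J) : (f * g) t = f t * g t := rfl
@[simp] theorem one_apply (t : J) : (1 : CJ J) t = 1 := rfl
@[simp] theorem fsmul_apply (f : CJ J) (g : CInf J X) (t : J) : (f • g) t = f t • g t := rfl

instance : CommRing (CJ J) :=
  { (inferInstance : AddCommGroup (CJ J)), (inferInstance : Mul (CJ J)),
    (inferInstance : One (CJ J)) with
    left_distrib := fun f g h => by ext t; simp [mul_add]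
    right_distrib := fun f g h => by ext t; simp [add_mul]
    zero_mul := fun f => by ext t; simp
    mul_zero := fun f => by ext t; simp
    mul_assoc := fun f g h => by ext t; simp [mul_assoc]
    one_mul := fun f => by ext t; simp
    mul_one := fun f => by ext t; simp
    mul_comm := fun f g => by ext t; simp [mul_comm] }

instance : Algebra ℂ (CJ J) :=
  Algebra.ofModule (fun c f g => by ext t; simp [mul_assoc])
    (fun c f g => by ext t; simp [mul_left_comm])

instance : ContinuousMul (CJ J) := ⟨(smulFam J ℂ).continuous_sections⟩

instance : Module (CJ J) (CInf J X) where
  one_smul f := by ext t; simp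
  mul_smul f g h := by ext t; simp [mul_smul]
  smul_zero f := by ext t; simp
  smul_add f g h := by ext t; simp
  add_smul f g h := by ext t; simp [add_smul]
  zero_smul f := by ext t; simp

theorem deriv_fsmul (f : CJ J) (g : CInf J X) : deriv (f • g) = deriv f • g + f • deriv g := by
  refine ((smulFam J X).deriv_sections f g).trans ?_
  have : (smulFam J X).der.sections f g = 0 := by
    ext t
    change deriv (const J (f t • g t)) t = 0
    rw [deriv_const, zero_apply]
  rw [this, zero_add]
  rfl

end CInf

/-- The algebra of sections `A_J` of a deformation: the space `C^∞(J, X)` with the product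
`(a b)(t) = m_t(a(t), b(t))`. -/
def Sections (_D : SmoothDeformation J X) : Type _ := CInf J X

namespace Sections

variable {D : SmoothDeformation J X}

instance : AddCommGroup (Sections D) := inferInstanceAs (AddCommGroup (CInf J X))
instance : Module ℂ (Sections D) := inferInstanceAs (Module ℂ (CInf J X))
instance : Module (CJ J) (Sections D) := inferInstanceAs (Module (CJ J) (CInf J X))
instance : TopologicalSpace (Sections D) := inferInstanceAs (TopologicalSpace (CInf J X))
instance : IsTopologicalAddGroup (Sections D) := inferInstanceAs (IsTopologicalAddGroup (CInf J X))
instance : FunLike (Sections D) J X := inferInstanceAs (FunLike (CInf J X) J X)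
instance : Mul (Sections D) := ⟨D.bilin.sections⟩

theorem mul_apply (a b : Sections D) (t : J) : (a * b) t = D.mul (ptmul (a t) (b t)) t := rfl

theorem ext {a b : Sections D} (h : ∀ t, a t = b t) : a = b := DFunLike.ext a b h

instance : NonUnitalRing (Sections D) :=
  { (inferInstance : AddCommGroup (Sections D)), (inferInstance : Mul (Sections D)) with
    left_distrib := fun a b c => ext fun t => by
      change D.bilin.toFun (a t) (b t + c t) t = _
      rw [map_add]; rfl
    right_distrib := fun a b c => ext fun t => by
      change D.bilin.toFun (a t + b t) (c t) t = _
      rw [map_add]; rfl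
    zero_mul := fun a => ext fun t => by
      change D.bilin.toFun 0 (a t) t = _
      rw [map_zero]; rfl
    mul_zero := fun a => ext fun t => by
      change D.bilin.toFun (a t) 0 t = _
      rw [map_zero]; rfl
    mul_assoc := fun a b c => ext fun t => D.assoc t (a t) (b t) (c t) }

instance : ContinuousMul (Sections D) := ⟨D.bilin.continuous_sections⟩
instance : ContinuousSMul (CJ J) (Sections D) := ⟨(CInf.smulFam J X).continuous_sections⟩
instance : IsScalarTower ℂ (CJ J) (Sections D) :=
  ⟨fun c f a => ext fun t => smul_assoc c (f t) (a t : X)⟩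
instance : IsScalarTower (CJ J) (Sections D) (Sections D) :=
  ⟨fun f a b => ext fun t => by
    change D.bilin.toFun (f t • a t) (b t) t = f t • D.bilin.toFun (a t) (b t) t
    rw [map_smul]; rfl⟩
instance : SMulCommClass (CJ J) (Sections D) (Sections D) :=
  ⟨fun f a b => ext fun t => by
    change f t • D.bilin.toFun (a t) (b t) t = D.bilin.toFun (a t) (f t • b t) t
    rw [map_smul]; rfl⟩

end Sections

end Deformations

section CyclicComplex

universe u

variable (R : Type) (A : Type u) [CommRing R] [Algebra ℂ R] [TopologicalSpace R]
  [NonUnitalRing A] [Module R A] [TopologicalSpace A]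

/-- The space in which the entry `a_0` of an elementary Hochschild `n`-chain
`(a_0, a_1, …, a_n)` lies: the algebra `A` if `n = 0`, its unitization `A_+ = A ⊕ R` if
`n ≥ 1`. -/
def Hd : ℕ → Type u
  | 0 => A
  | _ + 1 => Unitization R A

namespace Hd

instance : ∀ n, AddCommGroup (Hd R A n)
  | 0 => inferInstanceAs (AddCommGroup A)
  | _ + 1 => inferInstanceAs (AddCommGroup (Unitization R A))

instance : ∀ n, Module R (Hd R A n)
  | 0 => inferInstanceAs (Module R A)
  | _ + 1 => inferInstanceAs (Module R (Unitization R A))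

/-- The topology of `A`, and the product topology on `A_+ = A ⊕ R`. -/
instance : ∀ n, TopologicalSpace (Hd R A n)
  | 0 => inferInstanceAs (TopologicalSpace A)
  | _ + 1 => TopologicalSpace.induced (fun x : Unitization R A => (x.fst, x.snd)) inferInstance

variable {R A}

/-- The inclusion of `A`. -/
def ofA : ∀ n, A →ₗ[R] Hd R A n
  | 0 => LinearMap.id
  | _ + 1 => Unitization.inrHom R R A

/-- The component in `A`. -/
def toA : ∀ n, Hd R A n →ₗ[R] A
  | 0 => LinearMap.id
  | _ + 1 => Unitization.sndHom R R A

/-- The component in `R`, that is, the coefficient of the unit of `A_+`. -/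
def toR : ∀ n, Hd R A n →ₗ[R] R
  | 0 => 0
  | _ + 1 =>
    { toFun := fun x : Unitization R A => x.fst
      map_add' := Unitization.fst_add
      map_smul' := Unitization.fst_smul }

/-- The unit `e` of `A_+`. -/
def e (n : ℕ) : Hd R A (n + 1) := (1 : Unitization R A)

/-- For `n ≥ 1` the identity of `A_+`. (For `n = 0` the projection `A_+ → A`, which is only there
to make the definition total.) -/
def down : ∀ n, Hd R A (n + 1) →ₗ[R] Hd R A n
  | 0 => Unitization.sndHom R R A
  | _ + 1 => LinearMap.id

/-- The product `h a ∈ A` of `h` (in `A` or in `A_+`) and `a ∈ A`. -/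
def lmul {n : ℕ} (h : Hd R A n) (a : A) : A := toR n h • a + toA n h * a

/-- The product `a h ∈ A` of `a ∈ A` and `h` (in `A` or in `A_+`). -/
def rmul {n : ℕ} (a : A) (h : Hd R A n) : A := toR n h • a + a * toA n h

theorem continuous_ofA : ∀ n, Continuous (ofA n : A →ₗ[R] Hd R A n)
  | 0 => continuous_id
  | _ + 1 => continuous_induced_rng.2 (by exact continuous_const.prodMk continuous_id)

theorem continuous_toA : ∀ n, Continuous (toA n : Hd R A n →ₗ[R] A)
  | 0 => continuous_id
  | _ + 1 => continuous_snd.comp continuous_induced_dom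

theorem continuous_toR : ∀ n, Continuous (toR n : Hd R A n →ₗ[R] R)
  | 0 => continuous_const
  | _ + 1 => continuous_fst.comp continuous_induced_dom

theorem continuous_down : ∀ n, Continuous (down n : Hd R A (n + 1) →ₗ[R] Hd R A n)
  | 0 => continuous_snd.comp continuous_induced_dom
  | _ + 1 => continuous_id

end Hd

/-- The algebraic tensor product `A_+ ⊗_R A ⊗_R ⋯ ⊗_R A` (with `A` in place of `A_+` for
`n = 0`). -/
def AlgT (n : ℕ) : Type u := Hd R A n ⊗[R] (⨂[R] (_ : Fin n), A)

instance (n : ℕ) : AddCommGroup (AlgT R A n) :=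
  inferInstanceAs (AddCommGroup (Hd R A n ⊗[R] (⨂[R] (_ : Fin n), A)))
instance (n : ℕ) : Module R (AlgT R A n) :=
  inferInstanceAs (Module R (Hd R A n ⊗[R] (⨂[R] (_ : Fin n), A)))
instance (n : ℕ) : Module ℂ (AlgT R A n) := Module.compHom _ (algebraMap ℂ R)

/-- The canonical multilinear map `(a_0, (a_1, …, a_n)) ↦ a_0 ⊗ a_1 ⊗ ⋯ ⊗ a_n`. -/
def tens (n : ℕ) (p : Hd R A n × (Fin n → A)) : AlgT R A n := p.1 ⊗ₜ[R] PiTensorProduct.tprod R p.2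

/-- The algebraic tensor product with the projective topology. -/
abbrev AlgChain (n : ℕ) : Type u := WithProj (tens R A n)

/-- The space of Hochschild chains `C_n(A) = A_+ ⊗̂_R A^{⊗̂_R n}` for `n ≥ 1`, `C_0(A) = A`. -/
abbrev Chain (n : ℕ) : Type u := CompletedProj (tens R A n)

instance (n : ℕ) : Module R (AlgChain R A n) := inferInstanceAs (Module R (AlgT R A n))

variable {R A}

theorem csmul_def {n : ℕ} (c : ℂ) (z : AlgChain R A n) : c • z = algebraMap ℂ R c • z := rfl

instance (n : ℕ) : SMulCommClass R ℂ (AlgChain R A n) :=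
  ⟨fun r c z => by simp only [csmul_def, smul_smul, mul_comm]⟩

/-- The elementary chain `(h, v_0, …, v_{n-1})`. -/
def cls {n : ℕ} (h : Hd R A n) (v : Fin n → A) : AlgChain R A n := WithProj.of (tens R A n) (h, v)

section cls

variable {n : ℕ}

theorem cls_head_add (h h' : Hd R A n) (v : Fin n → A) : cls (h + h') v = cls h v + cls h' v :=
  TensorProduct.add_tmul h h' _

theorem cls_head_smul (r : R) (h : Hd R A n) (v : Fin n → A) : cls (r • h) v = r • cls h v :=
  (TensorProduct.smul_tmul' r h _).symm

theorem cls_update_add (h : Hd R A n) (v : Fin n → A) (i : Fin n) (x y : A) :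
    cls h (update v i (x + y)) = cls h (update v i x) + cls h (update v i y) := by
  unfold cls WithProj.of tens
  rw [MultilinearMap.map_update_add]
  exact TensorProduct.tmul_add h _ _

theorem cls_update_smul (h : Hd R A n) (v : Fin n → A) (i : Fin n) (r : R) (x : A) :
    cls h (update v i (r • x)) = r • cls h (update v i x) := by
  unfold cls WithProj.of tens
  rw [MultilinearMap.map_update_smul]
  exact TensorProduct.tmul_smul r h _

theorem continuous_cls : Continuous fun p : Hd R A n × (Fin n → A) => cls p.1 p.2 :=
  WithProj.continuous_of

end cls

/-- The conditions under which a formula on elementary chains defines a continuous `ℂ`-linear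
operator: additivity in all entries, `R`-balancedness, `ℂ`-homogeneity and joint continuity. -/
structure IsFormula {n : ℕ} {Z : Type*} [AddCommGroup Z] [Module ℂ Z] [TopologicalSpace Z]
    (f : Hd R A n → (Fin n → A) → Z) : Prop where
  head_add : ∀ h h' v, f (h + h') v = f h v + f h' v
  update_add : ∀ h v i x y, f h (update v i (x + y)) = f h (update v i x) + f h (update v i y)
  balanced : ∀ (r : R) h v i, f (r • h) v = f h (update v i (r • v i))
  csmul : ∀ (c : ℂ) h v, f (algebraMap ℂ R c • h) v = c • f h v
  cont : Continuous fun p : Hd R A n × (Fin n → A) => f p.1 p.2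

namespace IsFormula

variable {n : ℕ} {Z : Type*} [AddCommGroup Z] [Module ℂ Z] [TopologicalSpace Z]
  {f : Hd R A n → (Fin n → A) → Z}

theorem head_zero (hf : IsFormula f) (v : Fin n → A) : f 0 v = 0 := by
  have := hf.head_add 0 0 v
  rwa [add_zero, left_eq_add] at this

theorem update_zero (hf : IsFormula f) (h : Hd R A n) (v : Fin n → A) (i : Fin n)
    (hv : v i = 0) : f h v = 0 := by
  have := hf.update_add h v i 0 0
  rw [add_zero, left_eq_add] at this
  rwa [← hv, update_eq_self] at this

/-- The induced map on `A^{⊗ n}`, for a fixed entry `a_0`. -/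
def tailHom (hf : IsFormula f) (h : Hd R A n) : (⨂[R] (_ : Fin n), A) →+ Z :=
  PiTensorProduct.liftAddHom (fun p : R × (Fin n → A) => f (p.1 • h) p.2)
    (fun _ v i hv => hf.update_zero _ v i hv)
    (fun v => by simp only [zero_smul]; exact hf.head_zero v)
    (fun {inst} r v i x y => by
      obtain rfl : inst = instDecidableEqFin n := Subsingleton.elim _ _
      exact (hf.update_add _ v i x y).symm)
    (fun r r' v => by simp only [add_smul]; exact (hf.head_add _ _ v).symm)
    (fun {inst} r v i r' => by
      obtain rfl : inst = instDecidableEqFin n := Subsingleton.elim _ _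
      simp only [mul_smul]
      exact (hf.balanced r' _ v i).symm)

theorem tailHom_smul_tprod (hf : IsFormula f) (h : Hd R A n) (r : R) (v : Fin n → A) :
    hf.tailHom h (r • PiTensorProduct.tprod R v) = f (r • h) v := by
  rw [← PiTensorProduct.tprodCoeff_eq_smul_tprod]
  rfl

theorem tailHom_tprod (hf : IsFormula f) (h : Hd R A n) (v : Fin n → A) :
    hf.tailHom h (PiTensorProduct.tprod R v) = f h v := by
  have := hf.tailHom_smul_tprod h 1 v
  rwa [one_smul, one_smul] at this

/-- The induced additive map on the algebraic tensor product. -/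
def hom (hf : IsFormula f) : Hd R A n ⊗[R] (⨂[R] (_ : Fin n), A) →+ Z :=
  TensorProduct.liftAddHom (R := R)
    { toFun := hf.tailHom
      map_zero' := by
        ext z
        induction z using PiTensorProduct.induction_on with
        | smul_tprod r v => rw [tailHom_smul_tprod, smul_zero]; exact hf.head_zero v
        | add x y hx hy => rw [map_add, hx, hy, map_add]
      map_add' := fun h h' => by
        ext z
        induction z using PiTensorProduct.induction_on with
        | smul_tprod r v =>
          rw [AddMonoidHom.add_apply]
          simp only [tailHom_smul_tprod, smul_add]
          exact hf.head_add _ _ v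
        | add x y hx hy =>
          rw [map_add, hx, hy, map_add] }
    (fun r h z => by
      change hf.tailHom (r • h) z = hf.tailHom h (r • z)
      induction z using PiTensorProduct.induction_on with
      | smul_tprod s v => simp only [smul_smul, tailHom_smul_tprod, mul_comm]
      | add x y hx hy => rw [map_add, hx, hy, smul_add, map_add])

theorem hom_tens (hf : IsFormula f) (h : Hd R A n) (v : Fin n → A) :
    hf.hom (tens R A n (h, v)) = f h v :=
  hf.tailHom_tprod h v

theorem hom_csmul (hf : IsFormula f) (c : ℂ) (z : Hd R A n ⊗[R] (⨂[R] (_ : Fin n), A)) :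
    hf.hom (algebraMap ℂ R c • z) = c • hf.hom z := by
  induction z using TensorProduct.induction_on with
  | zero => rw [smul_zero, map_zero, smul_zero]
  | tmul h y =>
    change hf.tailHom (algebraMap ℂ R c • h) y = c • hf.tailHom h y
    induction y using PiTensorProduct.induction_on with
    | smul_tprod r v =>
      rw [tailHom_smul_tprod, tailHom_smul_tprod, smul_comm, hf.csmul]
    | add x y hx hy => rw [map_add, hx, hy, map_add, smul_add]
  | add x y hx hy =>
    rw [smul_add, map_add, hx, hy, ← smul_add, ← map_add]

/-- The `ℂ`-linear map on algebraic chains with `(a_0, …, a_n) ↦ f(a_0, …, a_n)`. -/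
def lin (hf : IsFormula f) : AlgChain R A n →ₗ[ℂ] Z :=
  { (hf.hom : AlgT R A n →+ Z) with
    map_smul' := fun c z => hf.hom_csmul c z }

theorem lin_cls (hf : IsFormula f) (h : Hd R A n) (v : Fin n → A) :
    hf.lin (cls h v) = f h v :=
  hf.hom_tens h v

/-- The operator `C_n(A) → C_m(A)` with `(a_0, …, a_n) ↦ f(a_0, …, a_n)`. -/
def op {m : ℕ} {f : Hd R A n → (Fin n → A) → AlgChain R A m} (hf : IsFormula f) :
    Chain R A n →L[ℂ] Chain R A m :=
  ContinuousLinearMap.completion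
    { hf.lin with
      cont := WithProj.continuous_lift hf.lin (by
        have h : (fun x => hf.lin (WithProj.of (tens R A n) x)) = fun p => f p.1 p.2 :=
          funext fun p => hf.lin_cls p.1 p.2
        rw [h]
        exact hf.cont) }

end IsFormula

variable [IsTopologicalAddGroup A] [ContinuousMul A] [ContinuousSMul R A]

/-- Formulas that are `R`-multilinear and jointly continuous in `(a_0, (a_1, …, a_n))`. -/
structure IsRFormula {n m : ℕ} (f : Hd R A n → (Fin n → A) → AlgChain R A m) : Prop where
  head_add : ∀ h h' v, f (h + h') v = f h v + f h' v
  head_smul : ∀ (r : R) h v, f (r • h) v = r • f h v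
  update_add : ∀ h v i x y, f h (update v i (x + y)) = f h (update v i x) + f h (update v i y)
  update_smul : ∀ h v i (r : R) x, f h (update v i (r • x)) = r • f h (update v i x)
  cont : Continuous fun p : Hd R A n × (Fin n → A) => f p.1 p.2

/-- Formulas that are `R`-multilinear and jointly continuous in `(a_0, …, a_{k-1}) ∈ A^k`. -/
structure IsRMulti {k m : ℕ} (g : (Fin k → A) → AlgChain R A m) : Prop where
  update_add : ∀ v i x y, g (update v i (x + y)) = g (update v i x) + g (update v i y)
  update_smul : ∀ v i (r : R) x, g (update v i (r • x)) = r • g (update v i x)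
  cont : Continuous g

/-- Jointly continuous `R`-bilinear products on `A`. -/
structure IsRBilin (R : Type) {A : Type u} [CommRing R] [NonUnitalRing A] [Module R A]
    [TopologicalSpace A] (β : A → A → A) : Prop where
  add_left : ∀ x x' y, β (x + x') y = β x y + β x' y
  add_right : ∀ x y y', β x (y + y') = β x y + β x y'
  smul_left : ∀ (r : R) x y, β (r • x) y = r • β x y
  smul_right : ∀ (r : R) x y, β x (r • y) = r • β x y
  cont : Continuous fun p : A × A => β p.1 p.2

theorem isRBilin_mul [IsScalarTower R A A] [SMulCommClass R A A] :
    IsRBilin R (fun x y : A => x * y) where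
  add_left := add_mul
  add_right := mul_add
  smul_left := smul_mul_assoc
  smul_right := fun r x y => mul_smul_comm r x y
  cont := continuous_mul

namespace IsRFormula

variable {n m : ℕ}

theorem isFormula {f : Hd R A n → (Fin n → A) → AlgChain R A m} (hf : IsRFormula f) :
    IsFormula f where
  head_add := hf.head_add
  update_add := hf.update_add
  balanced r h v i := by rw [hf.head_smul, hf.update_smul, update_eq_self]
  csmul c h v := hf.head_smul _ h v
  cont := hf.cont

theorem add {f g : Hd R A n → (Fin n → A) → AlgChain R A m} (hf : IsRFormula f)
    (hg : IsRFormula g) : IsRFormula fun h v => f h v + g h v where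
  head_add h h' v := by simp only [hf.head_add, hg.head_add]; abel
  head_smul r h v := by simp only [hf.head_smul, hg.head_smul, smul_add]
  update_add h v i x y := by simp only [hf.update_add, hg.update_add]; abel
  update_smul h v i r x := by simp only [hf.update_smul, hg.update_smul, smul_add]
  cont := hf.cont.add hg.cont

theorem zero : IsRFormula fun (_ : Hd R A n) (_ : Fin n → A) => (0 : AlgChain R A m) where
  head_add _ _ _ := (add_zero _).symm
  head_smul _ _ _ := (smul_zero _).symm
  update_add _ _ _ _ _ := (add_zero _).symm
  update_smul _ _ _ _ _ := (smul_zero _).symm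
  cont := continuous_const

theorem csmul {f : Hd R A n → (Fin n → A) → AlgChain R A m} (hf : IsRFormula f) (c : ℂ) :
    IsRFormula fun h v => c • f h v where
  head_add h h' v := by simp only [hf.head_add, smul_add]
  head_smul r h v := by simp only [hf.head_smul]; exact (smul_comm r c _).symm
  update_add h v i x y := by simp only [hf.update_add, smul_add]
  update_smul h v i r x := by simp only [hf.update_smul]; exact (smul_comm r c _).symm
  cont := hf.cont.const_smul c

theorem sum {ι : Type*} (s : Finset ι) {f : ι → Hd R A n → (Fin n → A) → AlgChain R A m}
    (hf : ∀ i ∈ s, IsRFormula (f i)) : IsRFormula fun h v => ∑ i ∈ s, f i h v := by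
  classical
  induction s using Finset.induction_on with
  | empty => simpa using zero
  | insert a s ha ih =>
    simp only [Finset.sum_insert ha]
    exact (hf a (Finset.mem_insert_self a s)).add
      (ih fun i hi => hf i (Finset.mem_insert_of_mem hi))

end IsRFormula

section builders

variable {n m k : ℕ}

theorem isRMulti_cls (h : Hd R A n) : IsRMulti (R := R) (fun v : Fin n → A => cls h v) where
  update_add := cls_update_add h
  update_smul v i r x := cls_update_smul h v i r x
  cont := continuous_cls.comp (continuous_const.prodMk continuous_id)

/-- Permuting the entries. -/
theorem IsRMulti.perm {g : (Fin k → A) → AlgChain R A m} (hg : IsRMulti g)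
    (σ : Equiv.Perm (Fin k)) : IsRMulti fun v => g (fun i => v (σ i)) := by
  have key : ∀ (v : Fin k → A) (i : Fin k) (x : A),
      (fun l => update v i x (σ l)) = update (fun l => v (σ l)) (σ.symm i) x := by
    intro v i x
    funext l
    simp only [update_apply, Equiv.eq_symm_apply]
  refine ⟨fun v i x y => ?_, fun v i r x => ?_, ?_⟩
  · simp only [key, hg.update_add]
  · simp only [key, hg.update_smul]
  · exact hg.cont.comp (continuous_pi fun i => continuous_apply (σ i))

/-- `(v_0, …, v_k) ↦ (v_0, …, v_{j-1}, β(v_j, v_{j+1}), v_{j+2}, …, v_k)`. -/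
def mergeAt (β : A → A → A) (j : Fin k) (v : Fin (k + 1) → A) : Fin k → A := fun i =>
  if i < j then v i.castSucc else if i = j then β (v j.castSucc) (v j.succ) else v i.succ

theorem mergeAt_update (β : A → A → A) (j : Fin k) (v : Fin (k + 1) → A) (i : Fin (k + 1)) :
    (i = j.castSucc ∧ ∀ x, mergeAt β j (update v i x) = update (mergeAt β j v) j
        (β x (v j.succ))) ∨
    (i = j.succ ∧ ∀ x, mergeAt β j (update v i x) = update (mergeAt β j v) j
        (β (v j.castSucc) x)) ∨
    ∃ l, ∀ x, mergeAt β j (update v i x) = update (mergeAt β j v) l x := by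
  rcases lt_trichotomy (i : ℕ) j with hij | hij | hij
  · refine Or.inr (Or.inr ⟨⟨i, by omega⟩, fun x => ?_⟩)
    funext a
    simp only [mergeAt, update_apply, Fin.ext_iff, Fin.lt_def, Fin.val_castSucc, Fin.val_succ]
    split_ifs <;> first | rfl | (exfalso; omega)
  · refine Or.inl ⟨Fin.ext hij, fun x => ?_⟩
    funext a
    simp only [mergeAt, update_apply, Fin.ext_iff, Fin.lt_def, Fin.val_castSucc, Fin.val_succ]
    split_ifs <;> first | rfl | (exfalso; omega)
  · rcases eq_or_ne (i : ℕ) (j + 1) with h1 | h1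
    · refine Or.inr (Or.inl ⟨Fin.ext h1, fun x => ?_⟩)
      funext a
      simp only [mergeAt, update_apply, Fin.ext_iff, Fin.lt_def, Fin.val_castSucc, Fin.val_succ]
      split_ifs <;> first | rfl | (exfalso; omega)
    · refine Or.inr (Or.inr ⟨⟨i - 1, by omega⟩, fun x => ?_⟩)
      funext a
      simp only [mergeAt, update_apply, Fin.ext_iff, Fin.lt_def, Fin.val_castSucc, Fin.val_succ]
      split_ifs <;> first | rfl | (exfalso; omega)

theorem continuous_mergeAt {β : A → A → A} (hβ : IsRBilin R β) (j : Fin k) :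
    Continuous (mergeAt β j) := by
  refine continuous_pi fun i => ?_
  unfold mergeAt
  split_ifs
  · exact continuous_apply _
  · have h2 : Continuous fun v : Fin (k + 1) → A => (v j.castSucc, v j.succ) :=
      (continuous_apply j.castSucc).prodMk (continuous_apply j.succ)
    exact hβ.cont.comp h2
  · exact continuous_apply _

/-- Merging two adjacent entries. -/
theorem IsRMulti.merge {g : (Fin k → A) → AlgChain R A m} (hg : IsRMulti g) {β : A → A → A}
    (hβ : IsRBilin R β) (j : Fin k) : IsRMulti fun v => g (mergeAt β j v) := by
  refine ⟨fun v i x y => ?_, fun v i r x => ?_, hg.cont.comp (continuous_mergeAt hβ j)⟩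
  · rcases mergeAt_update β j v i with ⟨_, h⟩ | ⟨_, h⟩ | ⟨l, h⟩
    · simp only [h, hβ.add_left, hg.update_add]
    · simp only [h, hβ.add_right, hg.update_add]
    · simp only [h, hg.update_add]
  · rcases mergeAt_update β j v i with ⟨_, h⟩ | ⟨_, h⟩ | ⟨l, h⟩
    · simp only [h, hβ.smul_left, hg.update_smul]
    · simp only [h, hβ.smul_right, hg.update_smul]
    · simp only [h, hg.update_smul]

/-- Formulas that involve `a_0` only through its component in `A`. -/
theorem IsRMulti.cons {g : (Fin (n + 1) → A) → AlgChain R A m} (hg : IsRMulti g) :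
    IsRFormula fun (h : Hd R A n) (v : Fin n → A) =>
      g (Fin.cons (α := fun _ => A) (Hd.toA n h) v) := by
  have key : ∀ (x : A) (v : Fin n → A), (Fin.cons x v : Fin (n + 1) → A)
      = update (Fin.cons 0 v : Fin (n + 1) → A) 0 x := fun x v => (Fin.update_cons_zero _ _ _).symm
  refine ⟨fun h h' v => ?_, fun r h v => ?_, fun h v i x y => ?_, fun h v i r x => ?_, ?_⟩
  · simp only [map_add]
    rw [key (_ + _) v, hg.update_add, ← key, ← key]
  · simp only [map_smul]
    rw [key (_ • _) v, hg.update_smul, ← key]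
  · simp only [Fin.cons_update, hg.update_add]
  · simp only [Fin.cons_update, hg.update_smul]
  · refine hg.cont.comp (continuous_pi fun i => ?_)
    refine Fin.cases ?_ (fun j => ?_) i
    · exact (Hd.continuous_toA n).comp continuous_fst
    · exact (continuous_apply j).comp continuous_snd

/-- The formula `(a_0, (v_0, …)) ↦ (a_0 v_0, v_1, …)`. -/
theorem isRFormula_first [IsScalarTower R A A] [SMulCommClass R A A] :
    IsRFormula fun (h : Hd R A (n + 1)) (v : Fin (n + 1) → A) =>
      cls (Hd.ofA n (Hd.lmul h (v 0))) (Fin.tail v) := by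
  refine ⟨fun h h' v => ?_, fun r h v => ?_, fun h v i x y => ?_, fun h v i r x => ?_, ?_⟩
  · rw [← cls_head_add, ← map_add]
    congr 2
    simp only [Hd.lmul, map_add, add_smul, add_mul]
    abel
  · rw [← cls_head_smul, ← map_smul]
    congr 2
    simp only [Hd.lmul, map_smul, smul_add, smul_eq_mul, mul_smul, smul_mul_assoc]
  · refine Fin.cases ?_ (fun j => ?_) i
    · simp only [update_self, Fin.tail_update_zero, Hd.lmul, smul_add, mul_add, map_add,
        cls_head_add]
      abel
    · simp only [Fin.tail_update_succ, cls_update_add,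
        update_of_ne (Fin.succ_ne_zero j).symm]
  · refine Fin.cases ?_ (fun j => ?_) i
    · simp only [update_self, Fin.tail_update_zero]
      rw [← cls_head_smul, ← map_smul]
      congr 2
      simp only [Hd.lmul, smul_add, mul_smul_comm, smul_comm _ r]
    · simp only [Fin.tail_update_succ, cls_update_smul,
        update_of_ne (Fin.succ_ne_zero j).symm]
  · refine continuous_cls.comp (Continuous.prodMk ((Hd.continuous_ofA n).comp ?_) ?_)
    · have h0 : Continuous fun p : Hd R A (n + 1) × (Fin (n + 1) → A) => p.2 0 :=
        (continuous_apply 0).comp continuous_snd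
      exact (((Hd.continuous_toR _).comp continuous_fst).smul h0).add
        (((Hd.continuous_toA _).comp continuous_fst).mul h0)
    · exact continuous_pi fun i => (continuous_apply i.succ).comp continuous_snd

/-- The formula `(a_0, (v_0, …, v_n)) ↦ (v_n a_0, v_0, …, v_{n-1})`. -/
theorem isRFormula_last [IsScalarTower R A A] [SMulCommClass R A A] :
    IsRFormula fun (h : Hd R A (n + 1)) (v : Fin (n + 1) → A) =>
      cls (Hd.ofA n (Hd.rmul (v (Fin.last n)) h)) (Fin.init v) := by
  refine ⟨fun h h' v => ?_, fun r h v => ?_, fun h v i x y => ?_, fun h v i r x => ?_, ?_⟩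
  · rw [← cls_head_add, ← map_add]
    congr 2
    simp only [Hd.rmul, map_add, add_smul, mul_add]
    abel
  · rw [← cls_head_smul, ← map_smul]
    congr 2
    simp only [Hd.rmul, map_smul, smul_add, smul_eq_mul, mul_smul, mul_smul_comm]
  · refine Fin.lastCases ?_ (fun j => ?_) i
    · simp only [update_self, Fin.init_update_last, Hd.rmul, smul_add, add_mul, map_add,
        cls_head_add]
      abel
    · simp only [Fin.init_update_castSucc, cls_update_add,
        update_of_ne (Fin.castSucc_lt_last j).ne']
  · refine Fin.lastCases ?_ (fun j => ?_) i
    · simp only [update_self, Fin.init_update_last]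
      rw [← cls_head_smul, ← map_smul]
      congr 2
      simp only [Hd.rmul, smul_add, smul_mul_assoc, smul_comm _ r]
    · simp only [Fin.init_update_castSucc, cls_update_smul,
        update_of_ne (Fin.castSucc_lt_last j).ne']
  · refine continuous_cls.comp (Continuous.prodMk ((Hd.continuous_ofA n).comp ?_) ?_)
    · have h0 : Continuous fun p : Hd R A (n + 1) × (Fin (n + 1) → A) => p.2 (Fin.last n) :=
        (continuous_apply (Fin.last n)).comp continuous_snd
      exact (((Hd.continuous_toR _).comp continuous_fst).smul h0).add
        (h0.mul ((Hd.continuous_toA _).comp continuous_fst))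
    · exact continuous_pi fun i => (continuous_apply i.castSucc).comp continuous_snd

/-- The formula `(a_0, (v_0, …)) ↦ (a_0, v_0, …, β(v_j, v_{j+1}), …)`. -/
theorem isRFormula_merge {β : A → A → A} (hβ : IsRBilin R β) (j : Fin n) :
    IsRFormula fun (h : Hd R A (n + 1)) (v : Fin (n + 1) → A) =>
      cls (Hd.down n h) (mergeAt β j v) where
  head_add h h' v := by rw [map_add, cls_head_add]
  head_smul r h v := by rw [map_smul, cls_head_smul]
  update_add h := ((isRMulti_cls (Hd.down n h)).merge hβ j).update_add
  update_smul h := ((isRMulti_cls (Hd.down n h)).merge hβ j).update_smul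
  cont := continuous_cls.comp (((Hd.continuous_down n).comp continuous_fst).prodMk
    ((continuous_mergeAt hβ j).comp continuous_snd))

/-- Merging the first two entries after `a_0` beforehand. -/
theorem IsRFormula.mergeFirst {f : Hd R A (n + 1) → (Fin (n + 1) → A) → AlgChain R A m}
    (hf : IsRFormula f) {β : A → A → A} (hβ : IsRBilin R β) :
    IsRFormula fun (h : Hd R A (n + 2)) v => f (Hd.down (n + 1) h) (mergeAt β 0 v) where
  head_add _ _ _ := hf.head_add _ _ _
  head_smul r _ _ := hf.head_smul r _ _
  update_add h := (IsRMulti.merge (g := f (Hd.down (n + 1) h)) ⟨hf.update_add _,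
    hf.update_smul _, hf.cont.comp (continuous_const.prodMk continuous_id)⟩ hβ 0).update_add
  update_smul h := (IsRMulti.merge (g := f (Hd.down (n + 1) h)) ⟨hf.update_add _,
    hf.update_smul _, hf.cont.comp (continuous_const.prodMk continuous_id)⟩ hβ 0).update_smul
  cont := hf.cont.comp (((Hd.continuous_down _).comp continuous_fst).prodMk
    ((continuous_mergeAt hβ 0).comp continuous_snd))

/-- The formula `(a_0, (v_0, v_1, v_2, …)) ↦ (a_0 β(v_0, v_1), v_2, …)`. -/
theorem isRFormula_contract [IsScalarTower R A A] [SMulCommClass R A A] {β : A → A → A}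
    (hβ : IsRBilin R β) :
    IsRFormula fun (h : Hd R A (n + 2)) (v : Fin (n + 2) → A) =>
      cls (Hd.ofA n (Hd.lmul h (β (v 0) (v 1)))) (fun i => v i.succ.succ) :=
  (isRFormula_first (R := R) (A := A) (n := n)).mergeFirst hβ

end builders

variable [IsTopologicalAddGroup R] [IsScalarTower R A A] [SMulCommClass R A A]

section Differentials

variable (R A)

/-- The Hochschild boundary on elementary chains of degree `n + 1`:
`b(a_0, …, a_{n+1}) = ∑_{j=0}^{n} (-1)^j (a_0, …, a_j a_{j+1}, …, a_{n+1})
  + (-1)^{n+1} (a_{n+1} a_0, a_1, …, a_n)`.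
The entry `a_0` is `h` and the entry `a_{j+1}` is `v j`. -/
def bFormula (n : ℕ) (h : Hd R A (n + 1)) (v : Fin (n + 1) → A) : AlgChain R A n :=
  cls (Hd.ofA n (Hd.lmul h (v 0))) (Fin.tail v)
    + ∑ j : Fin n, (-1 : ℂ) ^ ((j : ℕ) + 1) • cls (Hd.down n h) (mergeAt (fun x y => x * y) j v)
    + (-1 : ℂ) ^ (n + 1) • cls (Hd.ofA n (Hd.rmul (v (Fin.last n)) h)) (Fin.init v)

theorem isFormula_b (n : ℕ) : IsFormula (bFormula R A n) :=
  ((isRFormula_first.add (IsRFormula.sum _ fun j _ =>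
    (isRFormula_merge isRBilin_mul j).csmul _)).add (isRFormula_last.csmul _)).isFormula

/-- The Hochschild boundary `b : C_{n+1}(A) → C_n(A)`. -/
def bOp (n : ℕ) : Chain R A (n + 1) →L[ℂ] Chain R A n := (isFormula_b R A n).op

/-- The operator `B` on elementary chains of degree `n`:
`B(a_0, …, a_n) = ∑_{j=0}^{n} (-1)^{jn} (e, a_j, …, a_n, a_0, …, a_{j-1})` if `a_0 ∈ A`, and
`B(e, a_1, …, a_n) = 0`. (Indices in `Fin (n + 1)` are added modulo `n + 1`.) -/
def BFormula (n : ℕ) (h : Hd R A n) (v : Fin n → A) : AlgChain R A (n + 1) :=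
  ∑ j : Fin (n + 1), (-1 : ℂ) ^ ((j : ℕ) * n) •
    cls (Hd.e n) (fun i => (Fin.cons (Hd.toA n h) v : Fin (n + 1) → A) (i + j))

theorem isFormula_B (n : ℕ) : IsFormula (BFormula R A n) :=
  (IsRFormula.sum _ fun j _ =>
    ((isRMulti_cls (Hd.e n)).perm (Equiv.addRight j)).cons.csmul _).isFormula

/-- The operator `B : C_n(A) → C_{n+1}(A)`. -/
def BOp (n : ℕ) : Chain R A n →L[ℂ] Chain R A (n + 1) := (isFormula_B R A n).op

/-- `C_even(A) = ∏ C_{2n}(A)`. -/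
abbrev CEven : Type u := ∀ n : ℕ, Chain R A (2 * n)

/-- `C_odd(A) = ∏ C_{2n+1}(A)`. -/
abbrev COdd : Type u := ∀ n : ℕ, Chain R A (2 * n + 1)

/-- The differential `b + B : C_even(A) → C_odd(A)`. -/
def dEven : CEven R A →ₗ[ℂ] COdd R A where
  toFun ω n := bOp R A (2 * n + 1) (ω (n + 1)) + BOp R A (2 * n) (ω n)
  map_add' ω η := by
    funext n
    simp only [Pi.add_apply, map_add]
    abel
  map_smul' c ω := by
    funext n
    simp only [Pi.smul_apply, map_smul, smul_add, RingHom.id_apply]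

/-- The component of degree `2n` of `B ω`, for `ω ∈ C_odd(A)`. -/
def BOdd : ∀ n : ℕ, COdd R A →ₗ[ℂ] Chain R A (2 * n)
  | 0 => 0
  | n + 1 => (BOp R A (2 * n + 1)).toLinearMap ∘ₗ LinearMap.proj n

/-- The differential `b + B : C_odd(A) → C_even(A)`. -/
def dOdd : COdd R A →ₗ[ℂ] CEven R A where
  toFun ω n := bOp R A (2 * n) (ω n) + BOdd R A n ω
  map_add' ω η := by
    funext n
    simp only [Pi.add_apply, map_add]
    abel
  map_smul' c ω := by
    funext n
    simp only [Pi.smul_apply, map_smul, smul_add, RingHom.id_apply]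

/-- The even periodic cyclic homology of `A` over the ground ring `R`. -/
abbrev HP0 : Type u :=
  LinearMap.ker (dEven R A) ⧸ (LinearMap.range (dOdd R A)).submoduleOf (LinearMap.ker (dEven R A))

/-- The odd periodic cyclic homology of `A` over the ground ring `R`. -/
abbrev HP1 : Type u :=
  LinearMap.ker (dOdd R A) ⧸ (LinearMap.range (dEven R A)).submoduleOf (LinearMap.ker (dOdd R A))

variable {R A}

/-- The class of an even cycle. -/
def HP0.mk (ω : CEven R A) (hω : dEven R A ω = 0) : HP0 R A :=
  Submodule.Quotient.mk ⟨ω, hω⟩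

/-- The class of an odd cycle. -/
def HP1.mk (ω : COdd R A) (hω : dOdd R A ω = 0) : HP1 R A :=
  Submodule.Quotient.mk ⟨ω, hω⟩

end Differentials

section ChernCharacter

variable {N : ℕ}

/-- The generalized trace of the elementary chain `M_0 ⊗ M_1 ⊗ ⋯ ⊗ M_n` of matrices:
`∑ (M_0)_{i_0 i_1} ⊗ (M_1)_{i_1 i_2} ⊗ ⋯ ⊗ (M_n)_{i_n i_0}`. -/
def genTrace (n : ℕ) (M₀ : Matrix (Fin N) (Fin N) (Hd R A n))
    (M : Fin n → Matrix (Fin N) (Fin N) A) : Chain R A n :=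
  ∑ i : Fin (n + 1) → Fin N,
    (cls (M₀ (i 0) (i (0 + 1))) (fun k => M k (i k.succ) (i (k.succ + 1))) : AlgChain R A n)

variable (R) in
/-- The unit of the unitization of `M_N(A)`, as a matrix over `A_+`. -/
def eMat (A : Type u) [NonUnitalRing A] [Module R A] (N n : ℕ) :
    Matrix (Fin N) (Fin N) (Hd R A (n + 1)) :=
  Matrix.of fun i j => if i = j then Hd.e n else 0

variable (R) in
/-- The Chern character of an idempotent `P ∈ M_N(A)`: `(ch P)_0 = tr P` and
`(ch P)_{2n} = (-1)^n (2n)!/n! · T(P^{⊗(2n+1)} - ½ e ⊗ P^{⊗ 2n})` for `n ≥ 1`, where `T` is the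
generalized trace. -/
def chP (P : Matrix (Fin N) (Fin N) A) : CEven R A
  | 0 => genTrace 0 (P.map (Hd.ofA 0)) (fun _ => P)
  | n + 1 =>
    ((-1 : ℂ) ^ (n + 1) * ((2 * (n + 1)).factorial : ℂ) / ((n + 1).factorial : ℂ)) •
      (genTrace (2 * n + 1 + 1) (P.map (Hd.ofA (2 * n + 1 + 1))) (fun _ => P)
        - (1 / 2 : ℂ) • genTrace (2 * n + 1 + 1) (eMat R A N (2 * n + 1)) (fun _ => P))

/-- `W` is the inverse of `U` in the matrix algebra `M_N(A)`, which has the unit `one`. -/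
structure IsInverse (one U W : Matrix (Fin N) (Fin N) A) : Prop where
  one_mul : ∀ M : Matrix (Fin N) (Fin N) A, one * M = M
  mul_one : ∀ M : Matrix (Fin N) (Fin N) A, M * one = M
  mul_inv : U * W = one
  inv_mul : W * U = one

variable (R) in
/-- The Chern character of an invertible `U ∈ M_N(A)` with inverse `W`. As the chains
`A_+ ⊗ A^{⊗ k}` are the chains of the unital algebra `A_+` normalized by its unit `e`, it is formed
with the invertible element `V = U - 1 + e`, whose inverse is `W - 1 + e`:
`(ch U)_{2n+1} = (-1)^n n! · T(V⁻¹ ⊗ V ⊗ V⁻¹ ⊗ ⋯ ⊗ V⁻¹ ⊗ V)`, where all entries but the first one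
are taken modulo `e`, that is, they are `U - 1` and `W - 1` in turn. -/
def chU (one U W : Matrix (Fin N) (Fin N) A) : COdd R A := fun n =>
  ((-1 : ℂ) ^ n * (n.factorial : ℂ)) •
    genTrace (2 * n + 1) ((W - one).map (Hd.ofA (2 * n + 1)) + eMat R A N (2 * n))
      (fun k => if Even (k : ℕ) then U - one else W - one)

end ChernCharacter

section GaussManinConnection

/-- Continuous `ℂ`-linear derivations of the ground ring. -/
structure ContDerivation (R : Type) [CommRing R] [Algebra ℂ R] [TopologicalSpace R] where
  toDer : Derivation ℂ R R
  cont : Continuous toDer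

variable [Module ℂ A] [IsScalarTower ℂ R A]

/-- A connection on the `R`-module `A`, with respect to a derivation `δ` of `R`. -/
structure Connection (δ : ContDerivation R) (A : Type u) [NonUnitalRing A] [Module R A]
    [TopologicalSpace A] [Module ℂ A] where
  toCLM : A →L[ℂ] A
  leibniz : ∀ (r : R) (a : A), toCLM (r • a) = δ.toDer r • a + r • toCLM a

namespace Connection

variable {δ : ContDerivation R} (D : Connection δ A)

/-- The defect of `∇` from being a derivation, `E(a, b) = ∇(a) b + a ∇(b) - ∇(a b)`. -/
def E (a b : A) : A := D.toCLM a * b + a * D.toCLM b - D.toCLM (a * b)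

theorem isRBilin_E : IsRBilin R D.E where
  add_left x x' y := by simp only [E, map_add, add_mul]; abel
  add_right x y y' := by simp only [E, map_add, mul_add]; abel
  smul_left r x y := by
    simp only [E, smul_mul_assoc, D.leibniz, add_mul, smul_sub, smul_add]
    abel
  smul_right r x y := by
    simp only [E, mul_smul_comm, D.leibniz, mul_add, smul_sub, smul_add]
    abel
  cont := by
    unfold E
    have := D.toCLM.continuous
    fun_prop

/-- The extension of `∇` to `A_+ = A ⊕ R` with `∇ e = 0`. -/
def plus : Unitization R A →+ Unitization R A where
  toFun x := .mk (δ.toDer x.fst, D.toCLM x.snd)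
  map_zero' := Unitization.ext (map_zero δ.toDer) (map_zero D.toCLM)
  map_add' x y := Unitization.ext (map_add δ.toDer x.fst y.fst) (map_add D.toCLM x.snd y.snd)

/-- The action of `∇` on the entry `a_0` of an elementary chain. -/
def hd : ∀ n, Hd R A n →+ Hd R A n
  | 0 => (D.toCLM : A →ₗ[ℂ] A).toAddMonoidHom
  | _ + 1 => D.plus

theorem plus_leibniz (r : R) (x : Unitization R A) :
    D.plus (r • x) = δ.toDer r • x + r • D.plus x := by
  refine Unitization.ext ?_ (D.leibniz r x.snd)
  refine (δ.toDer.leibniz r x.fst).trans ?_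
  rw [add_comm, smul_eq_mul x.fst, mul_comm x.fst]
  rfl

theorem hd_leibniz : ∀ (n : ℕ) (r : R) (h : Hd R A n),
    D.hd n (r • h) = δ.toDer r • h + r • D.hd n h
  | 0, r, h => D.leibniz r h
  | _ + 1, r, h => D.plus_leibniz r h

theorem continuous_hd : ∀ n, Continuous (D.hd n)
  | 0 => D.toCLM.continuous
  | n + 1 => continuous_induced_rng.2
    ((δ.cont.comp (Hd.continuous_toR (R := R) (A := A) (n + 1))).prodMk
      (D.toCLM.continuous.comp (Hd.continuous_toA (R := R) (A := A) (n + 1))))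

/-- The Lie derivative `L_∇(a_0, …, a_n) = ∑_i (a_0, …, ∇ a_i, …, a_n)`. -/
def LFormula (n : ℕ) (h : Hd R A n) (v : Fin n → A) : AlgChain R A n :=
  cls (D.hd n h) v + ∑ i : Fin n, cls h (update v i (D.toCLM (v i)))

theorem isFormula_L (n : ℕ) : IsFormula (D.LFormula n) := by
  have hbal : ∀ (r : R) (h : Hd R A n) (v : Fin n → A),
      D.LFormula n (r • h) v = δ.toDer r • cls h v + r • D.LFormula n h v := by
    intro r h v
    simp only [LFormula, D.hd_leibniz, cls_head_add, cls_head_smul, smul_add, Finset.smul_sum]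
    abel
  refine ⟨fun h h' v => ?_, fun h v i x y => ?_, fun r h v i => ?_, fun c h v => ?_, ?_⟩
  · simp only [LFormula, map_add, cls_head_add, Finset.sum_add_distrib]
    abel
  · have key : ∀ k, cls h (update (update v i (x + y)) k (D.toCLM (update v i (x + y) k))) =
        cls h (update (update v i x) k (D.toCLM (update v i x k))) +
        cls h (update (update v i y) k (D.toCLM (update v i y k))) := by
      intro k
      rcases eq_or_ne k i with rfl | hk
      · simp only [update_self, update_idem, map_add, cls_update_add]
      · simp only [update_of_ne hk, update_comm hk.symm, cls_update_add]
    simp only [LFormula, key, cls_update_add, Finset.sum_add_distrib]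
    abel
  · have key : ∀ k, cls h (update (update v i (r • v i)) k (D.toCLM (update v i (r • v i) k))) =
        r • cls h (update v k (D.toCLM (v k))) + if k = i then δ.toDer r • cls h v else 0 := by
      intro k
      rcases eq_or_ne k i with rfl | hk
      · simp only [update_self, update_idem, D.leibniz, cls_update_add, cls_update_smul,
          update_eq_self, if_true]
        abel
      · rw [update_of_ne hk, if_neg hk, add_zero, update_comm hk.symm, cls_update_smul,
          update_comm hk, update_eq_self]
    rw [hbal]
    simp only [LFormula, key, Finset.sum_add_distrib, cls_update_smul, update_eq_self, smul_add,
      Finset.smul_sum, Finset.sum_ite_eq', Finset.mem_univ, if_true]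
    abel
  · rw [hbal, Derivation.map_algebraMap, zero_smul, zero_add]
    rfl
  · have h1 : Continuous fun p : Hd R A n × (Fin n → A) => cls (D.hd n p.1) p.2 :=
      continuous_cls.comp (((D.continuous_hd n).comp continuous_fst).prodMk continuous_snd)
    have h2 : ∀ i : Fin n, Continuous fun p : Hd R A n × (Fin n → A) =>
        cls p.1 (update p.2 i (D.toCLM (p.2 i))) := fun i =>
      continuous_cls.comp (continuous_fst.prodMk (continuous_snd.update i
        (D.toCLM.continuous.comp ((continuous_apply i).comp continuous_snd))))
    exact h1.add (continuous_finsetSum _ fun i _ => h2 i)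

/-- The Lie derivative `L_∇ : C_n(A) → C_n(A)`. -/
def LOp (n : ℕ) : Chain R A n →L[ℂ] Chain R A n := (D.isFormula_L n).op

/-- The contraction `ι_E(a_0, …, a_{n+2}) = -(a_0 E(a_1, a_2), a_3, …, a_{n+2})`. -/
def iFormula (n : ℕ) (h : Hd R A (n + 2)) (v : Fin (n + 2) → A) : AlgChain R A n :=
  (-1 : ℂ) • cls (Hd.ofA n (Hd.lmul h (D.E (v 0) (v 1)))) (fun i => v i.succ.succ)

theorem isFormula_i (n : ℕ) : IsFormula (D.iFormula n) :=
  ((isRFormula_contract D.isRBilin_E).csmul _).isFormula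

/-- The contraction `ι_E : C_{n+2}(A) → C_n(A)`. -/
def iOp (n : ℕ) : Chain R A (n + 2) →L[ℂ] Chain R A n := (D.isFormula_i n).op

/-- The operator `S_E` on elementary chains of degree `n + 1`: for `a_0 ∈ A`,
`S_E(a_0, …, a_{n+1}) = ∑_{i=1}^{n} ∑_{j=0}^{n-i} (-1)^{i+jn}
  (e, a_{n-j+2}, …, a_{n+1}, a_0, …, a_{i-1}, E(a_i, a_{i+1}), a_{i+2}, …, a_{n-j+1})`,
and `S_E(e, a_1, …, a_{n+1}) = 0`. (Indices in `Fin (n + 1)` are subtracted modulo `n + 1`.) -/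
def SFormula (n : ℕ) (h : Hd R A (n + 1)) (v : Fin (n + 1) → A) : AlgChain R A (n + 1) :=
  ∑ p ∈ (Finset.univ : Finset (Fin (n + 1) × Fin (n + 1))).filter
      (fun p => 1 ≤ (p.1 : ℕ) ∧ (p.1 : ℕ) + (p.2 : ℕ) ≤ n),
    (-1 : ℂ) ^ ((p.1 : ℕ) + (p.2 : ℕ) * n) • cls (Hd.e n)
      (fun l => mergeAt D.E p.1 (Fin.cons (Hd.toA (n + 1) h) v : Fin (n + 2) → A) (l - p.2))

theorem isFormula_S (n : ℕ) : IsFormula (D.SFormula n) :=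
  (IsRFormula.sum _ fun p _ => (((isRMulti_cls (Hd.e n)).perm (Equiv.subRight p.2)).merge
    D.isRBilin_E p.1).cons.csmul _).isFormula

/-- The operator `S_E : C_n(A) → C_n(A)`; it is zero on `C_0(A)`. -/
def SOp : ∀ n : ℕ, Chain R A n →L[ℂ] Chain R A n
  | 0 => 0
  | n + 1 => (D.isFormula_S n).op

/-- The Gauss-Manin connection `∇_GM = L_∇ - I_E`, `I_E = ι_E + S_E`, on `C_even(A)`. -/
def gmEven : CEven R A →ₗ[ℂ] CEven R A where
  toFun ω n := D.LOp (2 * n) (ω n) - (D.iOp (2 * n) (ω (n + 1)) + D.SOp (2 * n) (ω n))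
  map_add' ω η := by
    funext n
    simp only [Pi.add_apply, map_add]
    abel
  map_smul' c ω := by
    funext n
    simp only [Pi.smul_apply, map_smul, smul_add, smul_sub, RingHom.id_apply]

/-- The Gauss-Manin connection `∇_GM = L_∇ - I_E`, `I_E = ι_E + S_E`, on `C_odd(A)`. -/
def gmOdd : COdd R A →ₗ[ℂ] COdd R A where
  toFun ω n := D.LOp (2 * n + 1) (ω n)
    - (D.iOp (2 * n + 1) (ω (n + 1)) + D.SOp (2 * n + 1) (ω n))
  map_add' ω η := by
    funext n
    simp only [Pi.add_apply, map_add]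
    abel
  map_smul' c ω := by
    funext n
    simp only [Pi.smul_apply, map_smul, smul_add, smul_sub, RingHom.id_apply]

/-- The Gauss-Manin connection commutes with `b + B`. -/
structure IsChainMap : Prop where
  even : ∀ ω, dEven R A (D.gmEven ω) = D.gmOdd (dEven R A ω)
  odd : ∀ ω, dOdd R A (D.gmOdd ω) = D.gmEven (dOdd R A ω)

variable {D}

/-- The operator induced by the Gauss-Manin connection on even periodic cyclic homology. -/
def IsChainMap.gmHP0 (hD : D.IsChainMap) : HP0 R A →ₗ[ℂ] HP0 R A :=
  Submodule.mapQ _ _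
    (D.gmEven.restrict (p := LinearMap.ker (dEven R A)) (q := LinearMap.ker (dEven R A))
      (fun ω hω => by
        rw [LinearMap.mem_ker] at hω ⊢
        rw [hD.even, hω, map_zero]))
    (by
      rintro ⟨ω, hω⟩ ⟨η, hη⟩
      exact ⟨D.gmOdd η, (hD.odd η).trans (congrArg D.gmEven hη)⟩)

/-- The operator induced by the Gauss-Manin connection on odd periodic cyclic homology. -/
def IsChainMap.gmHP1 (hD : D.IsChainMap) : HP1 R A →ₗ[ℂ] HP1 R A :=
  Submodule.mapQ _ _
    (D.gmOdd.restrict (p := LinearMap.ker (dOdd R A)) (q := LinearMap.ker (dOdd R A))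
      (fun ω hω => by
        rw [LinearMap.mem_ker] at hω ⊢
        rw [hD.odd, hω, map_zero]))
    (by
      rintro ⟨ω, hω⟩ ⟨η, hη⟩
      exact ⟨D.gmEven η, (hD.even η).trans (congrArg D.gmOdd hη)⟩)

end Connection

end GaussManinConnection

end CyclicComplex

/-- The derivation `d/dt` of `C^∞(J)`. -/
def ddt (J : Opens ℝ) : ContDerivation (CJ J) where
  toDer := Derivation.mk' CInf.deriv fun f g => by
    refine (CInf.deriv_fsmul f g).trans ?_
    ext t
    change CInf.deriv f t * g t + f t * CInf.deriv g t = f t * CInf.deriv g t + g t * CInf.deriv f t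
    ring
  cont := CInf.continuous_deriv

end GaussManin

end

/-!
Regard chains as families of words with letters in `A`, tensored over `ℂ`. There the connection
acts on single letters, so that the contraction `(a_0 ∇(a_1), a_2, …)` makes sense, together with
a cyclic correction of the shape of `S_E`. In this formal complex `∇_GM` is null-homotopic: it is
the commutator of `b + B` with the corrected contraction. As `∇` is not `R`-linear, the homotopy
does not descend to tensor products over `R`, but `∇_GM` and `b + B` do, and the formal chains have
dense image in the chains of `A`; hence `∇_GM` commutes with `b + B` by continuity. Finally `ch P`
and `ch U` are the images of formal cycles: over `ℂ`, the words in `P` and the alternating words in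
`U⁻¹ - 1` and `U - 1`, to which the generalized trace is applied. So `∇_GM (ch P)` and
`∇_GM (ch U)` are the images of formal boundaries.
-/

noncomputable section

namespace GaussManin

section PrecyclicModule

open Finset

variable {k : Type*} [Ring k]

/-- A precyclic module (a cyclic module without degeneracies) over `k`, given by two operators on
the "words of length `m + 1`" in `V m`: the signed rotation `rotate` and the product `mul` of the
first two letters. The signed product of the letters `j` and `j + 1` is the conjugate of `mul` by
the `j`-th power of the rotation, where `rotate (m + 1) ^ ((m + 1) * j)` is the `(-j)`-th power, and
the axiom `mul_face` is the simplicial identity for the faces `0` and `j + 1`. -/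
structure PrecyclicModule (k : Type*) [Ring k] (V : ℕ → Type*) [∀ m, AddCommGroup (V m)]
    [∀ m, Module k (V m)] where
  rotate : ∀ m, V m →ₗ[k] V m
  mul : ∀ m, V (m + 1) →ₗ[k] V m
  rotate_pow : ∀ m, rotate m ^ (m + 1) = 1
  mul_face : ∀ m j, j ≤ m → ∀ x,
    mul m ((rotate (m + 1) ^ (j + 1)) (mul (m + 1) ((rotate (m + 2) ^ ((m + 2) * (j + 1))) x))) =
      -(rotate m ^ j) (mul m ((rotate (m + 1) ^ ((m + 1) * j)) (mul (m + 1) x)))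

namespace PrecyclicModule

variable {V : ℕ → Type*} [∀ m, AddCommGroup (V m)] [∀ m, Module k (V m)] (C : PrecyclicModule k V)

/-- The signed face operator `(-1)^j d_j`, which multiplies the letters `j` and `j + 1`. It is
defined for all natural numbers `j`, the letters being numbered cyclically. -/
def face (m j : ℕ) : V (m + 1) →ₗ[k] V m :=
  (C.rotate m ^ j) ∘ₗ C.mul m ∘ₗ C.rotate (m + 1) ^ ((m + 1) * j)

/-- The sum of the first `c` signed faces. It interpolates between the bar boundary and the
Hochschild boundary. -/
def sumFaces (m c : ℕ) : V (m + 1) →ₗ[k] V m := ∑ j ∈ range c, C.face m j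

/-- The Hochschild boundary `b`. -/
def boundary (m : ℕ) : V (m + 1) →ₗ[k] V m := C.sumFaces m (m + 2)

/-- The bar boundary `b'`. -/
def barBoundary (m : ℕ) : V (m + 1) →ₗ[k] V m := C.sumFaces m (m + 1)

/-- The sum of the first `r` powers of the signed rotation. -/
def sumRotations (m r : ℕ) : V m →ₗ[k] V m := ∑ j ∈ range r, C.rotate m ^ j

/-- The cyclic norm operator `N`. -/
def norm (m : ℕ) : V m →ₗ[k] V m := C.sumRotations m (m + 1)

theorem rotate_pow_mul (m j : ℕ) : C.rotate m ^ ((m + 1) * j) = 1 := by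
  rw [pow_mul, C.rotate_pow, one_pow]

theorem rotate_pow_apply (m : ℕ) (x : V m) : (C.rotate m ^ (m + 1)) x = x := by
  rw [C.rotate_pow, Module.End.one_apply]

theorem rotate_injective (m : ℕ) : Function.Injective (C.rotate m) := fun x y h => by
  rw [← C.rotate_pow_apply m x, ← C.rotate_pow_apply m y, pow_succ, Module.End.mul_apply,
    Module.End.mul_apply, h]

theorem rotate_surjective (m : ℕ) : Function.Surjective (C.rotate m) := fun x =>
  ⟨(C.rotate m ^ m) x, by rw [← Module.End.mul_apply, ← pow_succ', C.rotate_pow_apply]⟩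

theorem face_zero (m : ℕ) : C.face m 0 = C.mul m := by
  rw [face, mul_zero, pow_zero, pow_zero]
  rfl

theorem rotate_face (m j : ℕ) (x : V (m + 1)) :
    C.rotate m (C.face m j x) = C.face m (j + 1) (C.rotate (m + 1) x) := by
  have exponent : (m + 1) * (j + 1) + 1 = (m + 1) * j + (m + 1 + 1) := by ring
  simp only [face, LinearMap.comp_apply]
  rw [← Module.End.mul_apply (C.rotate (m + 1) ^ _) (C.rotate (m + 1)), ← pow_succ, exponent,
    pow_add _ ((m + 1) * j), C.rotate_pow, mul_one, ← Module.End.mul_apply (C.rotate m),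
    ← pow_succ']

theorem face_last (m : ℕ) (x : V (m + 1)) :
    C.face m (m + 1) x = C.face m 0 (C.rotate (m + 1) x) := by
  have exponent : (m + 1) * (m + 1) = (m + 1 + 1) * m + 1 := by ring
  rw [face_zero, face, LinearMap.comp_apply, LinearMap.comp_apply, C.rotate_pow_apply, exponent,
    pow_succ, C.rotate_pow_mul, one_mul]

theorem face_add (m j : ℕ) (x : V (m + 1)) :
    C.face m (j + (m + 2)) x = C.rotate m (C.face m j x) := by
  have exponent : (m + 1) * (j + (m + 2)) = (m + 1) * j + (m + 1 + 1) * (m + 1) := by ring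
  simp only [face, LinearMap.comp_apply]
  rw [exponent, pow_add _ ((m + 1) * j), C.rotate_pow_mul, mul_one,
    show j + (m + 2) = j + 1 + (m + 1) by ring, pow_add, C.rotate_pow, mul_one, pow_succ',
    Module.End.mul_apply]

theorem face_zero_face_succ (m j : ℕ) (hj : j ≤ m + 1) (x : V (m + 2)) :
    C.face m 0 (C.face (m + 1) (j + 1) x) = -C.face m j (C.face (m + 1) 0 x) := by
  rcases Nat.lt_or_ge m j with hmj | hjm
  · obtain rfl : j = m + 1 := by omega
    have wrapped : C.face m 0 (C.face (m + 1) 1 (C.rotate (m + 2) x)) =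
        -C.face m 0 (C.face (m + 1) 0 (C.rotate (m + 2) x)) := by
      rw [C.face_zero, C.face_zero]
      exact C.mul_face m 0 (Nat.zero_le _) _
    rw [C.face_last (m + 1), C.face_last m, C.rotate_face, wrapped, neg_neg]
  · rw [C.face_zero, C.face_zero]
    exact C.mul_face m j hjm x

theorem face_face (m i j : ℕ) (hj : j ≤ m + 1) (x : V (m + 2)) :
    C.face m i (C.face (m + 1) (i + j + 1) x) = -C.face m (i + j) (C.face (m + 1) i x) := by
  induction i generalizing x with
  | zero => simpa only [zero_add] using C.face_zero_face_succ m j hj x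
  | succ i ih =>
    obtain ⟨y, rfl⟩ := C.rotate_surjective _ x
    rw [show i + 1 + j + 1 = i + j + 1 + 1 by ring, ← C.rotate_face, ← C.rotate_face, ih, map_neg,
      C.rotate_face, C.rotate_face, show i + j + 1 = i + 1 + j by ring]

theorem sumFaces_zero (m : ℕ) : C.sumFaces m 0 = 0 := sum_range_zero _

theorem sumFaces_succ (m c : ℕ) (x : V (m + 1)) :
    C.sumFaces m (c + 1) x = C.sumFaces m c x + C.face m c x := by
  rw [sumFaces, sum_range_succ, LinearMap.add_apply, sumFaces]

theorem sumFaces_face (m c : ℕ) (hc : c ≤ m + 1) (x : V (m + 2)) :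
    C.sumFaces m c (C.face (m + 1) (c + 1) x) = -C.face m c (C.sumFaces (m + 1) c x) := by
  simp only [sumFaces, LinearMap.sum_apply, map_sum, ← sum_neg_distrib]
  refine sum_congr rfl fun i hi => ?_
  obtain ⟨j, rfl⟩ := Nat.exists_eq_add_of_lt (mem_range.1 hi)
  rw [show i + j + 1 + 1 = i + (j + 1) + 1 by ring, C.face_face m i (j + 1) (by omega), ← add_assoc]

theorem sumFaces_sumFaces (m c : ℕ) (hc : c ≤ m + 2) (x : V (m + 2)) :
    C.sumFaces m c (C.sumFaces (m + 1) (c + 1) x) = 0 := by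
  induction c with
  | zero => rw [sumFaces_zero, LinearMap.zero_apply]
  | succ c ih =>
    have diagonal : C.face m c (C.face (m + 1) (c + 1) x) = -C.face m c (C.face (m + 1) c x) :=
      C.face_face m c 0 (Nat.zero_le _) x
    rw [sumFaces_succ, sumFaces_succ, map_add, ih (by omega), C.sumFaces_face m c (by omega),
      C.sumFaces_succ _ c, map_add, map_add, diagonal]
    abel

theorem boundary_boundary (m : ℕ) (x : V (m + 2)) : C.boundary m (C.boundary (m + 1) x) = 0 :=
  C.sumFaces_sumFaces m (m + 2) le_rfl x

theorem barBoundary_barBoundary (m : ℕ) (x : V (m + 2)) :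
    C.barBoundary m (C.barBoundary (m + 1) x) = 0 :=
  C.sumFaces_sumFaces m (m + 1) (Nat.le_succ _) x

theorem boundary_eq_barBoundary_add (m : ℕ) (x : V (m + 1)) :
    C.boundary m x = C.barBoundary m x + C.face m 0 (C.rotate (m + 1) x) := by
  rw [boundary, sumFaces_succ, face_last, barBoundary]

theorem sumFaces_rotate (m c : ℕ) (x : V (m + 1)) :
    C.sumFaces m (c + 1) (C.rotate (m + 1) x) =
      C.rotate m (C.sumFaces m c x) + C.face m 0 (C.rotate (m + 1) x) := by
  simp only [sumFaces, LinearMap.sum_apply, map_sum, sum_range_succ', rotate_face,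
    LinearMap.add_apply]

theorem boundary_rotate (m : ℕ) (x : V (m + 1)) :
    C.boundary m (C.rotate (m + 1) x) =
      C.rotate m (C.barBoundary m x) + C.face m 0 (C.rotate (m + 1) x) :=
  C.sumFaces_rotate m (m + 1) x

theorem boundary_sub_rotate (m : ℕ) (x : V (m + 1)) :
    C.boundary m (x - C.rotate (m + 1) x) =
      C.barBoundary m x - C.rotate m (C.barBoundary m x) := by
  rw [map_sub, boundary_rotate, boundary_eq_barBoundary_add, add_sub_add_right_eq_sub]

theorem sumRotations_one (m : ℕ) : C.sumRotations m 1 = LinearMap.id := sum_range_one _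

theorem sumRotations_succ (m r : ℕ) (x : V m) :
    C.sumRotations m (r + 1) x = C.sumRotations m r x + (C.rotate m ^ r) x := by
  rw [sumRotations, sum_range_succ, LinearMap.add_apply, sumRotations]

theorem sumRotations_succ' (m r : ℕ) (x : V m) :
    C.sumRotations m (r + 1) x = C.rotate m (C.sumRotations m r x) + x := by
  simp only [sumRotations, sum_range_succ', LinearMap.add_apply, LinearMap.sum_apply, map_sum,
    pow_succ', Module.End.mul_apply, pow_zero, Module.End.one_apply]

theorem sumRotations_sub_rotate (m r : ℕ) (x : V m) :
    C.sumRotations m r x - C.rotate m (C.sumRotations m r x) = x - (C.rotate m ^ r) x := by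
  rw [sub_eq_sub_iff_add_eq_add, ← sumRotations_succ, sumRotations_succ', add_comm]

theorem sumRotations_rotate (m r : ℕ) (x : V m) :
    C.sumRotations m r (C.rotate m x) = C.rotate m (C.sumRotations m r x) := by
  simp only [sumRotations, LinearMap.sum_apply, map_sum, ← Module.End.mul_apply, ← pow_succ,
    ← pow_succ']

theorem sumRotations_of_rotate_eq {m : ℕ} {x : V m} (hx : C.rotate m x = x) (r : ℕ) :
    C.sumRotations m r x = r • x := by
  induction r with
  | zero => simp [sumRotations]
  | succ r ih => rw [sumRotations_succ', ih, map_nsmul, hx, succ_nsmul]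

theorem sumRotations_two_mul_of_rotate_eq_neg {m : ℕ} {x y : V m} (hx : C.rotate m x = -y)
    (hy : C.rotate m y = -x) (r : ℕ) : C.sumRotations m (2 * r) x = r • (x - y) := by
  induction r with
  | zero => simp [sumRotations]
  | succ r ih =>
    rw [show 2 * (r + 1) = 2 * r + 1 + 1 by ring, sumRotations_succ', sumRotations_succ', ih]
    simp only [map_add, map_nsmul, map_sub, map_neg, hx, hy]
    module

theorem rotate_norm (m : ℕ) (x : V m) : C.rotate m (C.norm m x) = C.norm m x := by
  have telescoped := C.sumRotations_sub_rotate m (m + 1) x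
  rw [C.rotate_pow_apply, sub_self, sub_eq_zero] at telescoped
  exact telescoped.symm

theorem norm_rotate (m : ℕ) (x : V m) : C.norm m (C.rotate m x) = C.norm m x := by
  rw [norm, sumRotations_rotate, ← norm, rotate_norm]

theorem barBoundary_sumRotations (m r : ℕ) (hr : r ≤ m + 1) (x : V (m + 1)) :
    C.barBoundary m (C.sumRotations (m + 1) (r + 1) x) =
      C.sumRotations m r (C.boundary m x) + (C.rotate m ^ r) (C.sumFaces m (m + 1 - r) x) := by
  induction r generalizing x with
  | zero =>
    rw [zero_add, sumRotations_one, sumRotations, sum_range_zero, LinearMap.zero_apply, zero_add,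
      LinearMap.id_apply, pow_zero, Module.End.one_apply, Nat.sub_zero, barBoundary]
  | succ r ih =>
    obtain ⟨c, hc⟩ : ∃ c, m + 1 - r = c + 1 := ⟨m - r, by omega⟩
    have telescoped : C.rotate m (C.sumRotations m r (C.barBoundary m x)) =
        C.sumRotations m r (C.barBoundary m x) + (C.rotate m ^ r) (C.barBoundary m x)
          - C.barBoundary m x := by
      rw [← sumRotations_succ, sumRotations_succ', add_sub_cancel_right]
    rw [sumRotations_succ', map_add, ← sumRotations_rotate, ih (by omega), boundary_rotate, map_add,
      sumRotations_rotate, sumRotations_succ, hc, show m + 1 - (r + 1) = c by omega,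
      sumFaces_rotate, pow_succ, Module.End.mul_apply, C.boundary_eq_barBoundary_add m x,
      telescoped]
    simp only [map_add]
    abel

theorem barBoundary_norm (m : ℕ) (x : V (m + 1)) :
    C.barBoundary m (C.norm (m + 1) x) = C.norm m (C.boundary m x) := by
  rw [norm, C.barBoundary_sumRotations m (m + 1) le_rfl, Nat.sub_self, sumFaces_zero,
    LinearMap.zero_apply, map_zero, add_zero, norm]

/-- An operator on the first letter of the words: it commutes with the products of two letters
among the other ones. Conjugating it by rotations, one can apply it to any letter. -/
structure LetterOperator where
  onFirst : ∀ m, V m →ₗ[k] V m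
  onFirst_face : ∀ m j, j < m → ∀ x,
    onFirst m (C.face m (j + 1) x) = C.face m (j + 1) (onFirst (m + 1) x)

namespace LetterOperator

variable {C} (D : C.LetterOperator)

/-- The operator applied to the letter `j`, the letters being numbered cyclically. -/
def onLetter (m j : ℕ) : V m →ₗ[k] V m :=
  (C.rotate m ^ j) ∘ₗ D.onFirst m ∘ₗ C.rotate m ^ (m * j)

/-- The sum of the applications of the operator to all letters, the `L_∇` of the paper. -/
def lie (m : ℕ) : V m →ₗ[k] V m := ∑ j ∈ range (m + 1), D.onLetter m j

/-- The defect `(-1)^j (∇(a_j) a_{j+1} + a_j ∇(a_{j+1}) - ∇(a_j a_{j+1}))` of the operator from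
being a derivation, in place of the letters `j` and `j + 1`. -/
def defect (m j : ℕ) : V (m + 1) →ₗ[k] V m :=
  C.face m j ∘ₗ D.onLetter (m + 1) j + C.face m j ∘ₗ D.onLetter (m + 1) (j + 1)
    - D.onLetter m j ∘ₗ C.face m j

/-- The contraction `(a_0 ∇(a_1), a_2, …)` with the operator, as if it were a derivation. -/
def contract (m : ℕ) : V (m + 1) →ₗ[k] V m := C.face m 0 ∘ₗ D.onLetter (m + 1) 1

/-- The cyclic correction of the contraction, analogous to the operator `S_E` of the paper with the
operator in place of its defect. -/
def cyclicContract (m : ℕ) : V m →ₗ[k] V m :=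
  ∑ i ∈ range m, C.sumRotations m (m - i) ∘ₗ D.onLetter m (i + 1)

/-- The operator `S_E` of the paper. -/
def cyclicDefect (m : ℕ) : V (m + 1) →ₗ[k] V m :=
  ∑ i ∈ range m, C.sumRotations m (m - i) ∘ₗ D.defect m (i + 1)

theorem onLetter_zero (m : ℕ) : D.onLetter m 0 = D.onFirst m := by
  rw [onLetter, mul_zero, pow_zero]
  rfl

theorem rotate_onLetter (m j : ℕ) (x : V m) :
    C.rotate m (D.onLetter m j x) = D.onLetter m (j + 1) (C.rotate m x) := by
  have exponent : m * (j + 1) + 1 = m * j + (m + 1) := by ring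
  simp only [onLetter, LinearMap.comp_apply]
  rw [← Module.End.mul_apply (C.rotate m ^ (m * _)), ← pow_succ, exponent, pow_add _ (m * j),
    C.rotate_pow, mul_one, ← Module.End.mul_apply (C.rotate m), ← pow_succ']

theorem rotate_pow_onLetter (m i j : ℕ) (x : V m) :
    (C.rotate m ^ i) (D.onLetter m j x) = D.onLetter m (j + i) ((C.rotate m ^ i) x) := by
  induction i with
  | zero => rfl
  | succ i ih =>
    rw [pow_succ', Module.End.mul_apply, ih, rotate_onLetter, Module.End.mul_apply, add_assoc]

theorem onLetter_last (m : ℕ) : D.onLetter m (m + 1) = D.onLetter m 0 := by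
  rw [onLetter_zero, onLetter, C.rotate_pow, mul_comm, C.rotate_pow_mul]
  rfl

theorem onLetter_face_of_lt (m i j : ℕ) (hj : j < m) (x : V (m + 1)) :
    D.onLetter m i (C.face m (i + j + 1) x) = C.face m (i + j + 1) (D.onLetter (m + 1) i x) := by
  induction i generalizing x with
  | zero => simpa only [onLetter_zero, zero_add] using D.onFirst_face m j hj x
  | succ i ih =>
    obtain ⟨y, rfl⟩ := C.rotate_surjective _ x
    rw [show i + 1 + j + 1 = i + j + 1 + 1 by ring, ← C.rotate_face, ← D.rotate_onLetter, ih,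
      C.rotate_face, D.rotate_onLetter]

theorem onLetter_face_of_gt (m i j : ℕ) (hj : j < m) (x : V (m + 1)) :
    D.onLetter m (i + j + 1) (C.face m i x) = C.face m i (D.onLetter (m + 1) (i + j + 2) x) := by
  apply C.rotate_injective
  rw [D.rotate_onLetter, ← C.face_add, ← C.face_add,
    show i + (m + 2) = (i + j + 1 + 1) + (m - 1 - j) + 1 by omega,
    D.onLetter_face_of_lt _ _ _ (by omega)]

theorem onLetter_sumFaces (m i c : ℕ) (hc : c ≤ i + 1) (hi : i < m) (x : V (m + 1)) :
    D.onLetter m (i + 1) (C.sumFaces m c x) = C.sumFaces m c (D.onLetter (m + 1) (i + 2) x) := by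
  simp only [sumFaces, LinearMap.sum_apply, map_sum]
  refine sum_congr rfl fun l hl => ?_
  obtain ⟨j, rfl⟩ := Nat.exists_eq_add_of_le (show l ≤ i by have := mem_range.1 hl; omega)
  exact D.onLetter_face_of_gt m l j (by omega) x

theorem sumFaces_onLetter_sub (m i c : ℕ) (hc : c ≤ m - i) (hi : i < m) (x : V (m + 1)) :
    C.sumFaces m (i + 2 + c) (D.onLetter (m + 1) (i + 1) x)
        - D.onLetter m (i + 1) (C.sumFaces m (i + 2 + c) x) =
      C.sumFaces m (i + 2) (D.onLetter (m + 1) (i + 1) x)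
        - D.onLetter m (i + 1) (C.sumFaces m (i + 2) x) := by
  induction c with
  | zero => rfl
  | succ c ih =>
    rw [← add_assoc, C.sumFaces_succ, C.sumFaces_succ, map_add, ← ih (by omega),
      show i + 2 + c = i + 1 + c + 1 by ring, D.onLetter_face_of_lt _ _ _ (by omega),
      add_sub_add_right_eq_sub]

theorem boundary_onLetter_sub (m i : ℕ) (hi : i < m) (x : V (m + 1)) :
    C.boundary m (D.onLetter (m + 1) (i + 1) x) - D.onLetter m (i + 1) (C.boundary m x) =
      D.defect m (i + 1) x + C.sumFaces m (i + 1) (D.onLetter (m + 1) (i + 1) x)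
        - C.sumFaces m (i + 2) (D.onLetter (m + 1) (i + 2) x) := by
  rw [boundary, show m + 2 = i + 2 + (m - i) by omega,
    D.sumFaces_onLetter_sub m i (m - i) le_rfl hi, C.sumFaces_succ _ (i + 1),
    C.sumFaces_succ _ (i + 1), C.sumFaces_succ _ (i + 1), map_add,
    D.onLetter_sumFaces m i _ le_rfl hi]
  simp only [defect, LinearMap.comp_apply, LinearMap.add_apply, LinearMap.sub_apply, add_assoc i]
  abel

theorem boundary_onFirst (m : ℕ) (x : V (m + 1)) :
    C.boundary m (D.onFirst (m + 1) x) + D.contract m (x - C.rotate (m + 1) x)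
      - D.onFirst m (C.barBoundary m x) = D.defect m 0 x := by
  have onFirst_barBoundary : D.onFirst m (C.barBoundary m x) + C.face m 0 (D.onFirst (m + 1) x) =
      D.onFirst m (C.face m 0 x) + C.barBoundary m (D.onFirst (m + 1) x) := by
    simp only [barBoundary, sumFaces, LinearMap.sum_apply, map_sum, sum_range_succ',
      LinearMap.add_apply, map_add]
    rw [sum_congr rfl fun j hj => D.onFirst_face m j (mem_range.1 hj) x]
    abel
  have contract_rotate : D.contract m (C.rotate (m + 1) x) =
      C.face m 0 (C.rotate (m + 1) (D.onFirst (m + 1) x)) := by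
    rw [← D.onLetter_zero, D.rotate_onLetter]
    rfl
  rw [map_sub, contract_rotate, eq_sub_of_add_eq onFirst_barBoundary, C.boundary_eq_barBoundary_add]
  simp only [defect, contract, LinearMap.add_apply, LinearMap.sub_apply, LinearMap.comp_apply,
    D.onLetter_zero]
  abel

theorem boundary_contract_add (m : ℕ) (x : V (m + 2)) :
    C.boundary m (D.contract (m + 1) x) + D.contract m (C.boundary (m + 1) x) =
      -C.face m 0 (D.defect (m + 1) 1 x) := by
  have contract_face : ∀ j ∈ range (m + 1),
      C.face m 0 (D.onLetter (m + 1) 1 (C.face (m + 1) (j + 1 + 1) x)) =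
        -C.face m (j + 1) (C.face (m + 1) 0 (D.onLetter (m + 2) 1 x)) := by
    intro j hj
    rw [show j + 1 + 1 = 1 + j + 1 by ring, D.onLetter_face_of_lt _ _ _ (mem_range.1 hj),
      show 1 + j + 1 = j + 1 + 1 by ring,
      C.face_zero_face_succ _ _ (by have := mem_range.1 hj; omega)]
  have onLetter_face_zero : D.onLetter (m + 1) 1 (C.face (m + 1) 0 x) =
      C.face (m + 1) 0 (D.onLetter (m + 2) 2 x) :=
    D.onLetter_face_of_gt (m + 1) 0 0 (Nat.succ_pos _) x
  have face_zero_face_one (y : V (m + 2)) :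
      C.face m 0 (C.face (m + 1) 1 y) = -C.face m 0 (C.face (m + 1) 0 y) :=
    C.face_zero_face_succ m 0 (Nat.zero_le _) y
  simp only [boundary, sumFaces, contract, defect, LinearMap.sum_apply, map_sum,
    LinearMap.comp_apply, LinearMap.add_apply, LinearMap.sub_apply, map_add, map_sub]
  rw [sum_range_succ' _ (m + 1), sum_range_succ' _ (m + 2), sum_range_succ' _ (m + 1),
    sum_congr rfl contract_face, sum_neg_distrib, zero_add, onLetter_face_zero, face_zero_face_one,
    face_zero_face_one]
  abel

theorem onFirst_norm (m : ℕ) (x : V m) :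
    D.onFirst m (C.norm m x) =
      D.onLetter m 0 x + ∑ i ∈ range m, D.onLetter m 0 ((C.rotate m ^ (m - i)) x) := by
  rw [← D.onLetter_zero, norm, sumRotations, LinearMap.sum_apply, map_sum, sum_range_succ',
    add_comm, ← sum_range_reflect]
  congr 1
  refine sum_congr rfl fun i hi => ?_
  rw [show m - 1 - i + 1 = m - i by have := mem_range.1 hi; omega]

theorem cyclicContract_sub_rotate (m : ℕ) (x : V m) :
    D.cyclicContract m x - C.rotate m (D.cyclicContract m x) + D.onFirst m (C.norm m x) =
      D.lie m x := by
  have telescoped : D.cyclicContract m x - C.rotate m (D.cyclicContract m x) =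
      ∑ i ∈ range m, D.onLetter m (i + 1) x
        - ∑ i ∈ range m, D.onLetter m 0 ((C.rotate m ^ (m - i)) x) := by
    simp only [cyclicContract, LinearMap.sum_apply, map_sum, LinearMap.comp_apply,
      ← sum_sub_distrib, C.sumRotations_sub_rotate]
    refine sum_congr rfl fun i hi => ?_
    rw [D.rotate_pow_onLetter, show i + 1 + (m - i) = m + 1 by have := mem_range.1 hi; omega,
      D.onLetter_last]
  rw [telescoped, onFirst_norm, lie, LinearMap.sum_apply, sum_range_succ']
  abel

theorem norm_onFirst_add_cyclicContract (m : ℕ) (x : V m) :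
    C.norm m (D.onFirst m x) + D.cyclicContract m (x - C.rotate m x) = D.lie m x := by
  have summand : ∀ i ∈ range m, C.sumRotations m (m - i) (D.onLetter m (i + 1) (x - C.rotate m x)) =
      (C.sumRotations m (m + 1 - (i + 1)) (D.onLetter m (i + 1) x)
        - C.sumRotations m (m + 1 - i) (D.onLetter m i x)) + D.onLetter m i x := by
    intro i hi
    rw [map_sub, map_sub, ← D.rotate_onLetter, C.sumRotations_rotate,
      show m + 1 - i = m - i + 1 by have := mem_range.1 hi; omega, C.sumRotations_succ',
      Nat.add_sub_add_right]
    abel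
  rw [cyclicContract, LinearMap.sum_apply]
  simp only [LinearMap.comp_apply]
  rw [sum_congr rfl summand, sum_add_distrib,
    sum_range_sub (fun i => C.sumRotations m (m + 1 - i) (D.onLetter m i x)), lie,
    LinearMap.sum_apply, sum_range_succ, Nat.add_sub_cancel_left, sumRotations_one, Nat.sub_zero,
    norm, D.onLetter_zero, LinearMap.id_apply]
  abel

theorem barBoundary_cyclicContract (m : ℕ) (x : V (m + 1)) :
    C.barBoundary m (D.cyclicContract (m + 1) x) =
      ∑ i ∈ range m, (C.sumRotations m (m - i) (C.boundary m (D.onLetter (m + 1) (i + 1) x))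
        + (C.rotate m ^ (m - i)) (C.sumFaces m (i + 1) (D.onLetter (m + 1) (i + 1) x)))
      + C.barBoundary m (D.onLetter (m + 1) (m + 1) x) := by
  simp only [cyclicContract, LinearMap.sum_apply, map_sum, LinearMap.comp_apply]
  rw [sum_range_succ, Nat.add_sub_cancel_left, sumRotations_one, LinearMap.id_apply]
  congr 1
  refine sum_congr rfl fun i hi => ?_
  have hi := mem_range.1 hi
  rw [show m + 1 - i = m - i + 1 by omega, C.barBoundary_sumRotations _ _ (by omega),
    show m + 1 - (m - i) = i + 1 by omega]

theorem barBoundary_cyclicContract_sub (m : ℕ) (x : V (m + 1)) :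
    C.barBoundary m (D.cyclicContract (m + 1) x) - D.cyclicContract m (C.boundary m x)
      - C.norm m (D.contract m x) = D.cyclicDefect m x := by
  let remainder (i : ℕ) : V m :=
    C.sumRotations m (m + 1 - i) (C.sumFaces m (i + 1) (D.onLetter (m + 1) (i + 1) x))
  have summand : ∀ i ∈ range m,
      C.sumRotations m (m - i) (C.boundary m (D.onLetter (m + 1) (i + 1) x))
        + (C.rotate m ^ (m - i)) (C.sumFaces m (i + 1) (D.onLetter (m + 1) (i + 1) x))
        - C.sumRotations m (m - i) (D.onLetter m (i + 1) (C.boundary m x)) =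
      C.sumRotations m (m - i) (D.defect m (i + 1) x) + (remainder i - remainder (i + 1)) := by
    intro i hi
    have hi := mem_range.1 hi
    simp only [remainder]
    rw [show m + 1 - i = m - i + 1 by omega, C.sumRotations_succ, Nat.add_sub_add_right,
      add_sub_right_comm, ← map_sub, D.boundary_onLetter_sub m i hi, map_sub, map_add]
    abel
  have remainder_zero : C.norm m (D.contract m x) = remainder 0 := by
    simp only [remainder, C.sumFaces_succ, C.sumFaces_zero, LinearMap.zero_apply, zero_add]
    rfl
  have remainder_last : C.barBoundary m (D.onLetter (m + 1) (m + 1) x) = remainder m := by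
    simp only [remainder, Nat.add_sub_cancel_left, sumRotations_one, LinearMap.id_apply,
      barBoundary]
  rw [barBoundary_cyclicContract, remainder_zero, remainder_last, cyclicContract, cyclicDefect,
    LinearMap.sum_apply, LinearMap.sum_apply]
  simp only [LinearMap.comp_apply]
  rw [add_sub_right_comm, ← sum_sub_distrib, sum_congr rfl summand, sum_add_distrib,
    sum_range_sub']
  abel

end LetterOperator

/-- Formal chains: a pair `(x, y)` stands for the chain whose component of degree `m` is the sum of
the words `(a_0, …, a_m)` in `x m` and of the words `(e, a_0, …, a_{m-1})` for `y (m - 1)`. -/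
abbrev FormalChain (V : ℕ → Type*) : Type _ := (∀ m, V m) × (∀ m, V m)

/-- The differential `b + B` on formal chains. -/
def differential : FormalChain V →ₗ[k] FormalChain V :=
  .prod
    (.pi fun m => C.boundary m ∘ₗ .proj (m + 1) ∘ₗ .fst k _ _
      + (1 - C.rotate m) ∘ₗ .proj m ∘ₗ .snd k _ _)
    (.pi fun m => C.norm m ∘ₗ .proj m ∘ₗ .fst k _ _
      - C.barBoundary m ∘ₗ .proj (m + 1) ∘ₗ .snd k _ _)

theorem differential_fst (z : FormalChain V) (m : ℕ) :
    (C.differential z).1 m = C.boundary m (z.1 (m + 1)) + (z.2 m - C.rotate m (z.2 m)) := rfl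

theorem differential_snd (z : FormalChain V) (m : ℕ) :
    (C.differential z).2 m = C.norm m (z.1 m) - C.barBoundary m (z.2 (m + 1)) := rfl

theorem differential_differential (z : FormalChain V) : C.differential (C.differential z) = 0 := by
  refine Prod.ext (funext fun m => ?_) (funext fun m => ?_)
  · rw [differential_fst, differential_fst, differential_snd, map_add, map_sub (C.rotate m),
      C.boundary_boundary, C.boundary_sub_rotate, C.rotate_norm]
    change _ = (0 : V m)
    abel
  · rw [differential_snd, differential_fst, differential_snd, map_add, map_sub, map_sub,
      C.barBoundary_barBoundary, C.norm_rotate, C.barBoundary_norm]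
    change _ = (0 : V m)
    abel

namespace LetterOperator

variable {C} (D : C.LetterOperator)

/-- The contraction of formal chains with a letter operator. -/
def contraction : FormalChain V →ₗ[k] FormalChain V :=
  .prod
    (.pi fun m => D.contract m ∘ₗ .proj (m + 1) ∘ₗ .fst k _ _
      + D.onFirst m ∘ₗ .proj m ∘ₗ .snd k _ _)
    (.pi fun m => D.cyclicContract m ∘ₗ .proj m ∘ₗ .fst k _ _)

theorem contraction_fst (z : FormalChain V) (m : ℕ) :
    (D.contraction z).1 m = D.contract m (z.1 (m + 1)) + D.onFirst m (z.2 m) := rfl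

theorem contraction_snd (z : FormalChain V) (m : ℕ) :
    (D.contraction z).2 m = D.cyclicContract m (z.1 m) := rfl

/-- The Gauss-Manin connection `L_∇ - ι_E - S_E` on formal chains. -/
def gaussManin : FormalChain V →ₗ[k] FormalChain V :=
  .prod
    (.pi fun m => D.lie m ∘ₗ .proj m ∘ₗ .fst k _ _
      - C.face m 0 ∘ₗ D.defect (m + 1) 1 ∘ₗ .proj (m + 2) ∘ₗ .fst k _ _
      + D.defect m 0 ∘ₗ .proj (m + 1) ∘ₗ .snd k _ _)
    (.pi fun m => D.lie m ∘ₗ .proj m ∘ₗ .snd k _ _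
      - D.cyclicDefect m ∘ₗ .proj (m + 1) ∘ₗ .fst k _ _)

theorem gaussManin_fst (z : FormalChain V) (m : ℕ) :
    (D.gaussManin z).1 m = D.lie m (z.1 m) - C.face m 0 (D.defect (m + 1) 1 (z.1 (m + 2)))
      + D.defect m 0 (z.2 (m + 1)) := rfl

theorem gaussManin_snd (z : FormalChain V) (m : ℕ) :
    (D.gaussManin z).2 m = D.lie m (z.2 m) - D.cyclicDefect m (z.1 (m + 1)) := rfl

theorem gaussManin_eq_differential_contraction_add (z : FormalChain V) :
    D.gaussManin z = C.differential (D.contraction z) + D.contraction (C.differential z) := by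
  refine Prod.ext (funext fun m => ?_) (funext fun m => ?_)
  · simp only [Prod.fst_add, Pi.add_apply, gaussManin_fst, differential_fst, differential_snd,
      contraction_fst, contraction_snd, ← D.cyclicContract_sub_rotate m (z.1 m),
      ← D.boundary_onFirst m (z.2 (m + 1)),
      ← neg_eq_iff_eq_neg.2 (D.boundary_contract_add m (z.1 (m + 2))), map_add, map_sub]
    abel
  · simp only [Prod.snd_add, Pi.add_apply, gaussManin_snd, differential_fst, differential_snd,
      contraction_fst, contraction_snd, ← D.norm_onFirst_add_cyclicContract m (z.2 m),
      ← D.barBoundary_cyclicContract_sub m (z.1 (m + 1)), map_add, map_sub]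
    abel

theorem differential_gaussManin (z : FormalChain V) :
    C.differential (D.gaussManin z) = D.gaussManin (C.differential z) := by
  rw [gaussManin_eq_differential_contraction_add, gaussManin_eq_differential_contraction_add,
    map_add, C.differential_differential, C.differential_differential, map_zero, zero_add, add_zero]

end LetterOperator

/-- A morphism of precyclic modules. -/
structure Hom {W : ℕ → Type*} [∀ m, AddCommGroup (W m)] [∀ m, Module k (W m)]
    (C : PrecyclicModule k V) (C' : PrecyclicModule k W) where
  toFun : ∀ m, V m →ₗ[k] W m
  map_rotate : ∀ m x, toFun m (C.rotate m x) = C'.rotate m (toFun m x)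
  map_mul : ∀ m x, toFun m (C.mul m x) = C'.mul m (toFun (m + 1) x)

namespace Hom

variable {W : ℕ → Type*} [∀ m, AddCommGroup (W m)] [∀ m, Module k (W m)]
  {C} {C' : PrecyclicModule k W} (f : C.Hom C')

theorem map_rotate_pow (m j : ℕ) (x : V m) :
    f.toFun m ((C.rotate m ^ j) x) = (C'.rotate m ^ j) (f.toFun m x) := by
  induction j with
  | zero => rfl
  | succ j ih =>
    rw [pow_succ', pow_succ', Module.End.mul_apply, Module.End.mul_apply, f.map_rotate, ih]

theorem map_sumFaces (m c : ℕ) (x : V (m + 1)) :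
    f.toFun m (C.sumFaces m c x) = C'.sumFaces m c (f.toFun (m + 1) x) := by
  simp only [sumFaces, face, LinearMap.sum_apply, LinearMap.comp_apply, map_sum, f.map_rotate_pow,
    f.map_mul]

theorem map_norm (m : ℕ) (x : V m) : f.toFun m (C.norm m x) = C'.norm m (f.toFun m x) := by
  simp only [norm, sumRotations, LinearMap.sum_apply, map_sum, f.map_rotate_pow]

/-- The map on formal chains induced by a morphism of precyclic modules. -/
def mapChain : FormalChain V →ₗ[k] FormalChain W :=
  .prodMap (.pi fun m => f.toFun m ∘ₗ .proj m) (.pi fun m => f.toFun m ∘ₗ .proj m)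

theorem mapChain_fst (z : FormalChain V) (m : ℕ) : (f.mapChain z).1 m = f.toFun m (z.1 m) := rfl

theorem mapChain_snd (z : FormalChain V) (m : ℕ) : (f.mapChain z).2 m = f.toFun m (z.2 m) := rfl

theorem differential_mapChain (z : FormalChain V) :
    C'.differential (f.mapChain z) = f.mapChain (C.differential z) := by
  refine Prod.ext (funext fun m => ?_) (funext fun m => ?_)
  · simp only [mapChain_fst, mapChain_snd, differential_fst, map_add, map_sub, f.map_rotate,
      boundary, f.map_sumFaces]
  · simp only [mapChain_fst, mapChain_snd, differential_snd, map_sub, f.map_norm, barBoundary,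
      f.map_sumFaces]

end Hom

end PrecyclicModule

end PrecyclicModule

section Words

section MergeAt

variable {A : Type*} {m : ℕ}

theorem mergeAt_update_castSucc (β : A → A → A) (j : Fin (m + 1)) (v : Fin (m + 2) → A) (x : A) :
    mergeAt β j (update v j.castSucc x) = update (mergeAt β j v) j (β x (v j.succ)) := by
  funext i
  simp only [mergeAt, update_apply, Fin.ext_iff, Fin.lt_def, Fin.val_castSucc, Fin.val_succ]
  split_ifs <;> first | rfl | (exfalso; omega)

theorem mergeAt_update_succ (β : A → A → A) (j : Fin (m + 1)) (v : Fin (m + 2) → A) (x : A) :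
    mergeAt β j (update v j.succ x) = update (mergeAt β j v) j (β (v j.castSucc) x) := by
  funext i
  simp only [mergeAt, update_apply, Fin.ext_iff, Fin.lt_def, Fin.val_castSucc, Fin.val_succ]
  split_ifs <;> first | rfl | (exfalso; omega)

theorem mergeAt_zero_update_succ_succ (β : A → A → A) (i : Fin m) (v : Fin (m + 2) → A) (x : A) :
    mergeAt β 0 (update v i.succ.succ x) = update (mergeAt β 0 v) i.succ x := by
  funext l
  simp only [mergeAt, update_apply, Fin.ext_iff, Fin.lt_def, Fin.val_castSucc, Fin.val_succ,
    Fin.val_zero]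
  split_ifs <;> first | rfl | (exfalso; omega)

theorem mergeAt_succ_update_zero (β : A → A → A) (j : Fin m) (v : Fin (m + 2) → A) (x : A) :
    mergeAt β j.succ (update v 0 x) = update (mergeAt β j.succ v) 0 x := by
  funext i
  simp only [mergeAt, update_apply, Fin.ext_iff, Fin.lt_def, Fin.val_castSucc, Fin.val_succ,
    Fin.val_zero]
  split_ifs <;> first | rfl | (exfalso; omega)

theorem update_mergeAt (β γ : A → A → A) (j : Fin (m + 1)) (v : Fin (m + 2) → A) :
    update (mergeAt β j v) j (γ (v j.castSucc) (v j.succ)) = mergeAt γ j v := by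
  funext i
  simp only [mergeAt, update_apply, Fin.ext_iff, Fin.lt_def]
  split_ifs <;> first | rfl | (exfalso; omega)

theorem mergeAt_self (β : A → A → A) (j : Fin m) (v : Fin (m + 1) → A) :
    mergeAt β j v j = β (v j.castSucc) (v j.succ) := by
  rw [mergeAt, if_neg (lt_irrefl j), if_pos rfl]

theorem mergeAt_succ_zero (β : A → A → A) (j : Fin m) (v : Fin (m + 2) → A) :
    mergeAt β j.succ v 0 = v 0 :=
  if_pos j.succ_pos

theorem tail_mergeAt_zero (β : A → A → A) (v : Fin (m + 2) → A) :
    Fin.tail (mergeAt β 0 v) = Fin.tail (Fin.tail v) := by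
  funext i
  rw [Fin.tail, mergeAt, if_neg (Fin.not_lt_zero _), if_neg (Fin.succ_ne_zero i)]
  rfl

theorem tail_mergeAt_succ (β : A → A → A) (j : Fin m) (v : Fin (m + 2) → A) :
    Fin.tail (mergeAt β j.succ v) = mergeAt β j (Fin.tail v) := by
  funext i
  simp only [mergeAt, Fin.tail, Fin.succ_lt_succ_iff, Fin.succ_inj, Fin.castSucc_succ]

theorem mergeAt_mergeAt {β : A → A → A} (assoc : ∀ a b c, β (β a b) c = β a (β b c))
    (j : Fin (m + 1)) (v : Fin (m + 3) → A) :
    mergeAt β 0 (mergeAt β j.succ v) = mergeAt β j (mergeAt β 0 v) := by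
  funext i
  refine Fin.cases ?_ (fun i => ?_) i
  · refine Fin.cases ?_ (fun j => ?_) j
    · simp [mergeAt, assoc]
    · simp [mergeAt, Fin.lt_def]
  · simp only [mergeAt, Fin.ext_iff, Fin.lt_def, Fin.val_castSucc, Fin.val_succ, Fin.val_zero,
      Nat.add_lt_add_iff_right, Nat.add_right_cancel_iff, Nat.not_lt_zero, Nat.succ_ne_zero,
      if_false, Fin.castSucc_succ]
    split_ifs <;> first | rfl | (exfalso; omega)

theorem mergeAt_rotate (β : A → A → A) (j : ℕ) (hj : j + 1 < m + 1) (v : Fin (m + 2) → A)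
    (i : Fin (m + 1)) :
    mergeAt β ⟨j, by omega⟩ (fun l => v (l + 1)) (i - 1) = mergeAt β ⟨j + 1, hj⟩ v i := by
  have letter_congr : ∀ a b : Fin (m + 2), (a : ℕ) = b → v a = v b := fun a b h =>
    congrArg v (Fin.ext h)
  have hi := i.isLt
  simp only [mergeAt, Fin.ext_iff, Fin.lt_def, Fin.coe_sub_one, Fin.val_zero]
  split_ifs <;>
    first | (exfalso; omega) | apply letter_congr | (apply congrArg₂ <;> apply letter_congr)
  all_goals
    simp only [Fin.val_add_one, Fin.coe_sub_one, Fin.ext_iff, Fin.val_castSucc, Fin.val_succ,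
      Fin.val_last, Fin.val_zero]
    split_ifs <;> omega

end MergeAt

theorem fin_nsmul_one {m : ℕ} (j : Fin (m + 1)) : (j : ℕ) • (1 : Fin (m + 1)) = j := by
  induction j using Fin.induction with
  | zero => exact zero_nsmul _
  | succ i ih =>
    rw [Fin.val_castSucc] at ih
    rw [Fin.val_succ, succ_nsmul, ih, Fin.coeSucc_eq_succ]

theorem fin_succ_nsmul_one (m : ℕ) : (m + 1) • (1 : Fin (m + 1)) = 0 := by
  rw [succ_nsmul, ← Fin.val_last m, fin_nsmul_one, Fin.last_add_one]

theorem fin_zero_sub_one (m : ℕ) : (0 - 1 : Fin (m + 1)) = Fin.last m := by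
  rw [sub_eq_iff_eq_add, Fin.last_add_one]

theorem fin_succ_sub_one {m : ℕ} (i : Fin m) : (i.succ - 1 : Fin (m + 1)) = i.castSucc := by
  rw [sub_eq_iff_eq_add, Fin.coeSucc_eq_succ]

theorem tail_rotate_eq_init {A : Type*} {m : ℕ} (v : Fin (m + 1) → A) :
    Fin.tail (fun i => v (i - 1)) = Fin.init v :=
  funext fun i => congrArg v (fin_succ_sub_one i)

section Sign

variable {k : Type*} [CommRing k]

theorem neg_one_pow_val_neg_mul {m : ℕ} (j : Fin (m + 1)) :
    (-1 : k) ^ (((-j : Fin (m + 1)) : ℕ) * m) = (-1) ^ ((j : ℕ) * m) := by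
  rcases eq_or_ne j 0 with rfl | hj
  · rw [neg_zero]
  · refine neg_one_pow_congr ?_
    rw [Fin.val_neg, if_neg hj, Nat.even_mul, Nat.even_mul, Nat.even_sub j.isLt.le,
      Nat.even_add_one]
    tauto

end Sign

section Module

variable (k : Type*) {A : Type*} [CommRing k] [AddCommGroup A] [Module k A] {m : ℕ}

variable (A) in
/-- The tensors `A ⊗ ⋯ ⊗ A` of degree `m + 1`, spanned by the words with `m + 1` letters. -/
abbrev Word (m : ℕ) : Type _ := ⨂[k] (_ : Fin (m + 1)), A

/-- The word with the given letters. -/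
abbrev word (v : Fin (m + 1) → A) : Word k A m := PiTensorProduct.tprod k v

theorem word_update_add (v : Fin (m + 1) → A) (i : Fin (m + 1)) (x y : A) :
    word k (update v i (x + y)) = word k (update v i x) + word k (update v i y) :=
  MultilinearMap.map_update_add _ v i x y

theorem word_update_sub (v : Fin (m + 1) → A) (i : Fin (m + 1)) (x y : A) :
    word k (update v i (x - y)) = word k (update v i x) - word k (update v i y) :=
  MultilinearMap.map_update_sub _ v i x y

theorem word_update_smul (v : Fin (m + 1) → A) (i : Fin (m + 1)) (c : k) (x : A) :
    word k (update v i (c • x)) = c • word k (update v i x) :=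
  MultilinearMap.map_update_smul _ v i c x

namespace Word

variable {k}

theorem hom_congr {M : Type*} [AddCommGroup M] [Module k M] {f g : Word k A m →ₗ[k] M}
    (h : ∀ v, f (word k v) = g (word k v)) (x : Word k A m) : f x = g x :=
  LinearMap.congr_fun (PiTensorProduct.ext (MultilinearMap.ext h)) x

variable (k A) in
/-- The signed rotation of words, which moves the last letter to the front. -/
def rotate (m : ℕ) : Word k A m →ₗ[k] Word k A m :=
  (-1 : k) ^ m • (PiTensorProduct.reindex k (fun _ => A)
    (Equiv.subRight (1 : Fin (m + 1))).symm).toLinearMap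

theorem rotate_word (v : Fin (m + 1) → A) :
    rotate k A m (word k v) = (-1 : k) ^ m • word k (fun i => v (i - 1)) := by
  rw [rotate, LinearMap.smul_apply, LinearEquiv.coe_coe, word, PiTensorProduct.reindex_tprod]
  rfl

theorem rotate_pow_word (j : ℕ) (v : Fin (m + 1) → A) :
    (rotate k A m ^ j) (word k v) =
      (-1 : k) ^ (j * m) • word k (fun i => v (i - j • (1 : Fin (m + 1)))) := by
  induction j generalizing v with
  | zero => simp
  | succ j ih =>
    rw [pow_succ, Module.End.mul_apply, rotate_word, map_smul, ih, smul_smul, ← pow_add,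
      show m + j * m = (j + 1) * m by ring]
    simp only [succ_nsmul, sub_sub]

theorem rotate_pow_val_word (j : Fin (m + 1)) (v : Fin (m + 1) → A) :
    (rotate k A m ^ (j : ℕ)) (word k v) =
      (-1 : k) ^ ((j : ℕ) * m) • word k (fun i => v (i - j)) := by
  rw [rotate_pow_word, fin_nsmul_one]

theorem rotate_pow_self_word (v : Fin (m + 1) → A) :
    (rotate k A m ^ m) (word k v) = (-1 : k) ^ m • word k (fun i => v (i + 1)) := by
  have nsmul_eq_neg_one : m • (1 : Fin (m + 1)) = -1 :=
    eq_neg_of_add_eq_zero_left ((succ_nsmul _ m).symm.trans (fin_succ_nsmul_one m))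
  rw [rotate_pow_word, nsmul_eq_neg_one, neg_one_pow_congr (n := m) (by rw [Nat.even_mul, or_self])]
  simp only [sub_neg_eq_add]

theorem rotate_pow_succ (m : ℕ) : rotate k A m ^ (m + 1) = 1 := by
  refine LinearMap.ext (hom_congr fun v => ?_)
  rw [rotate_pow_word, fin_succ_nsmul_one, mul_comm, (Nat.even_mul_succ_self m).neg_one_pow,
    one_smul]
  simp only [sub_zero, Module.End.one_apply]

/-- The action of a linear map on the first letter of words. -/
def mapFirst (g : A →ₗ[k] A) (m : ℕ) : Word k A m →ₗ[k] Word k A m :=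
  PiTensorProduct.map fun i => if i = 0 then g else LinearMap.id

theorem mapFirst_word (g : A →ₗ[k] A) (v : Fin (m + 1) → A) :
    mapFirst g m (word k v) = word k (update v 0 (g (v 0))) := by
  rw [mapFirst, word, PiTensorProduct.map_tprod]
  congr 1
  funext i
  rcases eq_or_ne i 0 with rfl | hi
  · rw [if_pos rfl, update_self]
  · rw [if_neg hi, update_of_ne hi, LinearMap.id_apply]

end Word

end Module

section Algebra

variable (k A : Type*) [CommRing k] [NonUnitalRing A] [Module k A] [IsScalarTower k A A]
  [SMulCommClass k A A] {m : ℕ}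

namespace Word

/-- The product of the first two letters of words. -/
def mulFirst (m : ℕ) : Word k A (m + 1) →ₗ[k] Word k A m :=
  PiTensorProduct.lift <| MultilinearMap.mk' (fun v => word k (mergeAt (· * ·) 0 v))
    (fun v i x y => by
      refine Fin.cases ?_ (fun i => Fin.cases ?_ (fun i => ?_) i) i
      · simp only [← Fin.castSucc_zero, mergeAt_update_castSucc, add_mul, word_update_add]
      · simp only [mergeAt_update_succ, mul_add, word_update_add]
      · simp only [mergeAt_zero_update_succ_succ, word_update_add])
    (fun v i c x => by
      refine Fin.cases ?_ (fun i => Fin.cases ?_ (fun i => ?_) i) i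
      · simp only [← Fin.castSucc_zero, mergeAt_update_castSucc, smul_mul_assoc, word_update_smul]
      · simp only [mergeAt_update_succ, mul_smul_comm, word_update_smul]
      · simp only [mergeAt_zero_update_succ_succ, word_update_smul])

variable {k A}

theorem mulFirst_word (v : Fin (m + 2) → A) :
    mulFirst k A m (word k v) = word k (mergeAt (· * ·) 0 v) := by
  rw [mulFirst, word, PiTensorProduct.lift.tprod]
  rfl

theorem rotate_pow_mulFirst_word (j : ℕ) (hj : j < m + 1) (v : Fin (m + 2) → A) :
    (rotate k A m ^ j) (mulFirst k A m ((rotate k A (m + 1) ^ ((m + 1) * j)) (word k v))) =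
      (-1 : k) ^ j • word k (mergeAt (· * ·) ⟨j, hj⟩ v) := by
  induction j generalizing v with
  | zero => simp [mulFirst_word]
  | succ j ih =>
    have sign : (-1 : k) ^ (m + 1) * (-1) ^ j * (-1) ^ m = (-1) ^ (j + 1) := by
      rw [← pow_add, ← pow_add]
      exact neg_one_pow_congr (by grind)
    rw [mul_add, mul_one, pow_add _ ((m + 1) * j), Module.End.mul_apply, rotate_pow_self_word,
      map_smul, map_smul, map_smul, pow_succ' (rotate k A m), Module.End.mul_apply,
      ih (by omega) fun i => v (i + 1), map_smul, rotate_word, smul_smul, smul_smul, sign]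
    simp only [mergeAt_rotate _ j hj]

end Word

open PrecyclicModule

/-- The precyclic module of the words with letters in an algebra. -/
def wordModule : PrecyclicModule k (Word k A) where
  rotate := Word.rotate k A
  mul := Word.mulFirst k A
  rotate_pow := Word.rotate_pow_succ
  mul_face m j hj x := by
    refine Word.hom_congr (f := Word.mulFirst k A m ∘ₗ (Word.rotate k A (m + 1) ^ (j + 1)) ∘ₗ
      Word.mulFirst k A (m + 1) ∘ₗ (Word.rotate k A (m + 2) ^ ((m + 2) * (j + 1))))
      (g := -((Word.rotate k A m ^ j) ∘ₗ Word.mulFirst k A m ∘ₗ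
        (Word.rotate k A (m + 1) ^ ((m + 1) * j)) ∘ₗ Word.mulFirst k A (m + 1))) (fun v => ?_) x
    simp only [LinearMap.neg_apply, LinearMap.comp_apply]
    rw [Word.rotate_pow_mulFirst_word (j + 1) (by omega), map_smul, Word.mulFirst_word,
      Word.mulFirst_word, Word.rotate_pow_mulFirst_word j (by omega), ← neg_smul,
      ← Fin.succ_mk (m + 1) j (by omega), mergeAt_mergeAt mul_assoc, pow_succ, mul_neg_one]

variable {A}

theorem rotate_word (v : Fin (m + 1) → A) :
    (wordModule k A).rotate m (word k v) = (-1 : k) ^ m • word k (fun i => v (i - 1)) :=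
  Word.rotate_word v

theorem rotate_word_add_one (v : Fin (m + 1) → A) :
    (wordModule k A).rotate m (word k fun i => v (i + 1)) = (-1 : k) ^ m • word k v := by
  simp only [rotate_word, sub_add_cancel]

theorem face_word (j : ℕ) (hj : j < m + 1) (v : Fin (m + 2) → A) :
    (wordModule k A).face m j (word k v) = (-1 : k) ^ j • word k (mergeAt (· * ·) ⟨j, hj⟩ v) :=
  Word.rotate_pow_mulFirst_word j hj v

theorem face_zero_word (v : Fin (m + 2) → A) :
    (wordModule k A).face m 0 (word k v) = word k (mergeAt (· * ·) 0 v) := by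
  rw [face_zero]
  exact Word.mulFirst_word v

theorem barBoundary_word (v : Fin (m + 2) → A) : (wordModule k A).barBoundary m (word k v) =
    ∑ j : Fin (m + 1), (-1 : k) ^ (j : ℕ) • word k (mergeAt (· * ·) j v) := by
  rw [barBoundary, sumFaces, LinearMap.sum_apply, Finset.sum_range]
  exact Finset.sum_congr rfl fun j _ => face_word k _ j.2 v

theorem sumRotations_word (r : ℕ) (hr : r ≤ m + 1) (v : Fin (m + 1) → A) :
    (wordModule k A).sumRotations m r (word k v) =
      ∑ j : Fin (m + 1) with j.val < r, (-1 : k) ^ (j.val * m) • word k (fun i => v (i - j)) := by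
  have range_eq : Finset.range r = (Finset.range (m + 1)).filter (· < r) := by
    ext j
    simp only [Finset.mem_range, Finset.mem_filter]
    omega
  rw [sumRotations, LinearMap.sum_apply, range_eq, Finset.sum_filter, Finset.sum_range,
    Finset.sum_filter]
  simp only [← Word.rotate_pow_val_word]
  rfl

theorem norm_word (v : Fin (m + 1) → A) : (wordModule k A).norm m (word k v) =
    ∑ j : Fin (m + 1), (-1 : k) ^ ((j : ℕ) * m) • word k (fun i => v (i + j)) := by
  rw [PrecyclicModule.norm, sumRotations_word k _ le_rfl,
    Finset.filter_true_of_mem fun j _ => j.isLt, ← Equiv.sum_comp (Equiv.neg (Fin (m + 1)))]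
  simp only [Equiv.neg_apply, neg_one_pow_val_neg_mul, sub_neg_eq_add]

variable {k}

/-- The action of a linear map on the first letter of words, as a letter operator. -/
def letterOperator (g : A →ₗ[k] A) : (wordModule k A).LetterOperator where
  onFirst := Word.mapFirst g
  onFirst_face m j hj x := by
    refine Word.hom_congr (f := Word.mapFirst g m ∘ₗ (wordModule k A).face m (j + 1))
      (g := (wordModule k A).face m (j + 1) ∘ₗ Word.mapFirst g (m + 1)) (fun v => ?_) x
    rw [LinearMap.comp_apply, LinearMap.comp_apply, face_word k _ (by omega), Word.mapFirst_word,
      face_word k _ (by omega), map_smul, Word.mapFirst_word, ← Fin.succ_mk m j hj,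
      mergeAt_succ_update_zero, mergeAt_succ_zero]

/-- The defect of a map from being a derivation. -/
def leibnizDefect {A : Type*} [NonUnitalRing A] (g : A → A) (a b : A) : A :=
  g a * b + a * g b - g (a * b)

namespace LetterOperator

variable (g : A →ₗ[k] A)

theorem onFirst_word (v : Fin (m + 1) → A) :
    (letterOperator g).onFirst m (word k v) = word k (update v 0 (g (v 0))) :=
  Word.mapFirst_word g v

theorem onLetter_word (j : ℕ) (hj : j < m + 1) (v : Fin (m + 1) → A) :
    (letterOperator g).onLetter m j (word k v) =
      word k (update v ⟨j, hj⟩ (g (v ⟨j, hj⟩))) := by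
  induction j generalizing v with
  | zero =>
    rw [LetterOperator.onLetter_zero]
    exact onFirst_word g v
  | succ j ih =>
    have index : (⟨j, by omega⟩ : Fin (m + 1)) + 1 = ⟨j + 1, hj⟩ :=
      Fin.ext (Fin.val_add_one_of_lt (Fin.lt_def.2 (Nat.lt_of_succ_lt_succ hj)))
    have rotated : (-1 : k) ^ m • (letterOperator g).onLetter m (j + 1) (word k v) =
        (-1 : k) ^ m • word k (update v ⟨j + 1, hj⟩ (g (v ⟨j + 1, hj⟩))) := by
      rw [← map_smul ((letterOperator g).onLetter m (j + 1)), ← rotate_word_add_one,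
        ← LetterOperator.rotate_onLetter, ih (by omega), rotate_word, index]
      congr 2
      funext i
      simp only [update_apply, sub_eq_iff_eq_add, index, sub_add_cancel]
    exact (isUnit_one.neg.pow m).smul_left_cancel.1 rotated

theorem lie_word (v : Fin (m + 1) → A) : (letterOperator g).lie m (word k v) =
    ∑ i : Fin (m + 1), word k (update v i (g (v i))) := by
  rw [LetterOperator.lie, LinearMap.sum_apply, Finset.sum_range]
  exact Finset.sum_congr rfl fun i _ => onLetter_word g _ i.2 v

theorem defect_word (j : ℕ) (hj : j < m + 1) (v : Fin (m + 2) → A) :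
    (letterOperator g).defect m j (word k v) =
      (-1 : k) ^ j • word k (mergeAt (leibnizDefect g) ⟨j, hj⟩ v) := by
  have onLeft := mergeAt_update_castSucc (· * ·) ⟨j, hj⟩ v (g (v (Fin.castSucc ⟨j, hj⟩)))
  have onRight := mergeAt_update_succ (· * ·) ⟨j, hj⟩ v (g (v (Fin.succ ⟨j, hj⟩)))
  simp only [Fin.castSucc_mk, Fin.succ_mk] at onLeft onRight
  simp only [LetterOperator.defect, LinearMap.sub_apply, LinearMap.add_apply, LinearMap.comp_apply]
  rw [onLetter_word g j (by omega), onLetter_word g (j + 1) (by omega), face_word k j hj,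
    face_word k j hj, face_word k j hj, map_smul, onLetter_word g j hj, ← smul_add, ← smul_sub,
    onLeft, onRight, mergeAt_self, ← word_update_add, ← word_update_sub,
    ← update_mergeAt (· * ·) (leibnizDefect g)]
  rfl

theorem cyclicDefect_word (v : Fin (m + 2) → A) :
    (letterOperator g).cyclicDefect m (word k v) =
      ∑ p : Fin (m + 1) × Fin (m + 1) with 1 ≤ (p.1 : ℕ) ∧ (p.1 : ℕ) + (p.2 : ℕ) ≤ m,
        (-1 : k) ^ ((p.1 : ℕ) + (p.2 : ℕ) * m) •
          word k (fun l => mergeAt (leibnizDefect g) p.1 v (l - p.2)) := by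
  rw [Finset.sum_filter, Fintype.sum_prod_type, Fin.sum_univ_succ,
    LetterOperator.cyclicDefect, LinearMap.sum_apply, Finset.sum_range]
  simp only [Fin.val_zero, nonpos_iff_eq_zero, one_ne_zero, false_and, if_false,
    Finset.sum_const_zero, zero_add, LinearMap.comp_apply]
  refine Finset.sum_congr rfl fun i _ => ?_
  rw [defect_word g _ (Nat.succ_lt_succ i.isLt), map_smul, sumRotations_word k _ (by omega),
    Finset.smul_sum, Finset.sum_filter]
  refine Finset.sum_congr rfl fun j _ => ?_
  rw [smul_smul, ← pow_add, Fin.val_succ]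
  exact if_congr (by omega) rfl rfl

end LetterOperator

end Algebra

end Words

section Projection

universe u

variable {R : Type} {A : Type u} [CommRing R] [Algebra ℂ R] [TopologicalSpace R]
  [NonUnitalRing A] [Module R A] [TopologicalSpace A] {m : ℕ}

section Heads

omit [Algebra ℂ R] [TopologicalSpace R] [TopologicalSpace A]

theorem Hd.down_ofA : ∀ (m : ℕ) (a : A), Hd.down m (Hd.ofA (m + 1) a : Hd R A (m + 1)) = Hd.ofA m a
  | 0, _ => rfl
  | _ + 1, _ => rfl

theorem Hd.toA_ofA : ∀ (m : ℕ) (a : A), Hd.toA m (Hd.ofA m a : Hd R A m) = a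
  | 0, _ => rfl
  | _ + 1, _ => rfl

theorem Hd.toA_e (m : ℕ) : Hd.toA (m + 1) (Hd.e m : Hd R A (m + 1)) = 0 := rfl

theorem Hd.lmul_ofA (a x : A) : Hd.lmul (Hd.ofA (m + 1) a : Hd R A (m + 1)) x = a * x := by
  change (0 : R) • x + a * x = _
  rw [zero_smul, zero_add]

theorem Hd.rmul_ofA (a x : A) : Hd.rmul x (Hd.ofA (m + 1) a : Hd R A (m + 1)) = x * a := by
  change (0 : R) • x + x * a = _
  rw [zero_smul, zero_add]

theorem Hd.lmul_e (x : A) : Hd.lmul (Hd.e m : Hd R A (m + 1)) x = x := by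
  change (1 : R) • x + 0 * x = _
  rw [one_smul, zero_mul, add_zero]

theorem Hd.rmul_e (x : A) : Hd.rmul x (Hd.e m : Hd R A (m + 1)) = x := by
  change (1 : R) • x + x * 0 = _
  rw [one_smul, mul_zero, add_zero]

theorem Hd.ofA_toA_add_toR_smul_e (h : Hd R A (m + 1)) :
    Hd.ofA (m + 1) (Hd.toA (m + 1) h) + Hd.toR (m + 1) h • Hd.e m = h := by
  refine Unitization.ext ?_ ?_
  · change 0 + h.fst * 1 = h.fst
    rw [mul_one, zero_add]
  · change h.snd + h.fst • (0 : A) = h.snd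
    rw [smul_zero, add_zero]

end Heads

theorem cls_head_zero (v : Fin m → A) : cls (0 : Hd R A m) v = 0 := by
  simpa only [zero_smul] using cls_head_smul (0 : R) (0 : Hd R A m) v

theorem cls_eq_zero_of_letter_eq_zero (h : Hd R A m) {v : Fin m → A} {i : Fin m} (hv : v i = 0) :
    cls h v = 0 := by
  have update_zero := cls_update_smul h v i (0 : R) 0
  rwa [zero_smul, zero_smul, ← hv, update_eq_self] at update_zero

section Connection

variable [Module ℂ A] {δ : ContDerivation R} (D : Connection δ A)

theorem Connection.hd_ofA : ∀ (m : ℕ) (a : A), D.hd m (Hd.ofA m a) = Hd.ofA m (D.toCLM a)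
  | 0, _ => rfl
  | _ + 1, _ => Unitization.ext (map_zero δ.toDer) rfl

theorem Connection.hd_e (m : ℕ) : D.hd (m + 1) (Hd.e m) = 0 :=
  Unitization.ext (Derivation.map_one_eq_zero δ.toDer) (map_zero D.toCLM)

end Connection

namespace Word

variable [Module ℂ A] [IsScalarTower ℂ R A]

variable (R A) in
/-- The words `a_0 ⋯ a_m` as chains `(a_0, …, a_m)`. -/
def toChain (m : ℕ) : Word ℂ A m →ₗ[ℂ] AlgChain R A m :=
  PiTensorProduct.lift <| MultilinearMap.mk' (fun v => cls (Hd.ofA m (v 0)) (Fin.tail v))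
    (fun v i x y => by
      refine Fin.cases ?_ (fun j => ?_) i
      · simp only [update_self, Fin.tail_update_zero, map_add, cls_head_add]
      · simp only [Fin.tail_update_succ, update_of_ne (Fin.succ_ne_zero j).symm, cls_update_add])
    (fun v i c x => by
      rw [csmul_def, ← algebraMap_smul R c x]
      refine Fin.cases ?_ (fun j => ?_) i
      · simp only [update_self, Fin.tail_update_zero, map_smul, cls_head_smul]
      · simp only [Fin.tail_update_succ, update_of_ne (Fin.succ_ne_zero j).symm, cls_update_smul])

variable (R A) in
/-- The words `a_0 ⋯ a_m` as chains `(e, a_0, …, a_m)`. -/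
def toUnitChain (m : ℕ) : Word ℂ A m →ₗ[ℂ] AlgChain R A (m + 1) :=
  PiTensorProduct.lift <| MultilinearMap.mk' (fun v => cls (Hd.e m) v)
    (fun v i x y => cls_update_add _ v i x y)
    (fun v i c x => by rw [csmul_def, ← algebraMap_smul R c x, cls_update_smul])

theorem toChain_word (v : Fin (m + 1) → A) :
    toChain R A m (word ℂ v) = cls (Hd.ofA m (v 0)) (Fin.tail v) :=
  PiTensorProduct.lift.tprod v

theorem toUnitChain_word (v : Fin (m + 1) → A) :
    toUnitChain R A m (word ℂ v) = cls (Hd.e m) v :=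
  PiTensorProduct.lift.tprod v

end Word

open Word

variable [Module ℂ A] [IsScalarTower ℂ R A] [IsScalarTower ℂ A A] [SMulCommClass ℂ A A]

/-- In `b(e, a_0, …, a_m)`, the terms in which `e` is multiplied are `(1 - λ)(a_0, …, a_m)`. -/
theorem toChain_sub_rotate_word (v : Fin (m + 1) → A) :
    toChain R A m (word ℂ v - (wordModule ℂ A).rotate m (word ℂ v)) =
      cls (Hd.ofA m (v 0)) (Fin.tail v)
        + (-1 : ℂ) ^ (m + 1) • cls (Hd.ofA m (v (Fin.last m))) (Fin.init v) := by
  rw [rotate_word, map_sub, map_smul, toChain_word, toChain_word, fin_zero_sub_one,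
    tail_rotate_eq_init, pow_succ, mul_neg_one, neg_smul, sub_eq_add_neg]

variable [IsTopologicalAddGroup A] [ContinuousMul A] [ContinuousSMul R A]
  [IsTopologicalAddGroup R] [IsScalarTower R A A] [SMulCommClass R A A]

theorem lin_b_toChain (x : Word ℂ A (m + 1)) :
    (isFormula_b R A m).lin (toChain R A (m + 1) x) =
      toChain R A m ((wordModule ℂ A).boundary m x) := by
  refine Word.hom_congr (f := (isFormula_b R A m).lin ∘ₗ toChain R A (m + 1))
    (g := toChain R A m ∘ₗ (wordModule ℂ A).boundary m) (fun v => ?_) x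
  rw [LinearMap.comp_apply, LinearMap.comp_apply, toChain_word, IsFormula.lin_cls,
    PrecyclicModule.boundary_eq_barBoundary_add, barBoundary_word, rotate_word, map_smul,
    face_zero_word, map_add, map_sum, Fin.sum_univ_succ, bFormula]
  simp only [map_smul, toChain_word, tail_mergeAt_succ, Fin.val_zero, pow_zero, one_smul,
    mergeAt_succ_zero, Hd.down_ofA, Hd.lmul_ofA, Hd.rmul_ofA, Fin.val_succ, tail_mergeAt_zero,
    mergeAt_self, Fin.castSucc_zero, Fin.succ_zero_eq_one, sub_self, fin_zero_sub_one,
    tail_rotate_eq_init, Fin.tail_init_eq_init_tail]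
  rfl

theorem lin_b_toUnitChain_zero (x : Word ℂ A 0) :
    (isFormula_b R A 0).lin (toUnitChain R A 0 x) =
      toChain R A 0 (x - (wordModule ℂ A).rotate 0 x) := by
  refine Word.hom_congr (f := (isFormula_b R A 0).lin ∘ₗ toUnitChain R A 0)
    (g := toChain R A 0 ∘ₗ (LinearMap.id - (wordModule ℂ A).rotate 0)) (fun v => ?_) x
  rw [LinearMap.comp_apply, LinearMap.comp_apply, toUnitChain_word, IsFormula.lin_cls,
    LinearMap.sub_apply, LinearMap.id_apply, toChain_sub_rotate_word, bFormula]
  simp only [Hd.lmul_e, Hd.rmul_e, Finset.univ_eq_empty, Finset.sum_empty, add_zero]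

theorem lin_b_toUnitChain_succ (x : Word ℂ A (m + 1)) :
    (isFormula_b R A (m + 1)).lin (toUnitChain R A (m + 1) x) =
      toChain R A (m + 1) (x - (wordModule ℂ A).rotate (m + 1) x)
        - toUnitChain R A m ((wordModule ℂ A).barBoundary m x) := by
  refine Word.hom_congr (f := (isFormula_b R A (m + 1)).lin ∘ₗ toUnitChain R A (m + 1))
    (g := toChain R A (m + 1) ∘ₗ (LinearMap.id - (wordModule ℂ A).rotate (m + 1))
      - toUnitChain R A m ∘ₗ (wordModule ℂ A).barBoundary m) (fun v => ?_) x
  have down_e : (Hd.down (m + 1) (Hd.e (m + 1)) : Hd R A (m + 1)) = Hd.e m := rfl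
  rw [LinearMap.sub_apply, LinearMap.comp_apply, LinearMap.comp_apply, LinearMap.comp_apply,
    toUnitChain_word, IsFormula.lin_cls, LinearMap.sub_apply, LinearMap.id_apply,
    toChain_sub_rotate_word, bFormula, barBoundary_word, map_sum, down_e]
  simp only [map_smul, toUnitChain_word, Hd.lmul_e, Hd.rmul_e, pow_succ _ (Fin.val _), mul_neg,
    mul_one, neg_smul, Finset.sum_neg_distrib]
  abel

theorem lin_B_toChain (x : Word ℂ A m) :
    (isFormula_B R A m).lin (toChain R A m x) =
      toUnitChain R A m ((wordModule ℂ A).norm m x) := by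
  refine Word.hom_congr (f := (isFormula_B R A m).lin ∘ₗ toChain R A m)
    (g := toUnitChain R A m ∘ₗ (wordModule ℂ A).norm m) (fun v => ?_) x
  rw [LinearMap.comp_apply, LinearMap.comp_apply, toChain_word, IsFormula.lin_cls, norm_word,
    map_sum, BFormula]
  simp only [map_smul, toUnitChain_word, Hd.toA_ofA, Fin.cons_self_tail]

omit [IsScalarTower ℂ A A] [SMulCommClass ℂ A A] in
theorem lin_B_toUnitChain (x : Word ℂ A m) :
    (isFormula_B R A (m + 1)).lin (toUnitChain R A m x) = 0 := by
  refine Word.hom_congr (f := (isFormula_B R A (m + 1)).lin ∘ₗ toUnitChain R A m) (g := 0)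
    (fun v => ?_) x
  rw [LinearMap.comp_apply, toUnitChain_word, IsFormula.lin_cls, BFormula, LinearMap.zero_apply]
  refine Finset.sum_eq_zero fun j _ => ?_
  rw [cls_eq_zero_of_letter_eq_zero (i := -j), smul_zero]
  rw [neg_add_cancel, Hd.toA_e, Fin.cons_zero]

section Connection

variable {δ : ContDerivation R} (D : Connection δ A)

/-- The action of a connection on the letters of words. -/
abbrev Connection.letterOperator : (wordModule ℂ A).LetterOperator :=
  GaussManin.letterOperator (D.toCLM : A →ₗ[ℂ] A)

theorem Connection.lin_L_toChain (x : Word ℂ A m) :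
    (D.isFormula_L m).lin (toChain R A m x) = toChain R A m (D.letterOperator.lie m x) := by
  refine Word.hom_congr (f := (D.isFormula_L m).lin ∘ₗ toChain R A m)
    (g := toChain R A m ∘ₗ D.letterOperator.lie m) (fun v => ?_) x
  rw [LinearMap.comp_apply, LinearMap.comp_apply, toChain_word, IsFormula.lin_cls,
    LetterOperator.lie_word, map_sum, Fin.sum_univ_succ, Connection.LFormula, D.hd_ofA]
  simp only [toChain_word, update_self, Fin.tail_update_zero, Fin.tail_update_succ,
    update_of_ne (Fin.succ_ne_zero _).symm]
  rfl

theorem Connection.lin_L_toUnitChain (x : Word ℂ A m) :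
    (D.isFormula_L (m + 1)).lin (toUnitChain R A m x) =
      toUnitChain R A m (D.letterOperator.lie m x) := by
  refine Word.hom_congr (f := (D.isFormula_L (m + 1)).lin ∘ₗ toUnitChain R A m)
    (g := toUnitChain R A m ∘ₗ D.letterOperator.lie m) (fun v => ?_) x
  rw [LinearMap.comp_apply, LinearMap.comp_apply, toUnitChain_word, IsFormula.lin_cls,
    LetterOperator.lie_word, map_sum, Connection.LFormula, D.hd_e, cls_head_zero, zero_add]
  simp only [toUnitChain_word]
  rfl

theorem Connection.lin_i_toChain (x : Word ℂ A (m + 2)) :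
    (D.isFormula_i m).lin (toChain R A (m + 2) x) =
      toChain R A m ((wordModule ℂ A).face m 0 (D.letterOperator.defect (m + 1) 1 x)) := by
  refine Word.hom_congr (f := (D.isFormula_i m).lin ∘ₗ toChain R A (m + 2))
    (g := toChain R A m ∘ₗ (wordModule ℂ A).face m 0 ∘ₗ D.letterOperator.defect (m + 1) 1)
    (fun v => ?_) x
  have one_eq_succ : (⟨1, by omega⟩ : Fin (m + 2)) = Fin.succ 0 := rfl
  rw [LinearMap.comp_apply, LinearMap.comp_apply, LinearMap.comp_apply, toChain_word,
    IsFormula.lin_cls, LetterOperator.defect_word _ 1 (by omega), map_smul, face_zero_word,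
    map_smul, toChain_word, Connection.iFormula, pow_one, Hd.lmul_ofA, tail_mergeAt_zero,
    mergeAt_self, one_eq_succ, tail_mergeAt_succ, tail_mergeAt_zero, Fin.castSucc_zero,
    mergeAt_succ_zero, mergeAt_self]
  rfl

theorem Connection.lin_i_toUnitChain (x : Word ℂ A (m + 1)) :
    (D.isFormula_i m).lin (toUnitChain R A (m + 1) x) =
      -toChain R A m (D.letterOperator.defect m 0 x) := by
  refine Word.hom_congr (f := (D.isFormula_i m).lin ∘ₗ toUnitChain R A (m + 1))
    (g := -(toChain R A m ∘ₗ D.letterOperator.defect m 0)) (fun v => ?_) x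
  rw [LinearMap.comp_apply, LinearMap.neg_apply, LinearMap.comp_apply, toUnitChain_word,
    IsFormula.lin_cls, LetterOperator.defect_word _ 0 (by omega), map_smul, toChain_word,
    Connection.iFormula, pow_zero, one_smul, Hd.lmul_e, neg_one_smul, Fin.mk_zero,
    tail_mergeAt_zero, mergeAt_self]
  rfl

theorem Connection.lin_S_toChain (x : Word ℂ A (m + 1)) :
    (D.isFormula_S m).lin (toChain R A (m + 1) x) =
      toUnitChain R A m (D.letterOperator.cyclicDefect m x) := by
  refine Word.hom_congr (f := (D.isFormula_S m).lin ∘ₗ toChain R A (m + 1))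
    (g := toUnitChain R A m ∘ₗ D.letterOperator.cyclicDefect m) (fun v => ?_) x
  rw [LinearMap.comp_apply, LinearMap.comp_apply, toChain_word, IsFormula.lin_cls,
    LetterOperator.cyclicDefect_word, map_sum, Connection.SFormula]
  simp only [map_smul, toUnitChain_word, Hd.toA_ofA, Fin.cons_self_tail]
  rfl

omit [IsScalarTower ℂ A A] [SMulCommClass ℂ A A] in
theorem Connection.lin_S_toUnitChain (x : Word ℂ A m) :
    (D.isFormula_S m).lin (toUnitChain R A m x) = 0 := by
  refine Word.hom_congr (f := (D.isFormula_S m).lin ∘ₗ toUnitChain R A m) (g := 0) (fun v => ?_) x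
  rw [LinearMap.comp_apply, toUnitChain_word, IsFormula.lin_cls, Connection.SFormula,
    LinearMap.zero_apply]
  refine Finset.sum_eq_zero fun p hp => ?_
  simp only [Finset.mem_filter, Finset.mem_univ, true_and] at hp
  rw [cls_eq_zero_of_letter_eq_zero (i := p.2), smul_zero]
  rw [sub_self, mergeAt, if_pos (show 0 < p.1 from hp.1), Fin.castSucc_zero,
    Fin.cons_zero, Hd.toA_e]

end Connection

end Projection

section FormalChains

theorem surjective_comp_of_injective {ι κ : Type*} {C : κ → Type*} [∀ m, Nonempty (C m)]
    {f : ι → κ} (hf : Injective f) : Surjective fun (t : ∀ m, C m) n => t (f n) := by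
  intro ω
  have exists_extension : ∀ m, ∃ c : C m, ∀ n (h : f n = m), h ▸ ω n = c := by
    intro m
    by_cases hm : ∃ n, f n = m
    · obtain ⟨n, rfl⟩ := hm
      exact ⟨ω n, fun k h => by obtain rfl := hf h; rfl⟩
    · exact ⟨Classical.arbitrary _, fun n h => (hm ⟨n, h⟩).elim⟩
  choose t ht using exists_extension
  exact ⟨t, funext fun n => (ht _ n rfl).symm⟩

universe u

open PrecyclicModule Word

variable {R : Type} {A : Type u} [CommRing R] [Algebra ℂ R] [TopologicalSpace R]
  [NonUnitalRing A] [Module R A] [TopologicalSpace A]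

omit [Algebra ℂ R] [TopologicalSpace R] [TopologicalSpace A] in
theorem AlgChain.mem_of_cls_mem {n : ℕ} {S : AddSubmonoid (AlgChain R A n)}
    (hS : ∀ h v, cls h v ∈ S) (a : AlgChain R A n) : a ∈ S := by
  change Hd R A n ⊗[R] (⨂[R] (_ : Fin n), A) at a
  induction a using TensorProduct.induction_on with
  | zero => exact S.zero_mem
  | add x y hx hy => exact S.add_mem hx hy
  | tmul h y =>
    induction y using PiTensorProduct.induction_on with
    | smul_tprod r v =>
      rw [← TensorProduct.smul_tmul]
      exact hS (r • h) v
    | add x y hx hy =>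
      rw [TensorProduct.tmul_add]
      exact S.add_mem hx hy

section Realization

variable [Module ℂ A] [IsScalarTower ℂ R A]

theorem toChain_zero_surjective : Surjective (toChain R A 0) :=
  AlgChain.mem_of_cls_mem (S := AddMonoidHom.mrange (toChain R A 0).toAddMonoidHom) fun h _ =>
    ⟨word ℂ fun _ => h, (toChain_word _).trans (congrArg (cls _) (Subsingleton.elim _ _))⟩

theorem toChain_coprod_toUnitChain_surjective (n : ℕ) :
    Surjective ((toChain R A (n + 1)).coprod (toUnitChain R A n)) := by
  refine AlgChain.mem_of_cls_mem (S := AddMonoidHom.mrange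
    ((toChain R A (n + 1)).coprod (toUnitChain R A n)).toAddMonoidHom) fun h v => ?_
  refine ⟨(word ℂ (Fin.cons (Hd.toA (n + 1) h) v),
    word ℂ (update v 0 (Hd.toR (n + 1) h • v 0))), ?_⟩
  change toChain R A (n + 1) (word ℂ _) + toUnitChain R A n (word ℂ _) = _
  rw [toChain_word, toUnitChain_word, cls_update_smul, update_eq_self, ← cls_head_smul,
    Fin.cons_zero, Fin.tail_cons, ← cls_head_add, Hd.ofA_toA_add_toR_smul_e]

variable (R A) in
/-- The algebraic chain of degree `n` of a formal chain `(x, y)`, in which `x` collects the words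
`(a_0, …, a_n)` and `y` the words `(e, a_1, …, a_n)`; thus `x n` and `y (n - 1)` contribute. -/
def AlgChain.ofFormal : ∀ n, FormalChain (Word ℂ A) →ₗ[ℂ] AlgChain R A n
  | 0 => toChain R A 0 ∘ₗ LinearMap.proj 0 ∘ₗ LinearMap.fst ℂ _ _
  | n + 1 => toChain R A (n + 1) ∘ₗ LinearMap.proj (n + 1) ∘ₗ LinearMap.fst ℂ _ _
      + toUnitChain R A n ∘ₗ LinearMap.proj n ∘ₗ LinearMap.snd ℂ _ _

theorem AlgChain.ofFormal_zero (z : FormalChain (Word ℂ A)) :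
    AlgChain.ofFormal R A 0 z = toChain R A 0 (z.1 0) := rfl

theorem AlgChain.ofFormal_succ (n : ℕ) (z : FormalChain (Word ℂ A)) :
    AlgChain.ofFormal R A (n + 1) z =
      toChain R A (n + 1) (z.1 (n + 1)) + toUnitChain R A n (z.2 n) := rfl

theorem AlgChain.ofFormal_surjective :
    Surjective fun (z : FormalChain (Word ℂ A)) (n : ℕ) => AlgChain.ofFormal R A n z := by
  intro a
  obtain ⟨x₀, h₀⟩ := toChain_zero_surjective (a 0)
  choose xy h using fun n => toChain_coprod_toUnitChain_surjective n (a (n + 1))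
  refine ⟨(fun m => Nat.casesOn m x₀ fun n => (xy n).1, fun n => (xy n).2), funext fun n => ?_⟩
  cases n with
  | zero => exact h₀
  | succ n => exact h n

variable (R A) in
/-- The chain of degree `n` of a formal chain. -/
def Chain.ofFormal (n : ℕ) : FormalChain (Word ℂ A) →+ Chain R A n :=
  UniformSpace.Completion.toCompl.comp (AlgChain.ofFormal R A n).toAddMonoidHom

theorem Chain.denseRange_ofFormal :
    DenseRange fun (z : FormalChain (Word ℂ A)) (n : ℕ) => Chain.ofFormal R A n z :=
  (DenseRange.piMap fun _ => UniformSpace.Completion.denseRange_coe).comp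
    AlgChain.ofFormal_surjective.denseRange
    (Continuous.piMap fun _ => UniformSpace.Completion.continuous_coe _)

theorem IsFormula.op_ofFormal {n m : ℕ} {f : Hd R A n → (Fin n → A) → AlgChain R A m}
    (hf : IsFormula f) (z : FormalChain (Word ℂ A)) :
    hf.op (Chain.ofFormal R A n z) =
      UniformSpace.Completion.toCompl (hf.lin (AlgChain.ofFormal R A n z)) :=
  ContinuousLinearMap.completion_apply_coe _ _

variable (R A) in
/-- The even chain of a formal chain. -/
def evenChain : FormalChain (Word ℂ A) →+ CEven R A :=
  AddMonoidHom.pi fun n => Chain.ofFormal R A (2 * n)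

variable (R A) in
/-- The odd chain of a formal chain. -/
def oddChain : FormalChain (Word ℂ A) →+ COdd R A :=
  AddMonoidHom.pi fun n => Chain.ofFormal R A (2 * n + 1)

theorem denseRange_evenChain : DenseRange (evenChain R A) :=
  (surjective_comp_of_injective (C := Chain R A)
    (mul_right_injective₀ (two_ne_zero (α := ℕ)))).denseRange.comp Chain.denseRange_ofFormal
    (continuous_pi fun _ => continuous_apply _)

theorem denseRange_oddChain : DenseRange (oddChain R A) :=
  (surjective_comp_of_injective (C := Chain R A) (f := fun n : ℕ => 2 * n + 1)
    fun a b h => by simpa using h).denseRange.comp Chain.denseRange_ofFormal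
    (continuous_pi fun _ => continuous_apply _)

end Realization

section Operators

variable [IsTopologicalAddGroup A] [ContinuousMul A] [ContinuousSMul R A]
  [IsTopologicalAddGroup R] [IsScalarTower R A A] [SMulCommClass R A A]

theorem continuous_dEven : Continuous (dEven R A) := by
  refine continuous_pi fun n => ?_
  change Continuous fun ω : CEven R A => bOp R A (2 * n + 1) (ω (n + 1)) + BOp R A (2 * n) (ω n)
  fun_prop

theorem continuous_dOdd : Continuous (dOdd R A) := by
  refine continuous_pi fun n => ?_
  cases n with
  | zero =>
    change Continuous fun ω : COdd R A => bOp R A 0 (ω 0) + 0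
    fun_prop
  | succ n =>
    change Continuous fun ω : COdd R A =>
      bOp R A (2 * n + 2) (ω (n + 1)) + BOp R A (2 * n + 1) (ω n)
    fun_prop

variable [Module ℂ A] [IsScalarTower ℂ R A]

theorem Connection.continuous_gmEven {δ : ContDerivation R} (D : Connection δ A) :
    Continuous D.gmEven := by
  refine continuous_pi fun n => ?_
  change Continuous fun ω : CEven R A => D.LOp (2 * n) (ω n)
    - (D.iOp (2 * n) (ω (n + 1)) + D.SOp (2 * n) (ω n))
  fun_prop

theorem Connection.continuous_gmOdd {δ : ContDerivation R} (D : Connection δ A) :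
    Continuous D.gmOdd := by
  refine continuous_pi fun n => ?_
  change Continuous fun ω : COdd R A => D.LOp (2 * n + 1) (ω n)
    - (D.iOp (2 * n + 1) (ω (n + 1)) + D.SOp (2 * n + 1) (ω n))
  fun_prop

variable [IsScalarTower ℂ A A] [SMulCommClass ℂ A A]

theorem bOp_ofFormal_one (z : FormalChain (Word ℂ A)) :
    bOp R A 0 (Chain.ofFormal R A 1 z) =
      Chain.ofFormal R A 0 ((wordModule ℂ A).differential z) := by
  refine (IsFormula.op_ofFormal _ z).trans (congrArg _ ?_)
  rw [AlgChain.ofFormal_succ, map_add, lin_b_toChain, lin_b_toUnitChain_zero, ← map_add]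
  rfl

theorem lin_B_ofFormal (m : ℕ) (z : FormalChain (Word ℂ A)) :
    (isFormula_B R A m).lin (AlgChain.ofFormal R A m z) =
      toUnitChain R A m ((wordModule ℂ A).norm m (z.1 m)) := by
  cases m with
  | zero => exact lin_B_toChain _
  | succ m => rw [AlgChain.ofFormal_succ, map_add, lin_B_toChain, lin_B_toUnitChain, add_zero]

theorem bOp_add_BOp_ofFormal (m : ℕ) (z : FormalChain (Word ℂ A)) :
    bOp R A (m + 1) (Chain.ofFormal R A (m + 2) z) + BOp R A m (Chain.ofFormal R A m z) =
      Chain.ofFormal R A (m + 1) ((wordModule ℂ A).differential z) := by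
  rw [bOp, BOp, IsFormula.op_ofFormal, IsFormula.op_ofFormal, ← map_add]
  refine congrArg _ ?_
  rw [lin_B_ofFormal, AlgChain.ofFormal_succ, map_add, lin_b_toChain, lin_b_toUnitChain_succ]
  change _ = AlgChain.ofFormal R A (m + 1) _
  rw [AlgChain.ofFormal_succ, differential_fst, differential_snd, map_add,
    map_sub (toUnitChain R A m)]
  abel

theorem dEven_evenChain (z : FormalChain (Word ℂ A)) :
    dEven R A (evenChain R A z) = oddChain R A ((wordModule ℂ A).differential z) :=
  funext fun n => bOp_add_BOp_ofFormal (2 * n) z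

theorem dOdd_oddChain (z : FormalChain (Word ℂ A)) :
    dOdd R A (oddChain R A z) = evenChain R A ((wordModule ℂ A).differential z) := by
  funext n
  cases n with
  | zero => exact (add_zero _).trans (bOp_ofFormal_one z)
  | succ n => exact bOp_add_BOp_ofFormal (2 * n + 1) z

namespace Connection

variable {δ : ContDerivation R} (D : Connection δ A)

theorem gaussManin_ofFormal (m : ℕ) (z : FormalChain (Word ℂ A)) :
    D.LOp m (Chain.ofFormal R A m z)
        - (D.iOp m (Chain.ofFormal R A (m + 2) z) + D.SOp m (Chain.ofFormal R A m z)) =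
      Chain.ofFormal R A m (D.letterOperator.gaussManin z) := by
  rw [LOp, iOp, IsFormula.op_ofFormal, IsFormula.op_ofFormal, AlgChain.ofFormal_succ, map_add,
    lin_i_toChain, lin_i_toUnitChain]
  cases m with
  | zero =>
    rw [SOp, zero_apply, add_zero, ← map_sub]
    refine congrArg _ ?_
    rw [AlgChain.ofFormal_zero, lin_L_toChain]
    change _ = AlgChain.ofFormal R A 0 _
    rw [AlgChain.ofFormal_zero, LetterOperator.gaussManin_fst, map_add, map_sub (toChain R A 0)]
    abel
  | succ m =>
    rw [SOp, IsFormula.op_ofFormal, ← map_add, ← map_sub]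
    refine congrArg _ ?_
    rw [AlgChain.ofFormal_succ, map_add, map_add, lin_L_toChain, lin_L_toUnitChain, lin_S_toChain,
      lin_S_toUnitChain]
    change _ = AlgChain.ofFormal R A (m + 1) _
    rw [AlgChain.ofFormal_succ, LetterOperator.gaussManin_fst, LetterOperator.gaussManin_snd,
      map_add, map_sub (toChain R A (m + 1)), map_sub (toUnitChain R A m)]
    abel

theorem gmEven_evenChain (z : FormalChain (Word ℂ A)) :
    D.gmEven (evenChain R A z) = evenChain R A (D.letterOperator.gaussManin z) :=
  funext fun n => D.gaussManin_ofFormal (2 * n) z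

theorem gmOdd_oddChain (z : FormalChain (Word ℂ A)) :
    D.gmOdd (oddChain R A z) = oddChain R A (D.letterOperator.gaussManin z) :=
  funext fun n => D.gaussManin_ofFormal (2 * n + 1) z

theorem isChainMap : D.IsChainMap where
  even := congrFun <| denseRange_evenChain.equalizer (continuous_dEven.comp D.continuous_gmEven)
    (D.continuous_gmOdd.comp continuous_dEven) <| funext fun z => by
      simp only [comp_apply, gmEven_evenChain, dEven_evenChain, gmOdd_oddChain,
        LetterOperator.differential_gaussManin]
  odd := congrFun <| denseRange_oddChain.equalizer (continuous_dOdd.comp D.continuous_gmOdd)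
    (D.continuous_gmEven.comp continuous_dOdd) <| funext fun z => by
      simp only [comp_apply, gmOdd_oddChain, dOdd_oddChain, gmEven_evenChain,
        LetterOperator.differential_gaussManin]

variable {D}

theorem IsChainMap.gmHP0_evenChain (hD : D.IsChainMap) {z : FormalChain (Word ℂ A)}
    (hz : (wordModule ℂ A).differential z = 0) :
    ∃ h : dEven R A (evenChain R A z) = 0, hD.gmHP0 (HP0.mk (evenChain R A z) h) = 0 := by
  refine ⟨by rw [dEven_evenChain, hz, map_zero], (Submodule.Quotient.mk_eq_zero _).2
    ⟨oddChain R A (D.letterOperator.contraction z), ?_⟩⟩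
  change _ = D.gmEven (evenChain R A z)
  rw [dOdd_oddChain, gmEven_evenChain, LetterOperator.gaussManin_eq_differential_contraction_add,
    hz, map_zero, add_zero]

theorem IsChainMap.gmHP1_oddChain (hD : D.IsChainMap) {z : FormalChain (Word ℂ A)}
    (hz : (wordModule ℂ A).differential z = 0) :
    ∃ h : dOdd R A (oddChain R A z) = 0, hD.gmHP1 (HP1.mk (oddChain R A z) h) = 0 := by
  refine ⟨by rw [dOdd_oddChain, hz, map_zero], (Submodule.Quotient.mk_eq_zero _).2
    ⟨evenChain R A (D.letterOperator.contraction z), ?_⟩⟩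
  change _ = D.gmOdd (oddChain R A z)
  rw [dEven_evenChain, gmOdd_oddChain, LetterOperator.gaussManin_eq_differential_contraction_add,
    hz, map_zero, add_zero]

end Connection

end Operators

end FormalChains

section Alternating

variable {A : Type*}

/-- The alternating word `a b a b ⋯`. -/
def alternating (a b : A) (m : ℕ) : Fin (m + 1) → A := fun i => if Even (i : ℕ) then a else b

/-- The word whose first `r` letters are those of `a b a b ⋯` and whose other letters are those of
`b a b a ⋯`. -/
def alternatingUpTo (a b : A) (m r : ℕ) : Fin (m + 1) → A :=
  fun i => if (Even (i : ℕ) ↔ (i : ℕ) < r) then a else b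

variable (a b : A)

theorem alternatingUpTo_zero (m : ℕ) : alternatingUpTo a b m 0 = alternating b a m := by
  funext i
  simp only [alternatingUpTo, alternating, Nat.not_lt_zero, iff_false, ite_not]

theorem alternatingUpTo_last (m : ℕ) : alternatingUpTo a b m (m + 1) = alternating a b m := by
  funext i
  simp only [alternatingUpTo, alternating, i.isLt, iff_true]

theorem update_alternatingUpTo {m : ℕ} (r : Fin (m + 1)) :
    update (alternatingUpTo a b m r) r (alternatingUpTo a b m (r + 1) r) =
      alternatingUpTo a b m (r + 1) := by
  funext i
  rcases eq_or_ne i r with rfl | hi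
  · rw [update_self]
  · have lt_succ_iff : (i : ℕ) < r + 1 ↔ (i : ℕ) < r := by
      have := Fin.val_ne_iff.2 hi
      omega
    rw [update_of_ne hi]
    simp only [alternatingUpTo, lt_succ_iff]

theorem alternating_odd_sub_one (n : ℕ) (i : Fin (2 * n + 1 + 1)) :
    alternating a b (2 * n + 1) (i - 1) = alternating b a (2 * n + 1) i := by
  refine Fin.cases ?_ (fun i => ?_) i
  · rw [fin_zero_sub_one]
    simp [alternating]
  · simp only [fin_succ_sub_one, alternating, Fin.val_castSucc, Fin.val_succ, Nat.even_add_one,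
      ite_not]

theorem alternating_even_sub_one (n : ℕ) (i : Fin (2 * n + 1)) :
    alternating a b (2 * n) (i - 1) = alternatingUpTo a b (2 * n) 1 i := by
  refine Fin.cases ?_ (fun i => ?_) i
  · rw [fin_zero_sub_one]
    simp [alternating, alternatingUpTo]
  · simp [fin_succ_sub_one, alternating, alternatingUpTo, Nat.even_add_one]

end Alternating

section Cycles

open PrecyclicModule

variable {A : Type*} [NonUnitalRing A]

section Idempotent

theorem mergeAt_const {p : A} (hp : p * p = p) {m : ℕ} (j : Fin (m + 1)) :
    mergeAt (· * ·) j (fun _ : Fin (m + 2) => p) = fun _ => p := by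
  funext i
  simp only [mergeAt, hp, ite_self]

section CommRing

variable (k : Type*) [CommRing k] [Module k A] [IsScalarTower k A A] [SMulCommClass k A A]
  {p : A}

theorem barBoundary_word_const (hp : p * p = p) (m : ℕ) :
    (wordModule k A).barBoundary m (word k fun _ => p) =
      (if Even (m + 1) then 0 else 1 : k) • word k fun _ => p := by
  rw [barBoundary_word, ← neg_one_geom_sum, Finset.sum_smul, Finset.sum_range]
  simp only [mergeAt_const hp]

theorem boundary_word_const (hp : p * p = p) (n : ℕ) :
    (wordModule k A).boundary (2 * n + 1) (word k fun _ => p) = word k fun _ => p := by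
  rw [boundary_eq_barBoundary_add, barBoundary_word_const k hp, if_pos ⟨n + 1, by ring⟩, zero_smul,
    zero_add, rotate_word, map_smul, face_zero_word, mergeAt_const hp,
    Even.neg_one_pow ⟨n + 1, by ring⟩, one_smul]

variable (p) in
theorem norm_word_const (n : ℕ) : (wordModule k A).norm (2 * n) (word k fun _ => p) =
    (2 * n + 1) • word k fun _ => p :=
  sumRotations_of_rotate_eq _ (by rw [rotate_word, (even_two_mul n).neg_one_pow, one_smul]) _

end CommRing

section Field

variable (k : Type*) [Field k]

/-- The coefficient of `P^{⊗(2n+1)}` in the Chern character of an idempotent `P`. -/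
def idempotentCoeff (n : ℕ) : k := (-1) ^ n * ((2 * n).factorial : k) / (n.factorial : k)

theorem idempotentCoeff_succ [CharZero k] (n : ℕ) :
    idempotentCoeff k (n + 1) = -(2 * (2 * n + 1)) * idempotentCoeff k n := by
  have factorial_ne_zero : (n.factorial : k) ≠ 0 := Nat.cast_ne_zero.2 n.factorial_ne_zero
  have succ_ne_zero : (n + 1 : k) ≠ 0 := Nat.cast_add_one_ne_zero n
  rw [idempotentCoeff, idempotentCoeff, show 2 * (n + 1) = 2 * n + 1 + 1 by ring,
    Nat.factorial_succ, Nat.factorial_succ, Nat.factorial_succ]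
  push_cast
  field_simp
  ring

variable [Module k A]

/-- The Chern character of an idempotent as a formal chain of words in the idempotent. -/
def idempotentChern (p : A) : FormalChain (Word k A) :=
  (fun m => (if Even m then idempotentCoeff k (m / 2) else 0) • word k fun _ => p,
    fun m => (if Even m then 0 else -(1 / 2) * idempotentCoeff k ((m + 1) / 2)) •
      word k fun _ => p)

variable (p : A) (n : ℕ)

theorem idempotentChern_fst_even :
    (idempotentChern k p).1 (2 * n) = idempotentCoeff k n • word k fun _ => p := by
  simp only [idempotentChern, if_pos (even_two_mul n), Nat.mul_div_cancel_left n two_pos]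

theorem idempotentChern_fst_odd : (idempotentChern k p).1 (2 * n + 1) = 0 := by
  simp only [idempotentChern, if_neg (Nat.not_even_two_mul_add_one n), zero_smul]

theorem idempotentChern_snd_even : (idempotentChern k p).2 (2 * n) = 0 := by
  simp only [idempotentChern, if_pos (even_two_mul n), zero_smul]

theorem idempotentChern_snd_odd : (idempotentChern k p).2 (2 * n + 1) =
    (-(1 / 2) * idempotentCoeff k (n + 1)) • word k fun _ => p := by
  simp only [idempotentChern, if_neg (Nat.not_even_two_mul_add_one n),
    show (2 * n + 1 + 1) / 2 = n + 1 by omega]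

variable {p} [CharZero k] [IsScalarTower k A A] [SMulCommClass k A A]

theorem differential_idempotentChern (hp : p * p = p) :
    (wordModule k A).differential (idempotentChern k p) = 0 := by
  have fst_succ (n : ℕ) : (idempotentChern k p).1 (2 * n + 1 + 1) =
      idempotentCoeff k (n + 1) • word k fun _ => p := idempotentChern_fst_even k p (n + 1)
  have snd_succ (n : ℕ) : (idempotentChern k p).2 (2 * n + 1 + 1) = 0 :=
    idempotentChern_snd_even k p (n + 1)
  refine Prod.ext (funext fun m => ?_) (funext fun m => ?_) <;>
    rcases Nat.even_or_odd' m with ⟨n, rfl | rfl⟩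
  · simp [differential_fst, idempotentChern_fst_odd, idempotentChern_snd_even]
  · have rotated : (wordModule k A).rotate (2 * n + 1) (word k fun _ => p) =
        -word k fun _ => p := by
      rw [rotate_word, (odd_two_mul_add_one n).neg_one_pow, neg_one_smul]
    rw [differential_fst, fst_succ, idempotentChern_snd_odd, map_smul, map_smul,
      boundary_word_const k hp, rotated]
    change _ = (0 : Word k A _)
    module
  · rw [differential_snd, idempotentChern_fst_even, idempotentChern_snd_odd, idempotentCoeff_succ,
      map_smul, map_smul, norm_word_const, barBoundary_word_const k hp,
      if_neg (Nat.not_even_two_mul_add_one n)]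
    change _ = (0 : Word k A _)
    module
  · simp [differential_snd, idempotentChern_fst_odd, snd_succ]

end Field

end Idempotent

section Invertible

theorem mergeAt_alternating {a b : A} (hab : a * b = -(a + b)) (hba : b * a = -(a + b)) {m : ℕ}
    (r : Fin (m + 1)) :
    mergeAt (· * ·) r (alternating a b (m + 1)) = update (alternatingUpTo a b m r) r
      (-(alternatingUpTo a b m r r + alternatingUpTo a b m (r + 1) r)) := by
  funext i
  simp only [mergeAt, alternating, update_apply, alternatingUpTo, Fin.val_castSucc, Fin.val_succ,
    Nat.even_add_one, Fin.lt_def]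
  rcases lt_trichotomy (i : ℕ) r with h | h | h
  · simp [h, h.ne, Fin.ext_iff]
  · obtain rfl := Fin.ext h
    by_cases even : Even (i : ℕ) <;> simp [even, hab, hba, add_comm]
  · simp [h.not_gt, h.ne', Fin.ext_iff]

section CommRing

variable (k : Type*) [CommRing k] [Module k A] [IsScalarTower k A A] [SMulCommClass k A A]

section Rotation

variable (a b : A) (n : ℕ)

theorem rotate_word_alternating_odd :
    (wordModule k A).rotate (2 * n + 1) (word k (alternating a b (2 * n + 1))) =
      -word k (alternating b a (2 * n + 1)) := by
  simp only [rotate_word, alternating_odd_sub_one, (odd_two_mul_add_one n).neg_one_pow,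
    neg_one_smul]

theorem rotate_word_alternating_even :
    (wordModule k A).rotate (2 * n) (word k (alternating a b (2 * n))) =
      word k (alternatingUpTo a b (2 * n) 1) := by
  simp only [rotate_word, alternating_even_sub_one, (even_two_mul n).neg_one_pow, one_smul]

theorem norm_word_alternating :
    (wordModule k A).norm (2 * n + 1) (word k (alternating a b (2 * n + 1))) =
      (n + 1) • (word k (alternating a b (2 * n + 1)) - word k (alternating b a (2 * n + 1))) :=
  sumRotations_two_mul_of_rotate_eq_neg _ (rotate_word_alternating_odd k a b n)
    (rotate_word_alternating_odd k b a n) (n + 1)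

end Rotation

variable {a b : A} (hab : a * b = -(a + b)) (hba : b * a = -(a + b))

include hab hba

theorem face_word_alternating {m : ℕ} (r : Fin (m + 1)) :
    (wordModule k A).face m r (word k (alternating a b (m + 1))) =
      (-1 : k) ^ (r + 1 : ℕ) • word k (alternatingUpTo a b m (r + 1)) -
        (-1 : k) ^ (r : ℕ) • word k (alternatingUpTo a b m r) := by
  rw [face_word k r r.isLt, Fin.eta, mergeAt_alternating hab hba, ← neg_one_smul k (_ + _),
    word_update_smul, word_update_add, update_eq_self, update_alternatingUpTo]
  module

theorem barBoundary_word_alternating (m : ℕ) :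
    (wordModule k A).barBoundary m (word k (alternating a b (m + 1))) =
      (-1 : k) ^ (m + 1) • word k (alternating a b m) - word k (alternating b a m) := by
  let partialWord (r : ℕ) : Word k A m := (-1 : k) ^ r • word k (alternatingUpTo a b m r)
  have telescoped : (wordModule k A).barBoundary m (word k (alternating a b (m + 1))) =
      partialWord (m + 1) - partialWord 0 := by
    rw [barBoundary, sumFaces, LinearMap.sum_apply, ← Finset.sum_range_sub, Finset.sum_range,
      Finset.sum_range]
    exact Finset.sum_congr rfl fun r _ => face_word_alternating k hab hba r
  rw [telescoped]
  simp only [partialWord, alternatingUpTo_last, alternatingUpTo_zero, pow_zero, one_smul]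

theorem boundary_word_alternating (n : ℕ) :
    (wordModule k A).boundary (2 * n) (word k (alternating a b (2 * n + 1))) =
      (wordModule k A).rotate (2 * n) (word k (alternating b a (2 * n))) -
        word k (alternating b a (2 * n)) := by
  have face_first := face_word_alternating k (hba.trans (by rw [add_comm]))
    (hab.trans (by rw [add_comm])) (0 : Fin (2 * n + 1))
  rw [Fin.val_zero, zero_add, alternatingUpTo_zero] at face_first
  rw [boundary_eq_barBoundary_add, barBoundary_word_alternating k hab hba,
    rotate_word_alternating_odd, map_neg, face_first, rotate_word_alternating_even,
    (odd_two_mul_add_one n).neg_one_pow]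
  module

end CommRing

variable (k : Type*) [CommRing k]

/-- The coefficient of degree `2n + 1` in the Chern character of an invertible element. -/
def invertibleCoeff (n : ℕ) : k := (-1) ^ n * (n.factorial : k)

theorem invertibleCoeff_succ (n : ℕ) :
    invertibleCoeff k (n + 1) = -((n + 1) * invertibleCoeff k n) := by
  rw [invertibleCoeff, invertibleCoeff, Nat.factorial_succ]
  push_cast
  ring

variable [Module k A]

/-- The Chern character of an invertible element `1 + b` with inverse `1 + a`, as a formal chain of
words in `a` and `b`. -/
def invertibleChern (a b : A) : FormalChain (Word k A) :=
  (fun m => (if Even m then 0 else invertibleCoeff k (m / 2)) • word k (alternating a b m),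
    fun m => (if Even m then invertibleCoeff k (m / 2) else 0) • word k (alternating b a m))

section Components

variable (a b : A) (n : ℕ)

theorem invertibleChern_fst_even : (invertibleChern k a b).1 (2 * n) = 0 := by
  simp only [invertibleChern, if_pos (even_two_mul n), zero_smul]

theorem invertibleChern_fst_odd : (invertibleChern k a b).1 (2 * n + 1) =
    invertibleCoeff k n • word k (alternating a b (2 * n + 1)) := by
  simp only [invertibleChern, if_neg (Nat.not_even_two_mul_add_one n),
    show (2 * n + 1) / 2 = n by omega]

theorem invertibleChern_snd_even : (invertibleChern k a b).2 (2 * n) =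
    invertibleCoeff k n • word k (alternating b a (2 * n)) := by
  simp only [invertibleChern, if_pos (even_two_mul n), Nat.mul_div_cancel_left n two_pos]

theorem invertibleChern_snd_odd : (invertibleChern k a b).2 (2 * n + 1) = 0 := by
  simp only [invertibleChern, if_neg (Nat.not_even_two_mul_add_one n), zero_smul]

end Components

theorem differential_invertibleChern [IsScalarTower k A A] [SMulCommClass k A A] {a b : A}
    (hab : a * b = -(a + b)) (hba : b * a = -(a + b)) :
    (wordModule k A).differential (invertibleChern k a b) = 0 := by
  have fst_succ (n : ℕ) : (invertibleChern k a b).1 (2 * n + 1 + 1) = 0 :=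
    invertibleChern_fst_even k a b (n + 1)
  have snd_succ (n : ℕ) : (invertibleChern k a b).2 (2 * n + 1 + 1) =
      invertibleCoeff k (n + 1) • word k (alternating b a (2 * n + 1 + 1)) :=
    invertibleChern_snd_even k a b (n + 1)
  refine Prod.ext (funext fun m => ?_) (funext fun m => ?_) <;>
    rcases Nat.even_or_odd' m with ⟨n, rfl | rfl⟩
  · rw [differential_fst, invertibleChern_fst_odd, invertibleChern_snd_even, map_smul, map_smul,
      boundary_word_alternating k hab hba]
    change _ = (0 : Word k A _)
    module
  · simp [differential_fst, fst_succ, invertibleChern_snd_odd]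
  · simp [differential_snd, invertibleChern_fst_even, invertibleChern_snd_odd]
  · rw [differential_snd, invertibleChern_fst_odd, snd_succ, map_smul, map_smul,
      norm_word_alternating, barBoundary_word_alternating k (hba.trans (by rw [add_comm]))
        (hab.trans (by rw [add_comm])), Even.neg_one_pow ⟨n + 1, by ring⟩, invertibleCoeff_succ]
    change _ = (0 : Word k A _)
    module

end Invertible

end Cycles

section Trace

open PrecyclicModule Word

variable {k A ι : Type*} {m : ℕ}

theorem insertNth_one_zero (x : ι) (i : Fin (m + 1) → ι) :
    (Fin.insertNth 1 x i : Fin (m + 2) → ι) 0 = i 0 :=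
  Fin.insertNth_apply_succAbove (α := fun _ => ι) 1 x i 0

theorem insertNth_one_succ_succ (x : ι) (i : Fin (m + 1) → ι) (j : Fin m) :
    (Fin.insertNth 1 x i : Fin (m + 2) → ι) j.succ.succ = i j.succ :=
  Fin.insertNth_apply_succAbove (α := fun _ => ι) 1 x i j.succ

theorem insertNth_one_succ_add_one (x : ι) (i : Fin (m + 1) → ι) (j : Fin (m + 1)) :
    (Fin.insertNth 1 x i : Fin (m + 2) → ι) (j.succ + 1) = i (j + 1) := by
  induction j using Fin.lastCases with
  | last => rw [Fin.succ_last, Fin.last_add_one, Fin.last_add_one, insertNth_one_zero]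
  | cast j =>
    rw [Fin.succ_castSucc, Fin.coeSucc_eq_succ, Fin.coeSucc_eq_succ, insertNth_one_succ_succ]

/-- The entries of a cyclic word of matrices along a closed path of indices. -/
def cyclicEntries (M : Fin (m + 1) → Matrix ι ι A) (i : Fin (m + 1) → ι) : Fin (m + 1) → A :=
  fun j => M j (i j) (i (j + 1))

theorem mergeAt_zero_cyclicEntries_insertNth [Fintype ι] [NonUnitalNonAssocSemiring A]
    (M : Fin (m + 2) → Matrix ι ι A) (i : Fin (m + 1) → ι) (x : ι) :
    mergeAt (· * ·) 0 (cyclicEntries M (Fin.insertNth 1 x i)) =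
      update (cyclicEntries (mergeAt (· * ·) 0 M) i) 0 (M 0 (i 0) x * M 1 x (i (0 + 1))) := by
  have next := insertNth_one_succ_add_one x i
  funext j
  induction j using Fin.cases with
  | zero =>
    rw [update_self, mergeAt_self, cyclicEntries, cyclicEntries, next, Fin.coeSucc_eq_succ,
      Fin.castSucc_zero, insertNth_one_zero, Fin.succ_zero_eq_one, Fin.insertNth_apply_same]
  | succ j =>
    rw [update_of_ne (Fin.succ_ne_zero j)]
    change Fin.tail (mergeAt _ 0 _) j = Fin.tail (mergeAt _ 0 M) j _ _
    rw [tail_mergeAt_zero, tail_mergeAt_zero]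
    change M j.succ.succ _ _ = M j.succ.succ _ _
    rw [next, insertNth_one_succ_succ]

variable [CommRing k] [NonUnitalRing A] [Module k A] [Fintype ι]

variable (k A ι) in
/-- The generalized trace of words of matrices. -/
def traceWord (m : ℕ) : Word k (Matrix ι ι A) m →ₗ[k] Word k A m :=
  ∑ i : Fin (m + 1) → ι,
    PiTensorProduct.map fun j => Matrix.entryLinearMap k A (i j) (i (j + 1))

theorem traceWord_word (M : Fin (m + 1) → Matrix ι ι A) :
    traceWord k A ι m (word k M) = ∑ i : Fin (m + 1) → ι, word k (cyclicEntries M i) := by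
  rw [traceWord, LinearMap.sum_apply]
  exact Finset.sum_congr rfl fun i _ => PiTensorProduct.map_tprod _ _

theorem traceWord_rotate (x : Word k (Matrix ι ι A) m) :
    traceWord k A ι m (Word.rotate k (Matrix ι ι A) m x) =
      Word.rotate k A m (traceWord k A ι m x) := by
  refine Word.hom_congr (f := traceWord k A ι m ∘ₗ Word.rotate k (Matrix ι ι A) m)
    (g := Word.rotate k A m ∘ₗ traceWord k A ι m) (fun M => ?_) x
  rw [LinearMap.comp_apply, LinearMap.comp_apply, Word.rotate_word, map_smul, traceWord_word,
    traceWord_word, map_sum, Finset.smul_sum,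
    ← Equiv.sum_comp ((Equiv.subRight (1 : Fin (m + 1))).symm.arrowCongr (Equiv.refl ι))]
  refine Finset.sum_congr rfl fun i _ => ?_
  rw [Word.rotate_word]
  congr 2
  funext j
  simp [cyclicEntries, Equiv.arrowCongr]

variable [IsScalarTower k A A] [SMulCommClass k A A]

theorem traceWord_mulFirst (x : Word k (Matrix ι ι A) (m + 1)) :
    traceWord k A ι m (mulFirst k (Matrix ι ι A) m x) =
      mulFirst k A m (traceWord k A ι (m + 1) x) := by
  refine Word.hom_congr (f := traceWord k A ι m ∘ₗ mulFirst k (Matrix ι ι A) m)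
    (g := mulFirst k A m ∘ₗ traceWord k A ι (m + 1)) (fun M => ?_) x
  have product_entry (i : Fin (m + 1) → ι) : cyclicEntries (mergeAt (· * ·) 0 M) i 0 =
      ∑ x, M 0 (i 0) x * M 1 x (i (0 + 1)) := by
    rw [cyclicEntries, mergeAt_self]
    exact Matrix.mul_apply
  symm
  rw [LinearMap.comp_apply, LinearMap.comp_apply, mulFirst_word, traceWord_word, traceWord_word,
    map_sum, ← Equiv.sum_comp (Fin.insertNthEquiv (fun _ => ι) 1), Fintype.sum_prod_type_right]
  refine Fintype.sum_congr _ _ fun i => ?_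
  rw [← update_eq_self 0 (cyclicEntries (mergeAt _ 0 M) i), product_entry, word,
    MultilinearMap.map_update_sum]
  refine Fintype.sum_congr _ _ fun a => ?_
  rw [mulFirst_word]
  exact congrArg _ (mergeAt_zero_cyclicEntries_insertNth M i a)

variable (k A ι) in
/-- The generalized trace, as a morphism of precyclic modules. -/
def trace : (wordModule k (Matrix ι ι A)).Hom (wordModule k A) where
  toFun := traceWord k A ι
  map_rotate _ := traceWord_rotate
  map_mul _ := traceWord_mulFirst

end Trace

section Inverse

variable {A : Type*} [NonUnitalRing A] {N : ℕ} {one U W : Matrix (Fin N) (Fin N) A}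

theorem IsInverse.symm (h : IsInverse one U W) :
    IsInverse one W U :=
  ⟨h.one_mul, h.mul_one, h.inv_mul, h.mul_inv⟩

theorem IsInverse.sub_mul_sub (h : IsInverse one U W) :
    (U - one) * (W - one) = -((U - one) + (W - one)) := by
  rw [sub_mul, mul_sub, mul_sub, h.mul_inv, h.mul_one, h.one_mul, h.one_mul]
  abel

end Inverse

section ChernCharacters

universe u

open PrecyclicModule Word

variable {R : Type} {A : Type u} [CommRing R] [Algebra ℂ R] [TopologicalSpace R]
  [NonUnitalRing A] [Module R A] [TopologicalSpace A] {N : ℕ}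

theorem genTrace_add {m : ℕ} (M₀ M₁ : Matrix (Fin N) (Fin N) (Hd R A m))
    (M : Fin m → Matrix (Fin N) (Fin N) A) :
    genTrace m (M₀ + M₁) M = genTrace m M₀ M + genTrace m M₁ M := by
  simp only [genTrace, Matrix.add_apply, cls_head_add, UniformSpace.Completion.coe_add,
    Finset.sum_add_distrib]

section Trace

theorem cons_self_succ_add_one {α : Type*} {m : ℕ} (i : Fin (m + 1) → α) (j : Fin (m + 1)) :
    (Fin.cons (i 0) i : Fin (m + 2) → α) (j.succ + 1) = i (j + 1) := by
  induction j using Fin.lastCases with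
  | last => rw [Fin.succ_last, Fin.last_add_one, Fin.last_add_one, Fin.cons_zero]
  | cast j => rw [Fin.succ_castSucc, Fin.coeSucc_eq_succ, Fin.coeSucc_eq_succ, Fin.cons_succ]

variable [Module ℂ A] [IsScalarTower ℂ R A]

theorem genTrace_map_ofA {m : ℕ} (M : Fin (m + 1) → Matrix (Fin N) (Fin N) A) :
    genTrace m ((M 0).map (Hd.ofA m)) (Fin.tail M) =
      UniformSpace.Completion.toCompl (toChain R A m (traceWord ℂ A (Fin N) m (word ℂ M))) := by
  rw [traceWord_word, map_sum, map_sum, genTrace]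
  refine Fintype.sum_congr _ _ fun i => ?_
  rw [toChain_word]
  rfl

theorem genTrace_eMat {m : ℕ} (M : Fin (m + 1) → Matrix (Fin N) (Fin N) A) :
    genTrace (m + 1) (eMat R A N m) M =
      UniformSpace.Completion.toCompl (toUnitChain R A m (traceWord ℂ A (Fin N) m (word ℂ M))) := by
  rw [traceWord_word, map_sum, map_sum, genTrace, ← Equiv.sum_comp (Fin.consEquiv fun _ => Fin N),
    Fintype.sum_prod_type_right]
  refine Fintype.sum_congr _ _ fun i => ?_
  change (∑ a, (cls (eMat R A N m a (i 0))
    fun j => M j (i j) ((Fin.cons a i : Fin (m + 2) → Fin N) (j.succ + 1)) : Chain R A (m + 1))) = _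
  rw [Finset.sum_eq_single_of_mem (i 0) (Finset.mem_univ _) fun a _ ha => ?offDiagonal,
    toUnitChain_word]
  case offDiagonal =>
    have entry : eMat R A N m a (i 0) = 0 := if_neg ha
    rw [entry, cls_head_zero, UniformSpace.Completion.coe_zero]
  have unit_entry : eMat R A N m (i 0) (i 0) = Hd.e m := if_pos rfl
  simp only [unit_entry, cons_self_succ_add_one]
  rfl

variable [IsScalarTower ℂ A A] [SMulCommClass ℂ A A]

theorem Chain.ofFormal_succ_mapChain_trace {m : ℕ}
    {z : FormalChain (Word ℂ (Matrix (Fin N) (Fin N) A))} {c d : ℂ}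
    {M : Fin (m + 2) → Matrix (Fin N) (Fin N) A} {M' : Fin (m + 1) → Matrix (Fin N) (Fin N) A}
    (hM : z.1 (m + 1) = c • word ℂ M) (hM' : z.2 m = d • word ℂ M') :
    Chain.ofFormal R A (m + 1) ((trace ℂ A (Fin N)).mapChain z) =
      c • genTrace (m + 1) ((M 0).map (Hd.ofA (m + 1))) (Fin.tail M) +
        d • genTrace (m + 1) (eMat R A N m) M' := by
  rw [genTrace_map_ofA, genTrace_eMat]
  change UniformSpace.Completion.toCompl
    (toChain R A (m + 1) (traceWord ℂ A (Fin N) (m + 1) (z.1 (m + 1))) +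
      toUnitChain R A m (traceWord ℂ A (Fin N) m (z.2 m))) = _
  rw [hM, hM', map_add]
  simp only [map_smul]
  exact congrArg₂ _ (UniformSpace.Completion.coe_smul _ _) (UniformSpace.Completion.coe_smul _ _)

theorem chP_eq_evenChain (P : Matrix (Fin N) (Fin N) A) :
    chP R P = evenChain R A ((trace ℂ A (Fin N)).mapChain (idempotentChern ℂ P)) := by
  funext n
  cases n with
  | zero =>
    refine (genTrace_map_ofA fun _ : Fin 1 => P).trans (congrArg _ ?_)
    change _ = toChain R A 0 (traceWord ℂ A (Fin N) 0 ((idempotentChern ℂ P).1 (2 * 0)))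
    rw [idempotentChern_fst_even, idempotentCoeff]
    simp
  | succ n =>
    refine Eq.trans ?_ (Chain.ofFormal_succ_mapChain_trace (idempotentChern_fst_even ℂ P (n + 1))
      (idempotentChern_snd_odd ℂ P n)).symm
    rw [chP, idempotentCoeff, smul_sub, smul_smul, sub_eq_add_neg, ← neg_smul, ← mul_neg,
      mul_comm (-(1 / 2 : ℂ))]
    rfl

theorem chU_eq_oddChain (one U W : Matrix (Fin N) (Fin N) A) :
    chU R one U W =
      oddChain R A ((trace ℂ A (Fin N)).mapChain (invertibleChern ℂ (W - one) (U - one))) := by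
  funext n
  refine Eq.trans ?_ (Chain.ofFormal_succ_mapChain_trace
    (invertibleChern_fst_odd ℂ (W - one) (U - one) n)
    (invertibleChern_snd_even ℂ (W - one) (U - one) n)).symm
  have tail_alternating : Fin.tail (alternating (W - one) (U - one) (2 * n + 1)) =
      alternating (U - one) (W - one) (2 * n) := by
    funext i
    simp only [Fin.tail, alternating, Fin.val_succ, Nat.even_add_one, ite_not]
  rw [chU, genTrace_add, smul_add, tail_alternating]
  rfl

end Trace

end ChernCharacters

section ParallelChernCharacters

universe u

variable {R : Type} {A : Type u} [CommRing R] [Algebra ℂ R] [TopologicalSpace R]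
  [NonUnitalRing A] [Module R A] [TopologicalSpace A] [IsTopologicalAddGroup A] [ContinuousMul A]
  [ContinuousSMul R A] [IsTopologicalAddGroup R] [IsScalarTower R A A] [SMulCommClass R A A]
  [Module ℂ A] [IsScalarTower ℂ R A]

theorem mainTheorem2_general {δ : ContDerivation R} (D : Connection δ A) :
    ∃ hGM : D.IsChainMap,
      (∀ (N : ℕ) (P : Matrix (Fin N) (Fin N) A), P * P = P →
        ∃ hP : dEven R A (chP R P) = 0, hGM.gmHP0 (HP0.mk (chP R P) hP) = 0) ∧
      (∀ (N : ℕ) (one U W : Matrix (Fin N) (Fin N) A), IsInverse one U W →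
        ∃ hU : dOdd R A (chU R one U W) = 0, hGM.gmHP1 (HP1.mk (chU R one U W) hU) = 0) := by
  have : IsScalarTower ℂ A A :=
    ⟨fun c a b => by simp only [← algebraMap_smul R c, smul_eq_mul, smul_mul_assoc]⟩
  have : SMulCommClass ℂ A A :=
    ⟨fun c a b => by simp only [← algebraMap_smul R c, smul_eq_mul, mul_smul_comm]⟩
  refine ⟨D.isChainMap, fun N P hP => ?_, fun N one U W hU => ?_⟩
  · have cycle : (wordModule ℂ A).differential
        ((trace ℂ A (Fin N)).mapChain (idempotentChern ℂ P)) = 0 := by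
      rw [PrecyclicModule.Hom.differential_mapChain, differential_idempotentChern ℂ hP, map_zero]
    simpa only [chP_eq_evenChain] using D.isChainMap.gmHP0_evenChain cycle
  · have cycle : (wordModule ℂ A).differential
        ((trace ℂ A (Fin N)).mapChain (invertibleChern ℂ (W - one) (U - one))) = 0 := by
      rw [PrecyclicModule.Hom.differential_mapChain, differential_invertibleChern ℂ
        hU.symm.sub_mul_sub (by rw [hU.sub_mul_sub, add_comm]), map_zero]
    simpa only [chU_eq_oddChain] using D.isChainMap.gmHP1_oddChain cycle

end ParallelChernCharacters

end GaussManin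

end

open GaussManin in
theorem mainTheorem2 {X : Type*} [AddCommGroup X] [Module ℂ X] [UniformSpace X]
    [IsUniformAddGroup X] [ContinuousSMul ℂ X] [LocallyConvexSpace ℝ X] [CompleteSpace X]
    [T2Space X] (J : TopologicalSpace.Opens ℝ) (hJ : (J : Set ℝ).OrdConnected)
    (hJne : (J : Set ℝ).Nonempty) (D : SmoothDeformation J X)
    (nabla : Connection (ddt J) (Sections D)) :
    ∃ hGM : nabla.IsChainMap,
      (∀ (N : ℕ) (P : Matrix (Fin N) (Fin N) (Sections D)), P * P = P →
        ∃ hP : dEven (CJ J) (Sections D) (chP (CJ J) P) = 0,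
          hGM.gmHP0 (HP0.mk (chP (CJ J) P) hP) = 0) ∧
      (∀ (N : ℕ) (one U W : Matrix (Fin N) (Fin N) (Sections D)), IsInverse one U W →
        ∃ hU : dOdd (CJ J) (Sections D) (chU (CJ J) one U W) = 0,
          hGM.gmHP1 (HP1.mk (chU (CJ J) one U W) hU) = 0) :=
  mainTheorem2_general nabla
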